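/- **Definitions.** Let $E=\mathbb{C}^2$ be the natural representation of $\mathrm{SL}_2(\mathbb{C})$ and let $\mathbb{N}=\{1,2,\ldots\}$. For a partition $\lambda$ write $\ell(\lambda)$ for its number of parts, $\lambda'$ for its conjugate and $\nabla^\lambda$ for the Schur functor: $\nabla^\lambda V$ is the span in $\bigotimes_i \mathrm{Sym}^{\lambda_i}V$ of the elements $\sum_{\tau}\mathrm{sgn}(\tau)\bigotimes_i\prod_{j} t(\tau^{-1}(i,j))$, where $t$ runs over the fillings of the Young diagram of $\lambda$ by vectors of $V$ and $\tau$ over the permutations of its boxes that preserve each column. For non-empty partitions $\lambda,\mu$ and $\ell,m\in\mathbb{N}$ with $\ell\ge\ell(\lambda)-1$ and $m\ge\ell(\mu)-1$, write $\lambda\,{}_{\ell}\!\sim_{m}\mu$ (a *plethystic equivalence*) if $\nabla^\lambda\mathrm{Sym}^\ell E\cong\nabla^\mu\mathrm{Sym}^m E$ as representations of $\mathrm{SL}_2(\mathbb{C})$. It is *prime* if moreover $\ell\ge\ell(\lambda)$ and $m\ge\ell(\mu)$. For a non-empty partition $\lambda$ let $d$ be the greatest $r$ with $\lambda_r\ge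 r$, and let $s\ge 0$ be the number of $j\ge1$ with $\lambda_{d+j}=d$. The *south-partition* of $\lambda$ is $\mathsf{S}(\lambda)=(\lambda_{d+s+1},\ldots,\lambda_{\ell(\lambda)})$, and the *east-partition* is $\mathsf{E}(\lambda)=\mathsf{S}(\lambda')'$. **Theorem 1.4.** Let $\lambda$ and $\mu$ be non-empty partitions. (i) There are two distinct pairs $(\ell,m)$, $(\ell^\dagger,m^\dagger)$ such that $\lambda\,{}_{\ell}\!\sim_{m}\mu$ and $\lambda\,{}_{\ell^\dagger}\!\sim_{m^\dagger}\mu$ are prime plethystic equivalences if and only if either $\lambda=\mu$, or $\mathsf{E}(\lambda)=\mathsf{S}(\lambda)'$ and $\lambda=\mu'$. (ii) There are three distinct pairs $(\ell,m)$, $(\ell^\dagger,m^\dagger)$, $(\ell^\ddagger,m^\ddagger)$ such that $\lambda\,{}_{\ell}\!\sim_{m}\mu$, $\lambda\,{}_{\ell^\dagger}\!\sim_{m^\dagger}\mu$ and $\lambda\,{}_{\ell^\ddagger}\!\sim_{m^\ddagger}\mu$ if and only if either $\lambda=\mu$, or $\mathsf{E}(\lambda)=\mathsf{S}(\lambda)'$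 and $\lambda=\mu'$. (iii) There exist distinct $n,n^\dagger\in\mathbb{N}$ such that $\lambda\,{}_{n}\!\sim_{n}\mu$ and $\lambda\,{}_{n^\dagger}\!\sim_{n^\dagger}\mu$ if and only if $\lambda=\mu$. -/

import Mathlib

open scoped TensorProduct

noncomputable section

namespace Plethysm

/-! ### Partitions

A partition is a Mathlib `YoungDiagram`, with boxes `(i, j)` indexed from `0` (row `i`, column `j`).
The part `λ_{i+1}` is `lam.rowLen i`, the number of parts `ℓ(λ)` is `lam.colLen 0`, the conjugate
partition is `lam.transpose`, and the empty partition is `⊥`. -/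

/-- The rank of a partition: the greatest `r` such that the `r`-th part is at least `r`,
that is, the side length of the Durfee square. -/
def rank (lam : YoungDiagram) : ℕ :=
  Nat.findGreatest (fun r => r ≤ lam.rowLen (r - 1)) (lam.colLen 0)

/-- The south-rank: with `d` the rank, the greatest `j` such that the `(d + j)`-th part equals `d`
(and `0` if there is no such `j`). -/
def southRank (lam : YoungDiagram) : ℕ :=
  Nat.findGreatest (fun j => lam.rowLen (rank lam + j - 1) = rank lam) (lam.colLen 0)

/-- The partition obtained by deleting the first `k` parts. -/
def dropRows (lam : YoungDiagram) (k : ℕ) : YoungDiagram :=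
  YoungDiagram.ofRowLens (lam.rowLens.drop k)
    (lam.rowLens_sorted.pairwise.sublist (List.drop_sublist k _)).sortedGE

/-- The south-partition: the parts strictly after position `d + southRank`, `d` the rank. -/
def southPartition (lam : YoungDiagram) : YoungDiagram :=
  dropRows lam (rank lam + southRank lam)

/-- The east-partition: the conjugate of the south-partition of the conjugate. -/
def eastPartition (lam : YoungDiagram) : YoungDiagram :=
  (southPartition lam.transpose).transpose

/-! ### Symmetric powers of a representation -/

section Representations

variable {G V W U : Type*} [Group G] [AddCommGroup V] [Module ℂ V] [AddCommGroup W] [Module ℂ W]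
  [AddCommGroup U] [Module ℂ U]

/-- Functoriality of the symmetric algebra. -/
def symMap (f : V →ₗ[ℂ] W) : SymmetricAlgebra ℂ V →ₐ[ℂ] SymmetricAlgebra ℂ W :=
  SymmetricAlgebra.lift (SymmetricAlgebra.ι ℂ W ∘ₗ f)

@[simp]
theorem symMap_ι (f : V →ₗ[ℂ] W) (v : V) :
    symMap f (SymmetricAlgebra.ι ℂ V v) = SymmetricAlgebra.ι ℂ W (f v) := by
  simp [symMap]

theorem symMap_one : symMap (1 : V →ₗ[ℂ] V) = AlgHom.id ℂ _ := by
  apply SymmetricAlgebra.algHom_ext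
  ext v
  simp

theorem symMap_comp (g : W →ₗ[ℂ] U) (f : V →ₗ[ℂ] W) :
    symMap (g ∘ₗ f) = (symMap g).comp (symMap f) := by
  apply SymmetricAlgebra.algHom_ext
  ext v
  simp

/-- The action of `G` on the symmetric algebra of a representation, by algebra maps. -/
def symAlgRep (ρ : Representation ℂ G V) : Representation ℂ G (SymmetricAlgebra ℂ V) where
  toFun g := (symMap (ρ g)).toLinearMap
  map_one' := by
    rw [map_one, symMap_one]
    rfl
  map_mul' g h := by
    rw [map_mul, Module.End.mul_eq_comp, symMap_comp]
    rfl

/-- The symmetric power `Sym^n V`, as the subrepresentation of the symmetric algebra that is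
spanned by the products of `n` elements of `V`. -/
def symPower (ρ : Representation ℂ G V) (n : ℕ) : Subrepresentation (symAlgRep ρ) where
  toSubmodule := LinearMap.range (SymmetricAlgebra.ι ℂ V) ^ n
  apply_mem_toSubmodule g v hv := by
    have h : (LinearMap.range (SymmetricAlgebra.ι ℂ V) ^ n).map (symMap (ρ g)).toLinearMap
        ≤ LinearMap.range (SymmetricAlgebra.ι ℂ V) ^ n := by
      rw [Submodule.map_pow]
      refine pow_le_pow_left' ?_ n
      rintro _ ⟨_, ⟨v, rfl⟩, rfl⟩
      exact ⟨ρ g v, (symMap_ι (ρ g) v).symm⟩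
    exact h (Submodule.mem_map_of_mem hv)

/-- The representation of `G` on `Sym^n V`. -/
def symRep (ρ : Representation ℂ G V) (n : ℕ) :
    Representation ℂ G (symPower ρ n).toSubmodule :=
  (symPower ρ n).toRepresentation

/-! ### Schur functors -/

variable (V) in
/-- The tensor product, over the rows of `lam`, of copies of the symmetric algebra of `V`. It
contains the tensor product of the symmetric powers `Sym^{λ_i} V`. -/
abbrev RowTensor (lam : YoungDiagram) : Type _ :=
  ⨂[ℂ] _ : Fin (lam.colLen 0), SymmetricAlgebra ℂ V

/-- For a filling `t` of the boxes of `lam` by vectors of `V`, the element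
`f(t) = ⨂_i ∏_j t(i,j)` of `⨂_i Sym^{λ_i} V`. -/
def tabloid (lam : YoungDiagram) (t : lam.cells → V) : RowTensor V lam :=
  ⨂ₜ[ℂ] i : Fin (lam.colLen 0),
    ∏ c : lam.cells with c.1.1 = (i : ℕ), SymmetricAlgebra.ι ℂ V (t c)

/-- The group of permutations of the boxes of `lam` that preserve every column, as a finset. -/
def columnPerms (lam : YoungDiagram) : Finset (Equiv.Perm lam.cells) :=
  Finset.univ.filter fun τ => ∀ c, (τ c).1.2 = c.1.2

/-- The polytabloid `F(t) = ∑_τ sgn(τ) f(τ · t)`, the sum being over all column-preserving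
permutations `τ` of the boxes, where `(τ · t)(c) = t(τ⁻¹ c)`. -/
def polytabloid (lam : YoungDiagram) (t : lam.cells → V) : RowTensor V lam :=
  ∑ τ ∈ columnPerms lam,
    ((Equiv.Perm.sign τ : ℤ) : ℂ) • tabloid lam (fun c => t (τ⁻¹ c))

/-- The map on `RowTensor` induced by a linear map. -/
def rowMap (lam : YoungDiagram) (f : V →ₗ[ℂ] W) : RowTensor V lam →ₗ[ℂ] RowTensor W lam :=
  PiTensorProduct.map fun _ => (symMap f).toLinearMap

theorem rowMap_tabloid (lam : YoungDiagram) (f : V →ₗ[ℂ] W) (t : lam.cells → V) :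
    rowMap lam f (tabloid lam t) = tabloid lam (fun c => f (t c)) := by
  simp [rowMap, tabloid, map_prod]

theorem rowMap_polytabloid (lam : YoungDiagram) (f : V →ₗ[ℂ] W) (t : lam.cells → V) :
    rowMap lam f (polytabloid lam t) = polytabloid lam (fun c => f (t c)) := by
  simp [polytabloid, rowMap_tabloid]

theorem rowMap_one (lam : YoungDiagram) : rowMap lam (1 : V →ₗ[ℂ] V) = 1 := by
  apply PiTensorProduct.ext
  ext a
  simp [rowMap, symMap_one]

theorem rowMap_comp (lam : YoungDiagram) (g : W →ₗ[ℂ] U) (f : V →ₗ[ℂ] W) :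
    rowMap lam (g ∘ₗ f) = rowMap lam g ∘ₗ rowMap lam f := by
  apply PiTensorProduct.ext
  ext a
  simp [rowMap, symMap_comp]

/-- The diagonal action of `G` on `RowTensor V lam`. -/
def rowRep (ρ : Representation ℂ G V) (lam : YoungDiagram) :
    Representation ℂ G (RowTensor V lam) where
  toFun g := rowMap lam (ρ g)
  map_one' := by
    rw [map_one, rowMap_one]
  map_mul' g h := by
    rw [map_mul, Module.End.mul_eq_comp, rowMap_comp]
    rfl

/-- The Schur functor `∇^λ` applied to a representation `V`: the span of the polytabloids `F(t)`
inside `⨂_i Sym^{λ_i} V`. As `F` is multilinear in the entries of `t`, it makes no difference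
whether these range over `V` or over a basis of `V`. -/
def schurFunctor (lam : YoungDiagram) (ρ : Representation ℂ G V) :
    Subrepresentation (rowRep ρ lam) where
  toSubmodule := Submodule.span ℂ (Set.range (polytabloid (V := V) lam))
  apply_mem_toSubmodule g v hv := by
    have h : (Submodule.span ℂ (Set.range (polytabloid (V := V) lam))).map (rowMap lam (ρ g))
        ≤ Submodule.span ℂ (Set.range (polytabloid (V := V) lam)) := by
      rw [Submodule.map_span, Submodule.span_le]
      rintro _ ⟨_, ⟨t, rfl⟩, rfl⟩
      exact Submodule.subset_span ⟨_, (rowMap_polytabloid lam (ρ g) t).symm⟩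
    exact h (Submodule.mem_map_of_mem hv)

/-- The representation of `G` on `∇^λ V`. -/
def schurRep (lam : YoungDiagram) (ρ : Representation ℂ G V) :
    Representation ℂ G (schurFunctor lam ρ).toSubmodule :=
  (schurFunctor lam ρ).toRepresentation

end Representations

/-! ### Plethystic equivalence -/

/-- The natural representation `E = ℂ²` of `SL₂(ℂ)`. -/
def natRep : Representation ℂ (Matrix.SpecialLinearGroup (Fin 2) ℂ) (Fin 2 → ℂ) where
  toFun g := Matrix.toLin' (g : Matrix (Fin 2) (Fin 2) ℂ)
  map_one' := by simp [Module.End.one_eq_id]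
  map_mul' g h := by simp [Matrix.toLin'_mul, Module.End.mul_eq_comp]

/-- The representation `∇^λ Sym^l E` of `SL₂(ℂ)`. -/
abbrev schurSymRep (lam : YoungDiagram) (l : ℕ) :=
  schurRep lam (symRep natRep l)

/-- Plethystic equivalence of the partitions `lam` and `mu` with respect to the pair `(l, m)`:
`l` and `m` are positive integers with `l ≥ ℓ(lam) - 1` and `m ≥ ℓ(mu) - 1`, and
`∇^lam Sym^l E ≅ ∇^mu Sym^m E` as representations of `SL₂(ℂ)`. -/
def PlethysticEquiv (lam mu : YoungDiagram) (l m : ℕ) : Prop :=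
  0 < l ∧ 0 < m ∧ lam.colLen 0 ≤ l + 1 ∧ mu.colLen 0 ≤ m + 1 ∧
    Nonempty ((schurSymRep lam l).Equiv (schurSymRep mu m))

/-- A plethystic equivalence is prime if moreover `l ≥ ℓ(lam)` and `m ≥ ℓ(mu)`. -/
def PrimePlethysticEquiv (lam mu : YoungDiagram) (l m : ℕ) : Prop :=
  PlethysticEquiv lam mu l m ∧ lam.colLen 0 ≤ l ∧ mu.colLen 0 ≤ m

end Plethysm

end

noncomputable section

namespace Plethysm

section ModuleTrace

variable {k A V W : Type*} [Field k] [Ring A] [Algebra k A]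
  [AddCommGroup V] [Module k V] [Module A V] [IsScalarTower k A V]
  [AddCommGroup W] [Module k W] [Module A W] [IsScalarTower k A W]

variable (k V) in
/-- The trace of the action of an element of an algebra on a module. -/
def moduleTrace (a : A) : k := LinearMap.trace k V (Algebra.lsmul k k V a)

theorem moduleTrace_congr (e : V ≃ₗ[A] W) (a : A) : moduleTrace k V a = moduleTrace k W a := by
  rw [moduleTrace, moduleTrace, ← LinearMap.trace_conj' _ (e.restrictScalars k)]
  congr 1
  ext w
  simp [LinearEquiv.conj_apply]

theorem moduleTrace_prod [FiniteDimensional k V] [FiniteDimensional k W] (a : A) :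
    moduleTrace k (V × W) a = moduleTrace k V a + moduleTrace k W a := by
  rw [moduleTrace, moduleTrace, moduleTrace, ← LinearMap.trace_prodMap']
  rfl

theorem moduleTrace_of_isCompl [FiniteDimensional k V] {V₁ V₂ : Submodule A V}
    (h : IsCompl V₁ V₂) (a : A) :
    moduleTrace k V a = moduleTrace k V₁ a + moduleTrace k V₂ a := by
  have : FiniteDimensional k V₁ :=
    inferInstanceAs (FiniteDimensional k (V₁.restrictScalars k))
  have : FiniteDimensional k V₂ :=
    inferInstanceAs (FiniteDimensional k (V₂.restrictScalars k))
  rw [← moduleTrace_prod]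
  exact (moduleTrace_congr (Submodule.prodEquivOfIsCompl V₁ V₂ h) a).symm

omit [Algebra k A] [Module k V] [IsScalarTower k A V] [Module k W] [IsScalarTower k A W] in
theorem exists_isCompl_of_hom_ne_zero [IsSemisimpleModule A V] [IsSemisimpleModule A W]
    {f : V →ₗ[A] W} (hf : f ≠ 0) :
    ∃ (V₁ V₂ : Submodule A V) (W₁ W₂ : Submodule A W), IsCompl V₁ V₂ ∧ IsCompl W₁ W₂ ∧
      V₂ ≠ ⊤ ∧ Nonempty (V₁ ≃ₗ[A] W₁) := by
  obtain ⟨V₁, hV⟩ := exists_isCompl (LinearMap.ker f)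
  obtain ⟨W₂, hW⟩ := exists_isCompl (LinearMap.range f)
  refine ⟨V₁, LinearMap.ker f, LinearMap.range f, W₂, hV.symm, hW, ?_, ?_⟩
  · rwa [Ne, LinearMap.ker_eq_top]
  · exact ⟨(Submodule.quotientEquivOfIsCompl _ _ hV).symm.trans f.quotKerEquivRange⟩

/-- Two semisimple modules without nonzero maps between them and with the same traces vanish. -/
theorem subsingleton_of_moduleTrace_eq [CharZero k] [FiniteDimensional k V]
    [FiniteDimensional k W] [IsSemisimpleModule A V] [IsSemisimpleModule A W]
    (h : ∀ a : A, moduleTrace k V a = moduleTrace k W a)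
    (hVW : ∀ f : V →ₗ[A] W, f = 0) (hWV : ∀ f : W →ₗ[A] V, f = 0) : Subsingleton V := by
  let p : Module.End (Module.End A (V × W)) (V × W) :=
    { toFun := fun x => (x.1, 0)
      map_add' := fun x y => by simp
      map_smul' := fun f x => by
        have h1 : ((f (x.1, 0)).2 : W) = 0 := by
          have := hVW (LinearMap.snd A V W ∘ₗ f ∘ₗ LinearMap.inl A V W)
          exact congr($this x.1)
        have h2 : ((f (0, x.2)).1 : V) = 0 := by
          have := hWV (LinearMap.fst A V W ∘ₗ f ∘ₗ LinearMap.inr A V W)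
          exact congr($this x.2)
        have h3 : f x = f (x.1, 0) + f (0, x.2) := by
          rw [← map_add]; simp
        simp only [Module.End.smul_def, RingHom.id_apply]
        ext
        · simp [h3, h2]
        · simp [h1] }
  have : IsSemisimpleModule A (V × W) := by
    have := IsSemisimpleModule.sup (IsSemisimpleModule.range (LinearMap.inl A V W))
      (IsSemisimpleModule.range (LinearMap.inr A V W))
    rw [LinearMap.sup_range_inl_inr] at this
    exact IsSemisimpleModule.congr Submodule.topEquiv.symm
  have : SMulCommClass A k (V × W) := IsScalarTower.to_smulCommClass'
  have : Module.Finite (Module.End A (V × W)) (V × W) :=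
    Module.Finite.of_restrictScalars_finite k _ _
  obtain ⟨a, ha⟩ := Module.Finite.toModuleEnd_moduleEnd_surjective (R := A) (M := V × W) p
  have ha' (x : V × W) : a • x = (x.1, 0) := congr($ha x)
  have hV : Algebra.lsmul k k V a = LinearMap.id := by
    ext v
    simpa using congr(($(ha' (v, 0))).1)
  have hW : Algebra.lsmul k k W a = 0 := by
    ext w
    simpa using congr(($(ha' (0, w))).2)
  have := h a
  rw [moduleTrace, moduleTrace, hV, hW, LinearMap.trace_id, map_zero, Nat.cast_eq_zero] at this
  exact Module.finrank_zero_iff.mp this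

end ModuleTrace

/-- Over a field of characteristic zero, finite-dimensional semisimple modules are determined
by their traces. -/
theorem nonempty_linearEquiv_of_moduleTrace_eq {k A : Type*} [Field k] [CharZero k] [Ring A]
    [Algebra k A] {V W : Type*}
    [AddCommGroup V] [Module k V] [Module A V] [IsScalarTower k A V]
    [AddCommGroup W] [Module k W] [Module A W] [IsScalarTower k A W]
    [FiniteDimensional k V] [FiniteDimensional k W]
    [IsSemisimpleModule A V] [IsSemisimpleModule A W]
    (h : ∀ a : A, moduleTrace k V a = moduleTrace k W a) : Nonempty (V ≃ₗ[A] W) := by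
  by_cases H : (∀ f : V →ₗ[A] W, f = 0) ∧ (∀ f : W →ₗ[A] V, f = 0)
  · have := subsingleton_of_moduleTrace_eq h H.1 H.2
    have := subsingleton_of_moduleTrace_eq (fun a => (h a).symm) H.2 H.1
    exact ⟨0⟩
  · obtain ⟨V₁, V₂, W₁, W₂, hV, hW, hlt, ⟨e⟩⟩ : ∃ (V₁ V₂ : Submodule A V)
        (W₁ W₂ : Submodule A W), IsCompl V₁ V₂ ∧ IsCompl W₁ W₂ ∧
        (V₂ ≠ ⊤) ∧ Nonempty (V₁ ≃ₗ[A] W₁) := by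
      rw [not_and_or] at H
      push Not at H
      rcases H with ⟨f, hf⟩ | ⟨f, hf⟩
      · exact exists_isCompl_of_hom_ne_zero hf
      · obtain ⟨W₁, W₂, V₁, V₂, hW, hV, hne, ⟨e⟩⟩ := exists_isCompl_of_hom_ne_zero hf
        refine ⟨V₁, V₂, W₁, W₂, hV, hW, ?_, ⟨e.symm⟩⟩
        rintro rfl
        have h1 : V₁ = ⊥ := by simpa using hV.inf_eq_bot
        subst h1
        have h2 : W₁ = ⊥ := by
          rw [← Submodule.subsingleton_iff_eq_bot]
          exact e.toEquiv.subsingleton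
        subst h2
        exact hne (by simpa using hW.sup_eq_top)
    have : FiniteDimensional k V₂ :=
      inferInstanceAs (FiniteDimensional k (V₂.restrictScalars k))
    have : FiniteDimensional k W₂ :=
      inferInstanceAs (FiniteDimensional k (W₂.restrictScalars k))
    have hdim : Module.finrank k V₂ < Module.finrank k V := by
      refine Submodule.finrank_lt (s := V₂.restrictScalars k) ?_
      simpa using hlt
    obtain ⟨e'⟩ := nonempty_linearEquiv_of_moduleTrace_eq (k := k) (A := A) (V := V₂) (W := W₂)
      (fun a => by
        have := h a
        rwa [moduleTrace_of_isCompl hV, moduleTrace_of_isCompl hW, moduleTrace_congr e,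
          add_right_inj] at this)
    exact ⟨(Submodule.prodEquivOfIsCompl V₁ V₂ hV).symm.trans
      ((e.prodCongr e').trans (Submodule.prodEquivOfIsCompl W₁ W₂ hW))⟩
termination_by Module.finrank k V

/-- Finite-dimensional semisimple representations in characteristic zero are determined by their
characters. -/
theorem nonempty_equiv_of_character_eq {k G V W : Type*} [Field k] [CharZero k] [Group G]
    [AddCommGroup V] [Module k V] [AddCommGroup W] [Module k W]
    [FiniteDimensional k V] [FiniteDimensional k W]
    {ρ : Representation k G V} {σ : Representation k G W}
    (hρ : IsSemisimpleModule (MonoidAlgebra k G) ρ.asModule)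
    (hσ : IsSemisimpleModule (MonoidAlgebra k G) σ.asModule)
    (h : ∀ g, ρ.character g = σ.character g) : Nonempty (ρ.Equiv σ) := by
  have key (a : MonoidAlgebra k G) :
      moduleTrace k ρ.asModule a = moduleTrace k σ.asModule a := by
    induction a using MonoidAlgebra.induction_linear with
    | zero => simp [moduleTrace]
    | add x y hx hy => simpa [moduleTrace] using congr($hx + $hy)
    | single g r =>
      have h1 : moduleTrace k ρ.asModule (MonoidAlgebra.single g r) = r * ρ.character g := by
        rw [moduleTrace, Representation.character, ← smul_eq_mul, ← map_smul]
        congr 1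
        ext v
        exact Representation.single_smul _ r g v
      have h2 : moduleTrace k σ.asModule (MonoidAlgebra.single g r) = r * σ.character g := by
        rw [moduleTrace, Representation.character, ← smul_eq_mul, ← map_smul]
        congr 1
        ext v
        exact Representation.single_smul _ r g v
      rw [h1, h2, h]
  obtain ⟨e⟩ := nonempty_linearEquiv_of_moduleTrace_eq key
  let f := Representation.IntertwiningMap.equivLinearMapAsModule (ρ := ρ) (σ := σ) |>.symm
    e.toLinearMap
  refine ⟨Representation.Equiv.mk (e.restrictScalars k) fun g => ?_⟩
  ext v
  exact Representation.IntertwiningMap.isIntertwining _ _ f g v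

end Plethysm

end


noncomputable section

namespace Plethysm

section Semisimple

/-- A representation on a finite-dimensional inner product space whose image is closed under
adjoints is semisimple. -/
theorem isSemisimpleModule_of_adjoint {G E : Type*} [Group G] [NormedAddCommGroup E]
    [InnerProductSpace ℂ E] [FiniteDimensional ℂ E] (ρ : Representation ℂ G E)
    (h : ∀ g, ∃ g', ρ g' = LinearMap.adjoint (ρ g)) :
    IsSemisimpleModule (MonoidAlgebra ℂ G) ρ.asModule := by
  rw [← Representation.isSemisimpleRepresentation_iff_isSemisimpleModule_asModule]
  refine ⟨fun U => ⟨⟨U.toSubmoduleᗮ, ?_⟩, ?_⟩⟩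
  · intro g v hv u hu
    obtain ⟨g', hg'⟩ := h g
    rw [← LinearMap.adjoint_inner_left, ← hg']
    exact hv _ (U.apply_mem_toSubmodule g' hu)
  · have := Submodule.isCompl_orthogonal (K := U.toSubmodule)
    constructor
    · rw [disjoint_iff]
      apply Subrepresentation.toSubmodule_injective
      exact this.inf_eq_bot
    · rw [codisjoint_iff]
      apply Subrepresentation.toSubmodule_injective
      exact this.sup_eq_top

theorem isSemisimpleModule_of_surjective {k G V W : Type*} [Field k] [Group G]
    [AddCommGroup V] [Module k V] [AddCommGroup W] [Module k W]
    {ρ : Representation k G V} {σ : Representation k G W} (f : ρ.IntertwiningMap σ)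
    (hf : Function.Surjective f) (hρ : IsSemisimpleModule (MonoidAlgebra k G) ρ.asModule) :
    IsSemisimpleModule (MonoidAlgebra k G) σ.asModule :=
  IsSemisimpleModule.of_surjective (Representation.IntertwiningMap.equivLinearMapAsModule _ _ f) hf

end Semisimple

section TensorPower

variable (ι : Type*) [Fintype ι] [DecidableEq ι]

/-- The Kronecker power of a `2 × 2` matrix, with tensor factors indexed by `ι`. -/
def kroneckerPow (g : Matrix (Fin 2) (Fin 2) ℂ) : Matrix (ι → Fin 2) (ι → Fin 2) ℂ :=
  Matrix.of fun a b => ∏ i, g (a i) (b i)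

theorem kroneckerPow_mul (g h : Matrix (Fin 2) (Fin 2) ℂ) :
    kroneckerPow ι (g * h) = kroneckerPow ι g * kroneckerPow ι h := by
  ext a b
  simp only [kroneckerPow, Matrix.of_apply, Matrix.mul_apply, Finset.prod_univ_sum,
    Fintype.piFinset_univ, Finset.prod_mul_distrib]

omit [DecidableEq ι] in
theorem kroneckerPow_one : kroneckerPow ι 1 = 1 := by
  ext a b
  simp only [kroneckerPow, Matrix.of_apply, Matrix.one_apply, Finset.prod_ite_zero,
    Finset.prod_const_one, funext_iff, Finset.mem_univ, true_implies]

omit [DecidableEq ι] in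
theorem kroneckerPow_conjTranspose (g : Matrix (Fin 2) (Fin 2) ℂ) :
    kroneckerPow ι g.conjTranspose = (kroneckerPow ι g).conjTranspose := by
  ext a b
  simp [kroneckerPow, Matrix.conjTranspose_apply]

/-- The tensor power of the natural representation, in coordinates. -/
def tensorRep : Representation ℂ (Matrix.SpecialLinearGroup (Fin 2) ℂ)
    (EuclideanSpace ℂ (ι → Fin 2)) where
  toFun g := Matrix.toEuclideanLin (kroneckerPow ι (g : Matrix (Fin 2) (Fin 2) ℂ))
  map_one' := by
    rw [Matrix.SpecialLinearGroup.coe_one, kroneckerPow_one]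
    ext v i
    simp [Matrix.toEuclideanLin]
  map_mul' g h := by
    rw [Matrix.SpecialLinearGroup.coe_mul, kroneckerPow_mul]
    ext v i
    simp [Matrix.toEuclideanLin]

theorem tensorRep_isSemisimpleModule :
    IsSemisimpleModule (MonoidAlgebra ℂ (Matrix.SpecialLinearGroup (Fin 2) ℂ))
      (tensorRep ι).asModule := by
  refine isSemisimpleModule_of_adjoint _ fun g => ?_
  refine ⟨⟨(g : Matrix (Fin 2) (Fin 2) ℂ).conjTranspose, ?_⟩, ?_⟩
  · rw [Matrix.det_conjTranspose, g.det_coe, star_one]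
  · change Matrix.toEuclideanLin (kroneckerPow ι _) = _
    rw [kroneckerPow_conjTranspose, Matrix.toEuclideanLin_conjTranspose_eq_adjoint]
    rfl

end TensorPower

section Character

open Matrix

/-- An upper triangular matrix of determinant one. -/
def upperSL (q : ℂˣ) (x : ℂ) : Matrix.SpecialLinearGroup (Fin 2) ℂ :=
  ⟨!![(q : ℂ), x; 0, (q : ℂ)⁻¹], by simp [Matrix.det_fin_two]⟩

theorem upperSL_conj (q a : ℂˣ) (x : ℂ) :
    upperSL a 0 * upperSL q x * (upperSL a 0)⁻¹ = upperSL q ((a : ℂ) ^ 2 * x) := by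
  rw [mul_inv_eq_iff_eq_mul]
  apply Subtype.ext
  have := a.ne_zero
  rw [Matrix.SpecialLinearGroup.coe_mul, Matrix.SpecialLinearGroup.coe_mul]
  ext i j
  fin_cases i <;> fin_cases j <;>
    simp [upperSL, Matrix.mul_apply, Fin.sum_univ_two] <;> field_simp

theorem exists_conj_upperSL (g : Matrix.SpecialLinearGroup (Fin 2) ℂ) :
    ∃ (p : Matrix.SpecialLinearGroup (Fin 2) ℂ) (q : ℂˣ) (x : ℂ), g = p * upperSL q x * p⁻¹ := by
  obtain ⟨t, ht⟩ := Module.End.exists_eigenvalue (Matrix.toLin' (g : Matrix (Fin 2) (Fin 2) ℂ))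
  obtain ⟨v, hv⟩ := ht.exists_hasEigenvector
  have hv0 := hv.2
  have hgv : (g : Matrix (Fin 2) (Fin 2) ℂ) *ᵥ v = t • v := by
    simpa using hv.apply_eq_smul
  obtain ⟨p, hp0, hp1⟩ : ∃ p : Matrix.SpecialLinearGroup (Fin 2) ℂ,
      (p : Matrix (Fin 2) (Fin 2) ℂ) 0 0 = v 0 ∧ (p : Matrix (Fin 2) (Fin 2) ℂ) 1 0 = v 1 := by
    by_cases h : v 0 = 0
    · have h1 : v 1 ≠ 0 := fun h1 => hv0 (by ext i; fin_cases i <;> simp [h, h1])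
      exact ⟨⟨!![v 0, -(v 1)⁻¹; v 1, 0], by simp [Matrix.det_fin_two, h1]⟩, rfl, rfl⟩
    · exact ⟨⟨!![v 0, 0; v 1, (v 0)⁻¹], by simp [Matrix.det_fin_two, h]⟩, rfl, rfl⟩
  set u := p⁻¹ * g * p with hu
  have hgu : g = p * u * p⁻¹ := by rw [hu]; group
  have hu10 : (u : Matrix (Fin 2) (Fin 2) ℂ) 1 0 = 0 := by
    have e0 := congrFun hgv 0
    have e1 := congrFun hgv 1
    simp only [Matrix.mulVec, dotProduct, Fin.sum_univ_two, Pi.smul_apply, smul_eq_mul] at e0 e1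
    simp only [hu, Matrix.SpecialLinearGroup.coe_mul, Matrix.SpecialLinearGroup.coe_inv, Matrix.adjugate_fin_two,
      Matrix.mul_apply, Fin.sum_univ_two, Matrix.of_apply, Matrix.cons_val_zero,
      Matrix.cons_val_one, hp0, hp1]
    linear_combination (-v 1) * e0 + v 0 * e1
  have hdet : (u : Matrix (Fin 2) (Fin 2) ℂ) 0 0 * (u : Matrix (Fin 2) (Fin 2) ℂ) 1 1 = 1 := by
    have := u.det_coe
    rw [Matrix.det_fin_two, hu10] at this
    simpa using this
  refine ⟨p, ⟨(u : Matrix (Fin 2) (Fin 2) ℂ) 0 0, (u : Matrix (Fin 2) (Fin 2) ℂ) 1 1, hdet, by rw [mul_comm]; exact hdet⟩,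
    (u : Matrix (Fin 2) (Fin 2) ℂ) 0 1, ?_⟩
  rw [hgu]
  congr 2
  apply Subtype.ext
  ext i j
  fin_cases i <;> fin_cases j <;> simp [upperSL, hu10, eq_inv_of_mul_eq_one_right hdet]

variable {W : Type*} [AddCommGroup W] [Module ℂ W]
  {σ : Representation ℂ (Matrix.SpecialLinearGroup (Fin 2) ℂ) W}

theorem continuous_character_upperSL {ι : Type*} [Fintype ι] [DecidableEq ι]
    (f : (tensorRep ι).IntertwiningMap σ) (hf : Function.Surjective f) (q : ℂˣ) :
    Continuous fun x => σ.character (upperSL q x) := by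
  have : FiniteDimensional ℂ W := Module.Finite.of_surjective f.toLinearMap hf
  obtain ⟨s, hs⟩ := f.toLinearMap.exists_rightInverse_of_surjective
    (LinearMap.range_eq_top.mpr hf)
  obtain ⟨B, hB⟩ := Matrix.toEuclideanLin.surjective (s ∘ₗ f.toLinearMap)
  have key (x : ℂ) : σ.character (upperSL q x) =
      (kroneckerPow ι (upperSL q x : Matrix (Fin 2) (Fin 2) ℂ) *
        B).trace := by
    have h1 : σ (upperSL q x) = f.toLinearMap ∘ₗ tensorRep ι (upperSL q x) ∘ₗ s := by
      ext w
      have h2 := congr($hs w)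
      simp only [LinearMap.comp_apply, LinearMap.id_apply] at h2
      rw [LinearMap.comp_apply, LinearMap.comp_apply]
      conv_lhs => rw [← h2]
      exact (Representation.IntertwiningMap.isIntertwining _ _ f _ _).symm
    rw [Representation.character, h1, LinearMap.trace_comp_comm', LinearMap.comp_assoc]
    rw [← hB, Matrix.toEuclideanLin_eq_toLin_orthonormal, ← Matrix.trace_toLin_eq _
      (EuclideanSpace.basisFun (ι → Fin 2) ℂ).toBasis, Matrix.toLin_mul _
      (EuclideanSpace.basisFun (ι → Fin 2) ℂ).toBasis]
    rfl
  simp only [key, Matrix.trace, Matrix.diag, Matrix.mul_apply, kroneckerPow, Matrix.of_apply]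
  refine continuous_finsetSum _ fun a _ => continuous_finsetSum _ fun b _ =>
    Continuous.mul (continuous_finsetProd _ fun i _ => ?_) continuous_const
  generalize a i = a'
  generalize b i = b'
  fin_cases a' <;> fin_cases b' <;> simp [upperSL] <;> fun_prop

theorem character_upperSL {ι : Type*} [Fintype ι] [DecidableEq ι]
    (f : (tensorRep ι).IntertwiningMap σ) (hf : Function.Surjective f) (q : ℂˣ) (x : ℂ) :
    σ.character (upperSL q x) = σ.character (upperSL q 0) := by
  have h1 : Continuous fun a : ℂ => σ.character (upperSL q (a ^ 2 * x)) :=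
    (continuous_character_upperSL f hf q).comp (by fun_prop)
  have h2 : Continuous fun _ : ℂ => σ.character (upperSL q x) := continuous_const
  have h3 := Continuous.ext_on (dense_compl_singleton (0 : ℂ)) h1 h2 fun a ha => by
    have ha' : a ≠ 0 := ha
    have := upperSL_conj q (Units.mk0 a ha') x
    rw [Units.val_mk0] at this
    simp only [← this, Representation.char_conj]
  have := congrFun h3 0
  simpa using this.symm

/-- Two quotients of tensor powers of the natural representation are isomorphic if their
characters agree on the diagonal torus. -/
theorem nonempty_equiv_of_character_torus_eq {W' : Type*} [AddCommGroup W'] [Module ℂ W']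
    {σ' : Representation ℂ (Matrix.SpecialLinearGroup (Fin 2) ℂ) W'}
    {ι ι' : Type*} [Fintype ι] [DecidableEq ι] [Fintype ι'] [DecidableEq ι']
    (f : (tensorRep ι).IntertwiningMap σ) (hf : Function.Surjective f)
    (f' : (tensorRep ι').IntertwiningMap σ') (hf' : Function.Surjective f')
    (h : ∀ q : ℂˣ, σ.character (upperSL q 0) = σ'.character (upperSL q 0)) :
    Nonempty (σ.Equiv σ') := by
  have : FiniteDimensional ℂ W := Module.Finite.of_surjective f.toLinearMap hf
  have : FiniteDimensional ℂ W' := Module.Finite.of_surjective f'.toLinearMap hf'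
  refine nonempty_equiv_of_character_eq
    (isSemisimpleModule_of_surjective f hf (tensorRep_isSemisimpleModule ι))
    (isSemisimpleModule_of_surjective f' hf' (tensorRep_isSemisimpleModule ι')) fun g => ?_
  obtain ⟨p, q, x, rfl⟩ := exists_conj_upperSL g
  rw [Representation.char_conj, Representation.char_conj, character_upperSL f hf,
    character_upperSL f' hf', h]

end Character

end Plethysm

end


noncomputable section

namespace Plethysm

section Polytabloids

theorem eq_zero_of_eq_neg {M : Type*} [AddCommGroup M] [Module ℂ M] {x : M} (h : x = -x) :
    x = 0 := by
  have h1 : (2 : ℂ) • x = 0 := by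
    rw [two_smul]
    nth_rewrite 1 [h]
    exact neg_add_cancel x
  exact (smul_eq_zero.mp h1).resolve_left two_ne_zero

variable {V : Type*} [AddCommGroup V] [Module ℂ V] (lam : YoungDiagram)

theorem mem_columnPerms {lam : YoungDiagram} {τ : Equiv.Perm lam.cells} :
    τ ∈ columnPerms lam ↔ ∀ c, (τ c).1.2 = c.1.2 := by
  simp [columnPerms]

theorem columnPerms_mul {lam : YoungDiagram} {τ σ : Equiv.Perm lam.cells}
    (hτ : τ ∈ columnPerms lam) (hσ : σ ∈ columnPerms lam) : τ * σ ∈ columnPerms lam := by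
  rw [mem_columnPerms] at *
  intro c
  rw [Equiv.Perm.mul_apply, hτ, hσ]

theorem columnPerms_inv {lam : YoungDiagram} {τ : Equiv.Perm lam.cells}
    (hτ : τ ∈ columnPerms lam) : τ⁻¹ ∈ columnPerms lam := by
  rw [mem_columnPerms] at *
  intro c
  rw [← hτ, ← Equiv.Perm.mul_apply, mul_inv_cancel, Equiv.Perm.one_apply]

theorem tabloid_update [DecidableEq lam.cells] (t : lam.cells → V) (c₀ : lam.cells) (x : V)
    (i₀ : Fin (lam.colLen 0)) (hi₀ : (i₀ : ℕ) = c₀.1.1) :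
    tabloid lam (Function.update t c₀ x) = PiTensorProduct.tprod ℂ (Function.update
      (fun i : Fin (lam.colLen 0) =>
        ∏ c : lam.cells with c.1.1 = (i : ℕ), SymmetricAlgebra.ι ℂ V (t c)) i₀
      (SymmetricAlgebra.ι ℂ V x *
        ∏ c ∈ (Finset.univ.filter fun c : lam.cells => c.1.1 = (i₀ : ℕ)).erase c₀,
          SymmetricAlgebra.ι ℂ V (t c))) := by
  rw [tabloid]
  congr 1
  ext1 i
  by_cases h : i = i₀
  · subst h
    rw [Function.update_self, ← Finset.mul_prod_erase _ _ (a := c₀) (by simp [hi₀]),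
      Function.update_self]
    congr 1
    refine Finset.prod_congr rfl fun c hc => ?_
    rw [Function.update_of_ne (Finset.ne_of_mem_erase hc)]
  · rw [Function.update_of_ne h]
    refine Finset.prod_congr rfl fun c hc => ?_
    rw [Function.update_of_ne]
    rintro rfl
    exact h (Fin.ext ((Finset.mem_filter.mp hc).2.symm.trans hi₀.symm))

theorem row_lt_colLen {lam : YoungDiagram} (c : lam.cells) : c.1.1 < lam.colLen 0 := by
  rw [← YoungDiagram.mem_iff_lt_colLen]
  exact lam.up_left_mem le_rfl (Nat.zero_le _) (lam.mem_cells c.1 |>.mp c.2)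

variable (V) in
/-- Tabloids as a multilinear function of their entries. -/
def tabloidMultilinear : MultilinearMap ℂ (fun _ : lam.cells => V) (RowTensor V lam) where
  toFun := tabloid lam
  map_update_add' {inst} t c x y := by
    have := tabloid_update lam t c
    rw [this _ ⟨_, row_lt_colLen c⟩ rfl, this _ ⟨_, row_lt_colLen c⟩ rfl,
      this _ ⟨_, row_lt_colLen c⟩ rfl, ← MultilinearMap.map_update_add, map_add, add_mul]
  map_update_smul' {inst} t c a x := by
    have := tabloid_update lam t c
    rw [this _ ⟨_, row_lt_colLen c⟩ rfl, this _ ⟨_, row_lt_colLen c⟩ rfl,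
      ← MultilinearMap.map_update_smul, map_smul, smul_mul_assoc]

variable (V) in
/-- Polytabloids as a multilinear function of their entries. -/
def polytabloidMultilinear : MultilinearMap ℂ (fun _ : lam.cells => V) (RowTensor V lam) :=
  ∑ τ ∈ columnPerms lam,
    ((Equiv.Perm.sign τ : ℤ) : ℂ) • (tabloidMultilinear V lam).domDomCongr τ⁻¹

theorem polytabloidMultilinear_apply (t : lam.cells → V) :
    polytabloidMultilinear V lam t = polytabloid lam t := by
  simp only [polytabloidMultilinear, sum_apply, smul_apply]
  rfl

/-- The polytabloids with entries in a basis span all polytabloids. -/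
theorem polytabloid_mem_span_basis {κ : Type*} [Fintype κ] (b : Module.Basis κ ℂ V)
    (t : lam.cells → V) : polytabloid lam t ∈
      Submodule.span ℂ (Set.range fun s : lam.cells → κ => polytabloid lam fun c => b (s c)) := by
  classical
  have h : t = fun c => ∑ k, b.repr (t c) k • b k := by
    ext c
    rw [b.sum_repr]
  rw [h, ← polytabloidMultilinear_apply, MultilinearMap.map_sum]
  refine Submodule.sum_mem _ fun s _ => ?_
  rw [MultilinearMap.map_smul_univ, polytabloidMultilinear_apply]
  exact Submodule.smul_mem _ _ (Submodule.subset_span ⟨s, rfl⟩)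

variable {lam}

theorem polytabloid_comp_columnPerm (t : lam.cells → V) {σ : Equiv.Perm lam.cells}
    (hσ : σ ∈ columnPerms lam) :
    polytabloid lam (fun c => t (σ c)) = ((Equiv.Perm.sign σ : ℤ) : ℂ) • polytabloid lam t := by
  rw [polytabloid, polytabloid, Finset.smul_sum]
  refine Finset.sum_nbij' (fun τ => τ * σ⁻¹) (fun τ => τ * σ)
    (fun τ hτ => columnPerms_mul hτ (columnPerms_inv hσ)) (fun τ hτ => columnPerms_mul hτ hσ)
    (by simp) (by simp) fun τ _ => ?_
  rw [smul_smul]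
  congr 1
  · rw [← Int.cast_mul, ← Units.val_mul, ← Equiv.Perm.sign_mul,
      Equiv.Perm.sign_mul, Equiv.Perm.sign_mul, Equiv.Perm.sign_inv, mul_comm, mul_assoc,
      Int.units_mul_self, mul_one]

theorem swap_mem_columnPerms {c c' : lam.cells} (h : c.1.2 = c'.1.2) :
    Equiv.swap c c' ∈ columnPerms lam := by
  rw [mem_columnPerms]
  intro x
  rw [Equiv.swap_apply_def]
  split_ifs with h1 h2
  · rw [h1, h]
  · rw [h2, h]
  · rfl

theorem polytabloid_comp_swap (t : lam.cells → V) {c c' : lam.cells} (h : c.1.2 = c'.1.2)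
    (hne : c ≠ c') : polytabloid lam (fun x => t (Equiv.swap c c' x)) = -polytabloid lam t := by
  rw [polytabloid_comp_columnPerm t (swap_mem_columnPerms h), Equiv.Perm.sign_swap hne, Units.val_neg, Units.val_one,
    Int.cast_neg, Int.cast_one]
  exact neg_one_smul ℂ (polytabloid lam t)

theorem polytabloid_eq_zero (t : lam.cells → V) {c c' : lam.cells} (h : c.1.2 = c'.1.2)
    (hne : c ≠ c') (ht : t c = t c') : polytabloid lam t = 0 := by
  have h1 := polytabloid_comp_swap t h hne
  have h2 : (fun x => t (Equiv.swap c c' x)) = t := by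
    ext x
    rw [Equiv.swap_apply_def]
    split_ifs with h1 h2
    · rw [h1, ht]
    · rw [h2, ht]
    · rfl
  rw [h2] at h1
  exact eq_zero_of_eq_neg h1

theorem tabloid_comp_swap (t : lam.cells → V) {x y : lam.cells} (h : x.1.1 = y.1.1) :
    tabloid lam (fun c => t (Equiv.swap x y c)) = tabloid lam t := by
  rw [tabloid, tabloid]
  congr 1
  ext1 i
  refine Finset.prod_nbij' (Equiv.swap x y) (Equiv.swap x y) ?_ ?_ (by simp) (by simp) (by simp)
  all_goals
    intro c hc
    rw [Finset.mem_filter] at hc ⊢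
    refine ⟨Finset.mem_univ _, ?_⟩
    rw [Equiv.swap_apply_def]
    split_ifs with h1 h2
    · rw [← h, ← h1, hc.2]
    · rw [h, ← h2, hc.2]
    · exact hc.2

/-- The Garnir relation: alternating a polytabloid over all permutations of a set of boxes
in columns `j, j + 1` gives zero if there are more boxes than rows in column `j`. -/
theorem sum_sign_polytabloid_eq_zero (t : lam.cells → V) (j : ℕ) (C : Finset lam.cells)
    (hC : ∀ c ∈ C, j ≤ c.1.2) (hcard : lam.colLen j < C.card) :
    ∑ σ : Equiv.Perm lam.cells with (∀ c, c ∉ C → σ c = c),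
      ((Equiv.Perm.sign σ : ℤ) : ℂ) • polytabloid lam (fun c => t (σ c)) = 0 := by
  simp only [polytabloid, Finset.smul_sum]
  rw [Finset.sum_comm]
  refine Finset.sum_eq_zero fun τ hτ => ?_
  rw [mem_columnPerms] at hτ
  obtain ⟨a, ha, b, hb, hab, hrow⟩ := Finset.exists_ne_map_eq_of_card_lt_of_maps_to
    (s := C) (t := Finset.range (lam.colLen j)) (f := fun c => (τ c).1.1) (by simpa using hcard)
    (fun c hc => by
      rw [Finset.mem_coe] at hc ⊢
      rw [Finset.mem_range, ← YoungDiagram.mem_iff_lt_colLen]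
      exact lam.up_left_mem le_rfl (by rw [hτ c]; exact hC c hc) ((lam.mem_cells _).mp (τ c).2))
  refine eq_zero_of_eq_neg ?_
  rw [← Finset.sum_neg_distrib]
  refine Finset.sum_nbij' (fun σ => σ * Equiv.swap a b) (fun σ => σ * Equiv.swap a b)
    ?_ ?_ (by simp) (by simp) fun σ _ => ?_
  iterate 2
    intro σ hσ
    rw [Finset.mem_filter] at hσ ⊢
    refine ⟨Finset.mem_univ _, fun c hc => ?_⟩
    rw [Equiv.Perm.mul_apply, Equiv.swap_apply_of_ne_of_ne, hσ.2 c hc]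
    · rintro rfl; exact hc ha
    · rintro rfl; exact hc hb
  have h1 : tabloid lam (fun c => t ((σ * Equiv.swap a b) (τ⁻¹ c))) =
      tabloid lam (fun c => t (σ (τ⁻¹ c))) := by
    rw [← tabloid_comp_swap (fun c => t (σ (τ⁻¹ c))) hrow]
    congr 1
    ext c
    have : Equiv.swap a b (τ⁻¹ c) = τ⁻¹ (Equiv.swap (τ a) (τ b) c) := by
      rw [Equiv.swap_apply_apply]
      simp
    simp only [Equiv.Perm.mul_apply, this]
  rw [h1, Equiv.Perm.sign_mul, Equiv.Perm.sign_swap hab, Units.val_mul, Units.val_neg,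
    Units.val_one, Int.cast_mul, Int.cast_neg, Int.cast_one, mul_neg_one]
  rw [show ∀ (a : ℂ) (x : RowTensor V lam), -a • x = -(a • x) from fun a x => neg_smul a x,
    neg_neg]

end Polytabloids

end Plethysm

end


noncomputable section

namespace Plethysm

section Straightening

variable {lam : YoungDiagram} {n : ℕ}

/-- Semistandard fillings: rows weakly increase and columns strictly increase. -/
structure IsSemistandard (t : lam.cells → Fin n) : Prop where
  row_weak : ∀ c c' : lam.cells, c.1.1 = c'.1.1 → c.1.2 ≤ c'.1.2 → t c ≤ t c'
  col_strict : ∀ c c' : lam.cells, c.1.2 = c'.1.2 → c.1.1 < c'.1.1 → t c < t c'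

theorem row_weak_of_adjacent {t : lam.cells → Fin n}
    (h : ∀ c c' : lam.cells, c.1.1 = c'.1.1 → c.1.2 + 1 = c'.1.2 → t c ≤ t c')
    (c c' : lam.cells) (hr : c.1.1 = c'.1.1) (hc : c.1.2 ≤ c'.1.2) : t c ≤ t c' := by
  obtain ⟨⟨i, j⟩, hcm⟩ := c
  obtain ⟨⟨i', j'⟩, hcm'⟩ := c'
  obtain rfl : i = i' := hr
  simp only at hc
  induction hc with
  | refl => exact le_rfl
  | @step m hm ih =>
    have hmem : (i, m) ∈ lam.cells := by
      rw [YoungDiagram.mem_cells] at hcm' ⊢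
      exact lam.up_left_mem le_rfl (Nat.le_succ m) hcm'
    exact (ih hmem).trans (h ⟨(i, m), hmem⟩ ⟨(i, m + 1), hcm'⟩ rfl rfl)

theorem card_le_colLen_sub (j i : ℕ) : lam.colLen j - i ≤
    (Finset.univ.filter fun c : lam.cells => c.1.2 = j ∧ i ≤ c.1.1).card := by
  rw [← Nat.card_Ico]
  refine Finset.card_le_card_of_surjOn (fun c => c.1.1) fun r hr => ?_
  simp only [Finset.coe_Ico, Set.mem_Ico] at hr
  have hmem : (r, j) ∈ lam.cells := by
    rw [YoungDiagram.mem_cells, YoungDiagram.mem_iff_lt_colLen]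
    exact hr.2
  exact ⟨⟨(r, j), hmem⟩, by simp [hr.1], rfl⟩

theorem card_ge_succ (c : lam.cells) : c.1.1 + 1 ≤
    (Finset.univ.filter fun x : lam.cells => x.1.2 = c.1.2 ∧ x.1.1 ≤ c.1.1).card := by
  rw [← Finset.card_range (c.1.1 + 1)]
  refine Finset.card_le_card_of_surjOn (fun c => c.1.1) fun r hr => ?_
  simp only [Finset.coe_range, Set.mem_Iio, Nat.lt_succ_iff] at hr
  have hmem : (r, c.1.2) ∈ lam.cells := by
    rw [YoungDiagram.mem_cells]
    exact lam.up_left_mem hr le_rfl ((lam.mem_cells _).mp c.2)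
  exact ⟨⟨(r, c.1.2), hmem⟩, by simp [hr], rfl⟩

/-- If the entries exceeding a threshold `v` among the boxes `C` in columns `j, j + 1` are those
in column `j`, a permutation of `C` moving a box to another column moves larger entries to the
right. -/
theorem sum_col_mul_lt (t : lam.cells → ℤ) (v : ℤ) (j : ℕ) (C : Finset lam.cells)
    (hj : ∀ c ∈ C, c.1.2 = j ∨ c.1.2 = j + 1)
    (hlt : ∀ c ∈ C, c.1.2 = j → v < t c) (hle : ∀ c ∈ C, c.1.2 = j + 1 → t c ≤ v)
    (σ : Equiv.Perm lam.cells) (hσ : ∀ c, c ∉ C → σ c = c) {c₀ : lam.cells}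
    (hc₀ : (σ c₀).1.2 ≠ c₀.1.2) :
    ∑ c : lam.cells, (c.1.2 : ℤ) * t c < ∑ c : lam.cells, (c.1.2 : ℤ) * t (σ c) := by
  have hσC (c) (hc : c ∈ C) : σ c ∈ C := by
    by_contra h
    have h1 := hσ _ h
    rw [σ.injective h1] at h
    exact h hc
  have e1 : ∑ c : lam.cells, (c.1.2 : ℤ) * t c = ∑ c : lam.cells, ((σ c).1.2 : ℤ) * t (σ c) :=
    (Equiv.sum_comp σ fun c => (c.1.2 : ℤ) * t c).symm
  have e2 : ∑ c : lam.cells, (c.1.2 : ℤ) * v = ∑ c : lam.cells, ((σ c).1.2 : ℤ) * v :=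
    (Equiv.sum_comp σ fun c => (c.1.2 : ℤ) * v).symm
  have term (c : lam.cells) :
      0 ≤ ((c.1.2 : ℤ) - (σ c).1.2) * (t (σ c) - v) ∧
      ((σ c).1.2 = j → c.1.2 ≠ j → 0 < ((c.1.2 : ℤ) - (σ c).1.2) * (t (σ c) - v)) := by
    by_cases hc : c ∈ C
    · rcases hj c hc with h1 | h1 <;> rcases hj _ (hσC c hc) with h2 | h2
      · simp [h1, h2]
      · have := hle _ (hσC c hc) h2
        rw [h1, h2]
        constructor
        · push_cast; nlinarith
        · intro h; omega
      · have := hlt _ (hσC c hc) h2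
        rw [h1, h2]
        push_cast
        constructor
        · nlinarith
        · intros; nlinarith
      · simp [h1, h2]
    · rw [hσ c hc]
      simp
  have hpos : ∃ c, (σ c).1.2 = j ∧ c.1.2 ≠ j := by
    by_contra! h
    have e3 : ∑ c : lam.cells, (c.1.2 : ℤ) = ∑ c : lam.cells, ((σ c).1.2 : ℤ) :=
      (Equiv.sum_comp σ fun c => (c.1.2 : ℤ)).symm
    have hle (c : lam.cells) : (c.1.2 : ℤ) ≤ (σ c).1.2 := by
      by_cases hc : c ∈ C
      · rcases hj c hc with h1 | h1 <;> rcases hj _ (hσC c hc) with h2 | h2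
        · rw [h1, h2]
        · rw [h1, h2]; simp
        · exact absurd (h c h2) (by omega)
        · rw [h1, h2]
      · rw [hσ c hc]
    have := (Finset.sum_eq_sum_iff_of_le fun c _ => hle c).mp e3 c₀ (Finset.mem_univ _)
    exact hc₀ (by exact_mod_cast this.symm)
  obtain ⟨c₁, h1, h2⟩ := hpos
  have := Finset.sum_pos' (fun c _ => (term c).1) ⟨c₁, Finset.mem_univ _, (term c₁).2 h1 h2⟩
  have e4 : ∑ c : lam.cells, ((c.1.2 : ℤ) - (σ c).1.2) * (t (σ c) - v) =
      (∑ c : lam.cells, (c.1.2 : ℤ) * t (σ c) - ∑ c : lam.cells, ((σ c).1.2 : ℤ) * t (σ c)) -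
      (∑ c : lam.cells, (c.1.2 : ℤ) * v - ∑ c : lam.cells, ((σ c).1.2 : ℤ) * v) := by
    simp only [← Finset.sum_sub_distrib]
    exact Finset.sum_congr rfl fun c _ => by ring
  rw [e4, e2, sub_self, sub_zero, ← e1] at this
  linarith

theorem sum_comp_swap_lt (w t : lam.cells → ℤ) {c c' : lam.cells} (hw : w c < w c')
    (ht : t c' < t c) :
    ∑ x, w x * t x < ∑ x, w x * t (Equiv.swap c c' x) := by
  have hne : c ≠ c' := by rintro rfl; exact lt_irrefl _ hw
  rw [← Finset.add_sum_erase _ _ (Finset.mem_univ c),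
    ← Finset.add_sum_erase Finset.univ (fun x => w x * t (Equiv.swap c c' x)) (Finset.mem_univ c),
    ← Finset.add_sum_erase (Finset.univ.erase c) _
      (Finset.mem_erase.mpr ⟨hne.symm, Finset.mem_univ c'⟩),
    ← Finset.add_sum_erase (Finset.univ.erase c) (fun x => w x * t (Equiv.swap c c' x))
      (Finset.mem_erase.mpr ⟨hne.symm, Finset.mem_univ c'⟩),
    Finset.sum_congr (g := fun x => w x * t x) (s₁ := (Finset.univ.erase c).erase c')
      (f := fun x => w x * t (Equiv.swap c c' x)) rfl fun x hx => by
      rw [Finset.mem_erase, Finset.mem_erase] at hx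
      rw [Equiv.swap_apply_of_ne_of_ne hx.2.1 hx.1]]
  simp only [Equiv.swap_apply_left, Equiv.swap_apply_right]
  nlinarith

variable {V : Type*} [AddCommGroup V] [Module ℂ V]

/-- Semistandard polytabloids span. -/
theorem polytabloid_mem_span_semistandard (b : Fin n → V) (t : lam.cells → Fin n) :
    polytabloid lam (fun c => b (t c)) ∈ Submodule.span ℂ
      ((fun s : lam.cells → Fin n => polytabloid lam fun c => b (s c)) ''
        {s | IsSemistandard s}) := by
  let col (t : lam.cells → Fin n) : ℤ := ∑ c : lam.cells, (c.1.2 : ℤ) * (t c : ℕ)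
  let row (t : lam.cells → Fin n) : ℤ := ∑ c : lam.cells, (c.1.1 : ℤ) * (t c : ℕ)
  let r (s t : lam.cells → Fin n) : Prop := toLex (col t, row t) < toLex (col s, row s)
  have : IsTrans (lam.cells → Fin n) r := ⟨fun a b c h1 h2 => lt_trans h2 h1⟩
  have : Std.Irrefl r := ⟨fun a h => lt_irrefl _ h⟩
  induction t using (Finite.wellFounded_of_trans_of_irrefl r).induction with
  | _ t ih
  simp only [r, Prod.Lex.toLex_lt_toLex] at ih
  by_cases hcol : ∀ c c' : lam.cells, c.1.2 = c'.1.2 → c.1.1 < c'.1.1 → t c < t c'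
  swap
  · push Not at hcol
    obtain ⟨c, c', h1, h2, h3⟩ := hcol
    have hne : c ≠ c' := by rintro rfl; exact lt_irrefl _ h2
    rcases h3.eq_or_lt with h3 | h3
    · rw [polytabloid_eq_zero _ h1 hne (congrArg b h3.symm)]
      exact Submodule.zero_mem _
    · rw [← neg_neg (polytabloid lam _), ← polytabloid_comp_swap _ h1 hne]
      refine Submodule.neg_mem _ (ih (fun x => t (Equiv.swap c c' x)) (Or.inr ⟨?_, ?_⟩))
      · simp only [col]
        rw [← Equiv.sum_comp (Equiv.swap c c')]
        refine Finset.sum_congr rfl fun x _ => ?_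
        rw [mem_columnPerms.mp (swap_mem_columnPerms h1)]
      · exact sum_comp_swap_lt (fun x => (x.1.1 : ℤ)) (fun x => ((t x : ℕ) : ℤ))
          (by exact_mod_cast h2) (by exact_mod_cast h3)
  by_cases hrow : ∀ c c' : lam.cells, c.1.1 = c'.1.1 → c.1.2 + 1 = c'.1.2 → t c ≤ t c'
  · exact Submodule.subset_span ⟨t, ⟨row_weak_of_adjacent hrow, hcol⟩, rfl⟩
  push Not at hrow
  obtain ⟨a, a', hr, hc, hlt⟩ := hrow
  have hcol' (c c' : lam.cells) (h : c.1.2 = c'.1.2) (h' : c.1.1 ≤ c'.1.1) : t c ≤ t c' := by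
    rcases h'.eq_or_lt with h' | h'
    · rw [Subtype.ext (Prod.ext h' h)]
    · exact (hcol c c' h h').le
  let A := Finset.univ.filter fun c : lam.cells => c.1.2 = a.1.2 ∧ a.1.1 ≤ c.1.1
  let B := Finset.univ.filter fun c : lam.cells => c.1.2 = a'.1.2 ∧ c.1.1 ≤ a'.1.1
  have hdisj : Disjoint A B := by
    rw [Finset.disjoint_left]
    intro c hcA hcB
    have h1 := (Finset.mem_filter.mp hcA).2.1
    have h2 := (Finset.mem_filter.mp hcB).2.1
    omega
  have hmem (c) : c ∈ A ∪ B ↔ (c.1.2 = a.1.2 ∧ a.1.1 ≤ c.1.1) ∨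
      (c.1.2 = a'.1.2 ∧ c.1.1 ≤ a'.1.1) := by simp [A, B]
  have hcard : lam.colLen a.1.2 < (A ∪ B).card := by
    rw [Finset.card_union_of_disjoint hdisj]
    have h1 : _ ≤ A.card := card_le_colLen_sub (lam := lam) a.1.2 a.1.1
    have h2 : _ ≤ B.card := card_ge_succ a'
    omega
  have hgarnir := sum_sign_polytabloid_eq_zero (fun c => b (t c)) a.1.2 (A ∪ B)
    (fun c hc => by rw [hmem] at hc; omega) hcard
  rw [← Finset.sum_filter_add_sum_filter_not _ (fun σ => σ ∈ columnPerms lam),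
    Finset.sum_congr rfl (g := fun _ => polytabloid lam fun c => b (t c)) fun σ hσ => by
      rw [polytabloid_comp_columnPerm (fun c => b (t c)) (Finset.mem_filter.mp hσ).2, smul_smul, ← Int.cast_mul,
        ← Units.val_mul, Int.units_mul_self, Units.val_one, Int.cast_one, one_smul],
    Finset.sum_const, add_eq_zero_iff_eq_neg] at hgarnir
  have hne : (Finset.card (Finset.filter (fun σ => σ ∈ columnPerms lam)
      (Finset.univ.filter fun σ : Equiv.Perm lam.cells => ∀ c, c ∉ A ∪ B → σ c = c)) : ℂ) ≠ 0 := by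
    rw [Nat.cast_ne_zero, ← Nat.pos_iff_ne_zero, Finset.card_pos]
    exact ⟨1, by simp [mem_columnPerms]⟩
  rw [← Nat.cast_smul_eq_nsmul ℂ] at hgarnir
  rw [← Submodule.smul_mem_iff _ hne, hgarnir]
  refine Submodule.neg_mem _ (Submodule.sum_mem _ fun σ hσ => Submodule.smul_mem _ _
    (ih (fun c => t (σ c)) (Or.inl ?_)))
  rw [Finset.mem_filter, Finset.mem_filter, mem_columnPerms] at hσ
  push Not at hσ
  obtain ⟨⟨-, hσ1⟩, c₀, hc₀⟩ := hσ
  refine sum_col_mul_lt (fun c => ((t c : ℕ) : ℤ)) (t a' : ℕ) a.1.2 (A ∪ B) (fun c hc => ?_)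
    (fun c hc h => ?_) (fun c hc h => ?_) σ hσ1 hc₀
  · rw [hmem] at hc
    omega
  · rw [hmem] at hc
    have := hcol' a c h.symm (by omega)
    exact_mod_cast lt_of_lt_of_le hlt this
  · rw [hmem] at hc
    have := hcol' c a' (by omega) (by omega)
    exact_mod_cast this

end Straightening

end Plethysm

end


noncomputable section

namespace Plethysm

section Independence

variable {lam : YoungDiagram} {n : ℕ}

/-- The multiset of pairs (row, entry) of a filling, as an exponent vector. -/
def rowContent (t : lam.cells → Fin n) : (ℕ × Fin n) →₀ ℕ :=
  ∑ c : lam.cells, Finsupp.single (c.1.1, t c) 1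

theorem sum_eq_of_rowContent_eq {t t' : lam.cells → Fin n} (h : rowContent t = rowContent t')
    (w : ℕ × Fin n → ℕ) :
    ∑ c : lam.cells, w (c.1.1, t c) = ∑ c : lam.cells, w (c.1.1, t' c) := by
  have key (t : lam.cells → Fin n) :
      Finsupp.linearCombination ℕ w (rowContent t) = ∑ c : lam.cells, w (c.1.1, t c) := by
    simp [rowContent, map_sum]
  rw [← key, ← key, h]

theorem le_iff_lt_card_of_row_weak {t : lam.cells → Fin n}
    (ht : ∀ c c' : lam.cells, c.1.1 = c'.1.1 → c.1.2 ≤ c'.1.2 → t c ≤ t c')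
    (c : lam.cells) (v : Fin n) : t c ≤ v ↔
      c.1.2 < (Finset.univ.filter fun x : lam.cells => x.1.1 = c.1.1 ∧ t x ≤ v).card := by
  constructor
  · intro h
    rw [Nat.lt_iff_add_one_le, ← Finset.card_range (c.1.2 + 1)]
    refine Finset.card_le_card_of_surjOn (fun c => c.1.2) fun j hj => ?_
    simp only [Finset.coe_range, Set.mem_Iio, Nat.lt_succ_iff] at hj
    have hmem : (c.1.1, j) ∈ lam.cells := by
      rw [YoungDiagram.mem_cells]
      exact lam.up_left_mem le_rfl hj ((lam.mem_cells _).mp c.2)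
    exact ⟨⟨(c.1.1, j), hmem⟩, by simpa using (ht ⟨(c.1.1, j), hmem⟩ c rfl hj).trans h, rfl⟩
  · intro h
    by_contra hv
    refine h.not_ge ?_
    conv_rhs => rw [← Finset.card_range c.1.2]
    refine Finset.card_le_card_of_injOn (fun c => c.1.2) (fun x hx => ?_) fun x hx y hy hxy => ?_
    · rw [Finset.mem_coe, Finset.mem_filter] at hx
      rw [Finset.mem_coe, Finset.mem_range]
      by_contra hlt
      exact hv ((ht c x hx.2.1.symm (not_lt.mp hlt)).trans hx.2.2)
    · rw [Finset.mem_coe, Finset.mem_filter] at hx hy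
      exact Subtype.ext (Prod.ext (hx.2.1.trans hy.2.1.symm) hxy)

theorem eq_of_rowContent_eq {t t' : lam.cells → Fin n} (ht : IsSemistandard t)
    (ht' : IsSemistandard t') (h : rowContent t = rowContent t') : t = t' := by
  ext1 c
  refine eq_of_forall_ge_iff fun v => ?_
  rw [le_iff_lt_card_of_row_weak ht.row_weak, le_iff_lt_card_of_row_weak ht'.row_weak]
  have := sum_eq_of_rowContent_eq h fun p => if p.1 = c.1.1 ∧ p.2 ≤ v then 1 else 0
  rw [Finset.card_filter, Finset.card_filter, this]

/-- A strictly increasing permutation of a finite set is trivial. -/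
theorem perm_eq_one_of_strictMono {α : Type*} [Finite α] (f : α → ℕ)
    (hf : Function.Injective f) (τ : Equiv.Perm α)
    (h : ∀ a b, f a < f b → f (τ a) < f (τ b)) : τ = 1 := by
  by_contra hne
  obtain ⟨a₀, ha₀⟩ : ∃ a, τ a ≠ a := by
    by_contra! H
    exact hne (Equiv.ext H)
  obtain ⟨a, ha, hmin⟩ := Set.exists_min_image {a | τ a ≠ a} f (Set.toFinite _) ⟨a₀, ha₀⟩
  rcases lt_trichotomy (f (τ a)) (f a) with h1 | h1 | h1
  · have h2 : τ (τ a) = τ a := by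
      by_contra h3
      exact absurd (hmin _ h3) (not_le.mpr h1)
    exact ha (τ.injective h2)
  · exact ha (hf h1)
  · obtain ⟨b, rfl⟩ := τ.surjective a
    have hb : τ b ≠ b := fun hb => ha (congrArg τ hb)
    rcases lt_trichotomy (f (τ b)) (f b) with h2 | h2 | h2
    · exact absurd (h _ _ h2) (not_lt.mpr h1.le)
    · exact hb (hf h2)
    · exact absurd (hmin b hb) (not_le.mpr h2)

theorem sum_row_mul_columnPerm_le {t : lam.cells → Fin n}
    (ht : ∀ c c' : lam.cells, c.1.2 = c'.1.2 → c.1.1 < c'.1.1 → t c < t c')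
    {τ : Equiv.Perm lam.cells} (hτ : τ ∈ columnPerms lam) :
    ∑ c : lam.cells, (τ c).1.1 * (t c : ℕ) ≤ ∑ c : lam.cells, c.1.1 * (t c : ℕ) ∧
    (∑ c : lam.cells, (τ c).1.1 * (t c : ℕ) = ∑ c : lam.cells, c.1.1 * (t c : ℕ) → τ = 1) := by
  rw [mem_columnPerms] at hτ
  set K := lam.colLen 0 + n with hK
  let f : lam.cells → ℕ := fun c => c.1.1 + K * c.1.2
  let g : lam.cells → ℕ := fun c => t c + K * c.1.2
  have hlex {a b j k : ℕ} (ha : a < K) (hb : b < K) :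
      a + K * j < b + K * k ↔ j < k ∨ j = k ∧ a < b := by
    constructor
    · intro h
      rcases lt_trichotomy j k with h1 | h1 | h1
      · exact Or.inl h1
      · subst h1; exact Or.inr ⟨rfl, by omega⟩
      · nlinarith
    · rintro (h | ⟨rfl, h⟩)
      · nlinarith
      · omega
  have hrK (c : lam.cells) : c.1.1 < K := (row_lt_colLen c).trans_le (Nat.le_add_right _ _)
  have htK (c : lam.cells) : (t c : ℕ) < K := (t c).2.trans_le (Nat.le_add_left _ _)
  have hfinj : Function.Injective f := by
    intro c c' h
    have h1 := (hlex (j := c.1.2) (k := c'.1.2) (hrK c) (hrK c')).not.mp h.not_lt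
    have h2 := (hlex (j := c'.1.2) (k := c.1.2) (hrK c') (hrK c)).not.mp h.not_gt
    exact Subtype.ext (Prod.ext (by omega) (by omega))
  have hfg (c c') : f c < f c' → g c < g c' := by
    simp only [f, g, hlex (hrK c) (hrK c'), hlex (htK c) (htK c')]
    rintro (h | ⟨h, h'⟩)
    · exact Or.inl h
    · exact Or.inr ⟨h, ht _ _ h h'⟩
  have hmono : Monovary f g := fun c c' h => by
    by_contra h'
    exact absurd (hfg _ _ (not_le.mp h')) (not_lt.mpr h.le)
  have hsum (τ : Equiv.Perm lam.cells) (hτ : ∀ c, (τ c).1.2 = c.1.2) :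
      ∑ c, f (τ c) * g c = ∑ c : lam.cells, (τ c).1.1 * (t c : ℕ) +
        (∑ c : lam.cells, c.1.1 * (K * c.1.2) + ∑ c : lam.cells, K * c.1.2 * g c) := by
    have e : ∑ c : lam.cells, c.1.1 * (K * c.1.2) =
        ∑ c : lam.cells, (τ c).1.1 * (K * c.1.2) := by
      rw [← Equiv.sum_comp τ]
      simp only [hτ]
    rw [e, ← Finset.sum_add_distrib, ← Finset.sum_add_distrib]
    refine Finset.sum_congr rfl fun c _ => ?_
    simp only [f, g, hτ]
    ring
  have hs1 := hsum 1 (fun _ => rfl)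
  simp only [Equiv.Perm.one_apply] at hs1
  constructor
  · have := hmono.sum_comp_perm_mul_le_sum_mul (σ := τ)
    rw [hsum τ hτ, hs1] at this
    exact Nat.le_of_add_le_add_right this
  · intro heq
    have h1 := (hmono.sum_comp_perm_mul_eq_sum_mul_iff (σ := τ)).mp (by
      rw [hsum τ hτ, hs1, heq])
    refine perm_eq_one_of_strictMono f hfinj τ fun a b hab => ?_
    refine lt_of_le_of_ne (h1 (hfg _ _ hab)) fun h2 => ?_
    exact hab.ne (congrArg f (τ.injective (hfinj h2)))

variable {V : Type*} [AddCommGroup V] [Module ℂ V]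

variable (lam) in
/-- The map from `RowTensor` to polynomials in variables indexed by (row, entry) that sends a
tabloid to the product of the variables of its boxes. -/
def rowPolynomial (b : Module.Basis (Fin n) ℂ V) :
    RowTensor V lam →ₗ[ℂ] MvPolynomial (ℕ × Fin n) ℂ :=
  PiTensorProduct.lift <| (MultilinearMap.mkPiAlgebra ℂ (Fin (lam.colLen 0))
    (MvPolynomial (ℕ × Fin n) ℂ)).compLinearMap fun i =>
      (SymmetricAlgebra.lift (b.constr ℂ fun k =>
        (MvPolynomial.X ((i : ℕ), k) : MvPolynomial (ℕ × Fin n) ℂ))).toLinearMap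

theorem rowPolynomial_tabloid (b : Module.Basis (Fin n) ℂ V) (t : lam.cells → Fin n) :
    rowPolynomial lam b (tabloid lam fun c => b (t c)) =
      MvPolynomial.monomial (rowContent t) 1 := by
  have h1 : rowPolynomial lam b (tabloid lam fun c => b (t c)) =
      ∏ i : Fin (lam.colLen 0), ∏ c : lam.cells with c.1.1 = (i : ℕ),
        (MvPolynomial.X (c.1.1, t c) : MvPolynomial (ℕ × Fin n) ℂ) := by
    simp only [rowPolynomial, tabloid, PiTensorProduct.lift.tprod,
      MultilinearMap.compLinearMap_apply, MultilinearMap.mkPiAlgebra_apply]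
    refine Finset.prod_congr rfl fun i _ => ?_
    simp only [AlgHom.toLinearMap_apply, map_prod, SymmetricAlgebra.lift_ι_apply]
    refine Finset.prod_congr rfl fun c hc => ?_
    rw [Module.Basis.constr_basis, (Finset.mem_filter.mp hc).2]
  rw [h1, rowContent, MvPolynomial.monomial_sum_one]
  rw [← Finset.prod_fiberwise Finset.univ
    (fun c : lam.cells => (⟨c.1.1, row_lt_colLen c⟩ : Fin (lam.colLen 0)))]
  refine Finset.prod_congr rfl fun i _ => Finset.prod_congr ?_ fun _ _ => rfl
  ext c
  simp [Fin.ext_iff]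

theorem rowPolynomial_polytabloid (b : Module.Basis (Fin n) ℂ V) (t : lam.cells → Fin n) :
    rowPolynomial lam b (polytabloid lam fun c => b (t c)) = ∑ τ ∈ columnPerms lam,
      MvPolynomial.monomial (rowContent fun c => t (τ⁻¹ c)) ((Equiv.Perm.sign τ : ℤ) : ℂ) := by
  rw [polytabloid, map_sum]
  refine Finset.sum_congr rfl fun τ _ => ?_
  rw [map_smul, rowPolynomial_tabloid b fun c => t (τ⁻¹ c), MvPolynomial.smul_monomial,
    smul_eq_mul, mul_one]

/-- Semistandard polytabloids are linearly independent. -/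
theorem linearIndependent_polytabloid (b : Module.Basis (Fin n) ℂ V) :
    LinearIndependent ℂ fun s : {s : lam.cells → Fin n // IsSemistandard s} =>
      polytabloid lam fun c => b (s.1 c) := by
  classical
  rw [Fintype.linearIndependent_iff]
  intro g hg
  by_contra! hne
  obtain ⟨s₀, hs₀⟩ := hne
  obtain ⟨s, hs, hmax⟩ := Finset.exists_max_image (Finset.univ.filter fun s => g s ≠ 0)
    (fun s => ∑ c : lam.cells, c.1.1 * (s.1 c : ℕ)) ⟨s₀, by simpa using hs₀⟩
  refine (Finset.mem_filter.mp hs).2 ?_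
  have h1 := congr(MvPolynomial.coeff (rowContent s.1) (rowPolynomial lam b $hg))
  rw [map_sum, map_zero, MvPolynomial.coeff_zero, MvPolynomial.coeff_sum,
    Finset.sum_eq_single s] at h1
  · rw [map_smul, rowPolynomial_polytabloid, MvPolynomial.coeff_smul, MvPolynomial.coeff_sum,
      Finset.sum_eq_single 1] at h1
    · simpa using h1
    · intro τ hτ hne
      rw [MvPolynomial.coeff_monomial, if_neg]
      intro heq
      refine hne ((sum_row_mul_columnPerm_le s.2.col_strict hτ).2 ?_)
      rw [← sum_eq_of_rowContent_eq heq fun p => p.1 * p.2,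
        ← Equiv.sum_comp τ fun c => c.1.1 * (s.1 (τ⁻¹ c) : ℕ)]
      simp
    · intro h
      exact absurd (by simp [mem_columnPerms]) h
  · intro s' _ hs'
    by_cases hg' : g s' = 0
    · rw [hg', zero_smul, map_zero, MvPolynomial.coeff_zero]
    rw [map_smul, rowPolynomial_polytabloid, MvPolynomial.coeff_smul, MvPolynomial.coeff_sum,
      Finset.sum_eq_zero, smul_zero]
    intro τ hτ
    rw [MvPolynomial.coeff_monomial, if_neg]
    intro heq
    have h2 := sum_row_mul_columnPerm_le s'.2.col_strict hτ
    have h3 := hmax s' (by simpa using hg')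
    have h4 : ∑ c : lam.cells, (τ c).1.1 * (s'.1 c : ℕ) = ∑ c : lam.cells, c.1.1 * (s.1 c : ℕ) := by
      rw [← sum_eq_of_rowContent_eq heq fun p => p.1 * p.2,
        ← Equiv.sum_comp τ fun c => c.1.1 * (s'.1 (τ⁻¹ c) : ℕ)]
      simp
    have h5 := h2.2 (le_antisymm h2.1 (h4 ▸ h3))
    subst h5
    exact hs' (Subtype.ext (eq_of_rowContent_eq s'.2 s.2 (by simpa using heq)))
  · simp

open Classical in
variable (lam n) in
/-- The semistandard fillings with entries in `Fin n`. -/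
def semistandardFillings : Finset (lam.cells → Fin n) :=
  Finset.univ.filter IsSemistandard

/-- The trace on a Schur functor of a group element acting diagonally on a basis. -/
theorem trace_schurRep {G : Type*} [Group G] (ρ : Representation ℂ G V)
    (b : Module.Basis (Fin n) ℂ V) (g : G) (χ : Fin n → ℂ) (h : ∀ k, ρ g (b k) = χ k • b k) :
    LinearMap.trace ℂ (schurFunctor lam ρ).toSubmodule (schurRep lam ρ g) =
      ∑ s ∈ semistandardFillings lam n, ∏ c, χ (s c) := by
  classical
  have hspan : Submodule.span ℂ (Set.range
      fun s : {s : lam.cells → Fin n // IsSemistandard s} => polytabloid lam fun c => b (s.1 c)) =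
      (schurFunctor lam ρ).toSubmodule := by
    apply le_antisymm
    · rw [Submodule.span_le]
      rintro _ ⟨s, rfl⟩
      exact Submodule.subset_span ⟨_, rfl⟩
    · refine Submodule.span_le.mpr ?_
      rintro _ ⟨t, rfl⟩
      refine Submodule.span_le.mpr ?_ (polytabloid_mem_span_basis lam b t)
      rintro _ ⟨s, rfl⟩
      have := polytabloid_mem_span_semistandard b s
      rw [Set.image_eq_range] at this
      exact this
  let B := (Module.Basis.span (linearIndependent_polytabloid (lam := lam) b)).map
    (LinearEquiv.ofEq _ _ hspan)
  have hB (s) : (B s : RowTensor V lam) = polytabloid lam fun c => b (s.1 c) := by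
    simp [B, Module.Basis.span_apply]
  have hact (s) : schurRep lam ρ g (B s) = (∏ c, χ (s.1 c)) • B s := by
    apply Subtype.ext
    rw [Submodule.coe_smul, hB]
    change rowMap lam (ρ g) (B s) = _
    rw [hB, rowMap_polytabloid, ← polytabloidMultilinear_apply, ← polytabloidMultilinear_apply,
      ← MultilinearMap.map_smul_univ]
    simp only [h]
  rw [LinearMap.trace_eq_matrix_trace ℂ B, Matrix.trace,
    Finset.sum_subtype (p := IsSemistandard) _ (by simp [semistandardFillings])]
  refine Finset.sum_congr rfl fun s _ => ?_
  rw [Matrix.diag_apply, LinearMap.toMatrix_apply, hact, map_smul, Finsupp.smul_apply,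
    Module.Basis.repr_self, Finsupp.single_eq_same, smul_eq_mul, mul_one]

end Independence

end Plethysm

end


noncomputable section

namespace Plethysm

section SymmetricPower

theorem coe_symRep_apply {G V : Type*} [Group G] [AddCommGroup V] [Module ℂ V]
    (ρ : Representation ℂ G V) (n : ℕ) (g : G) (v : (symPower ρ n).toSubmodule) :
    (symRep ρ n g v : SymmetricAlgebra ℂ V) = symMap (ρ g) v :=
  rfl

theorem coe_schurRep_apply {G V : Type*} [Group G] [AddCommGroup V] [Module ℂ V]
    (lam : YoungDiagram) (ρ : Representation ℂ G V) (g : G)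
    (v : (schurFunctor lam ρ).toSubmodule) :
    (schurRep lam ρ g v : RowTensor V lam) = rowMap lam (ρ g) v :=
  rfl

/-- The standard basis vectors of the natural representation, in the symmetric algebra. -/
def symVar (i : Fin 2) : SymmetricAlgebra ℂ (Fin 2 → ℂ) :=
  SymmetricAlgebra.ι ℂ _ (Pi.single i 1)

theorem range_ι_eq_span :
    LinearMap.range (SymmetricAlgebra.ι ℂ (Fin 2 → ℂ)) = Submodule.span ℂ {symVar 0, symVar 1} := by
  rw [LinearMap.range_eq_map, ← (Pi.basisFun ℂ (Fin 2)).span_eq, Submodule.map_span]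
  congr 1
  ext x
  simp [symVar, eq_comm]

theorem prod_symVar_mem (l : ℕ) (a : Fin l → Fin 2) :
    ∏ j, symVar (a j) ∈ (symPower natRep l).toSubmodule := by
  have key (s : Finset (Fin l)) : ∏ j ∈ s, symVar (a j) ∈
      LinearMap.range (SymmetricAlgebra.ι ℂ (Fin 2 → ℂ)) ^ s.card := by
    induction s using Finset.cons_induction with
    | empty => simp
    | cons j s hj ih =>
      rw [Finset.prod_cons, Finset.card_cons, pow_succ']
      exact Submodule.mul_mem_mul ⟨_, rfl⟩ ih
  have := key Finset.univ
  rwa [Finset.card_univ, Fintype.card_fin] at this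

/-- Products of basis vectors, in a symmetric power. -/
def symProd (l : ℕ) (a : Fin l → Fin 2) : (symPower natRep l).toSubmodule :=
  ⟨∏ j, symVar (a j), prod_symVar_mem l a⟩

theorem symPower_le_span (l : ℕ) : (symPower natRep l).toSubmodule ≤
    Submodule.span ℂ (Set.range fun k : Fin (l + 1) => symVar 0 ^ (l - k : ℕ) * symVar 1 ^ (k : ℕ)) := by
  change LinearMap.range (SymmetricAlgebra.ι ℂ (Fin 2 → ℂ)) ^ l ≤ _
  induction l with
  | zero =>
    rw [pow_zero, Submodule.one_eq_span]
    refine Submodule.span_mono ?_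
    rintro _ rfl
    exact ⟨0, by simp⟩
  | succ l ih =>
    rw [pow_succ]
    refine (mul_le_mul' ih le_rfl).trans ?_
    rw [range_ι_eq_span, Submodule.span_mul_span, Submodule.span_le]
    rintro _ ⟨_, ⟨k, rfl⟩, y, hy, rfl⟩
    refine Submodule.subset_span ?_
    have hk := k.2
    rcases hy with rfl | rfl
    · refine ⟨k.castSucc, ?_⟩
      simp only [Fin.val_castSucc]
      rw [show l + 1 - (k : ℕ) = (l - k) + 1 by omega, pow_succ]
      ring
    · refine ⟨k.succ, ?_⟩
      simp only [Fin.val_succ]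
      rw [show l + 1 - ((k : ℕ) + 1) = l - k by omega, pow_succ]
      ring

theorem linearIndependent_symVar_pow (l : ℕ) : LinearIndependent ℂ
    fun k : Fin (l + 1) => symVar 0 ^ (l - k : ℕ) * symVar 1 ^ (k : ℕ) := by
  let e := SymmetricAlgebra.equivMvPolynomial (Pi.basisFun ℂ (Fin 2))
  have he (i : Fin 2) : e (symVar i) = MvPolynomial.X i := by
    have := SymmetricAlgebra.equivMvPolynomial_ι_apply (Pi.basisFun ℂ (Fin 2)) i
    rwa [Pi.basisFun_apply] at this
  refine LinearIndependent.of_comp e.toLinearMap ?_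
  let m (k : Fin (l + 1)) : Fin 2 →₀ ℕ :=
    Finsupp.single 0 (l - k : ℕ) + Finsupp.single 1 (k : ℕ)
  have hm : Function.Injective m := fun k k' h => by
    have := DFunLike.congr_fun h 1
    simp only [m, Finsupp.add_apply, Finsupp.single_apply] at this
    exact Fin.ext (by simpa using this)
  have key := (MvPolynomial.basisMonomials (Fin 2) ℂ).linearIndependent.comp m hm
  suffices h : e.toLinearMap ∘ (fun k : Fin (l + 1) => symVar 0 ^ (l - k : ℕ) * symVar 1 ^ (k : ℕ))
      = MvPolynomial.basisMonomials (Fin 2) ℂ ∘ m by rw [h]; exact key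
  ext1 k
  simp only [Function.comp_apply, AlgEquiv.toLinearMap_apply, map_mul, map_pow, he,
    MvPolynomial.coe_basisMonomials, m]
  rw [MvPolynomial.X_pow_eq_monomial, MvPolynomial.X_pow_eq_monomial, MvPolynomial.monomial_mul,
    mul_one]

theorem exists_symProd_eq (l : ℕ) (k : Fin (l + 1)) : ∃ a : Fin l → Fin 2,
    (symProd l a : SymmetricAlgebra ℂ (Fin 2 → ℂ)) =
      symVar 0 ^ (l - k : ℕ) * symVar 1 ^ (k : ℕ) := by
  refine ⟨fun j => if (j : ℕ) < k then 1 else 0, ?_⟩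
  have h1 : (Finset.univ.filter fun j : Fin l => (j : ℕ) < k).card = k := by
    rw [Fin.card_filter_val_lt]
    have := k.2
    omega
  have h2 := Finset.card_filter_add_card_filter_not (s := Finset.univ) fun j : Fin l => (j : ℕ) < k
  rw [h1, Finset.card_univ, Fintype.card_fin] at h2
  simp only [symProd, apply_ite symVar, Finset.prod_ite, Finset.prod_const, h1]
  rw [mul_comm]
  congr 2
  omega

/-- The basis of monomials of a symmetric power of the natural representation. -/
def symBasis (l : ℕ) : Module.Basis (Fin (l + 1)) ℂ (symPower natRep l).toSubmodule :=
  (Module.Basis.span (linearIndependent_symVar_pow l)).map <| LinearEquiv.ofEq _ _ <| by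
    refine le_antisymm ?_ (symPower_le_span l)
    rw [Submodule.span_le]
    rintro _ ⟨k, rfl⟩
    obtain ⟨a, ha⟩ := exists_symProd_eq l k
    dsimp only
    rw [← ha]
    exact (symProd l a).2

theorem coe_symBasis (l : ℕ) (k : Fin (l + 1)) :
    (symBasis l k : SymmetricAlgebra ℂ (Fin 2 → ℂ)) =
      symVar 0 ^ (l - k : ℕ) * symVar 1 ^ (k : ℕ) := by
  simp [symBasis, Module.Basis.span_apply]

theorem symMap_symVar (g : Matrix.SpecialLinearGroup (Fin 2) ℂ) (i : Fin 2) :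
    symMap (natRep g) (symVar i) =
      ∑ k, (g : Matrix (Fin 2) (Fin 2) ℂ) k i • symVar k := by
  have h : natRep g (Pi.single i 1) =
      ∑ k, (g : Matrix (Fin 2) (Fin 2) ℂ) k i • (Pi.single k 1 : Fin 2 → ℂ) := by
    change Matrix.toLin' _ _ = _
    ext j
    simp [Pi.single_apply]
  rw [symVar, symMap_ι, h, map_sum]
  simp [symVar]

theorem symRep_symBasis (l : ℕ) (q : ℂˣ) (k : Fin (l + 1)) :
    symRep natRep l (upperSL q 0) (symBasis l k) =
      ((q : ℂ) ^ (l - k : ℕ) * ((q : ℂ)⁻¹) ^ (k : ℕ)) • symBasis l k := by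
  apply Subtype.ext
  rw [coe_symRep_apply, Submodule.coe_smul, coe_symBasis, map_mul, map_pow, map_pow, symMap_symVar, symMap_symVar]
  simp only [Fin.sum_univ_two, upperSL]
  simp [smul_pow, smul_smul, mul_comm]

theorem symRep_symProd (l : ℕ) (g : Matrix.SpecialLinearGroup (Fin 2) ℂ) (a : Fin l → Fin 2) :
    symRep natRep l g (symProd l a) =
      ∑ s : Fin l → Fin 2, (∏ j, (g : Matrix (Fin 2) (Fin 2) ℂ) (s j) (a j)) • symProd l s := by
  apply Subtype.ext
  rw [coe_symRep_apply, symProd, map_prod, Submodule.coe_sum]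
  simp only [symMap_symVar, Finset.prod_univ_sum, Fintype.piFinset_univ, Submodule.coe_smul,
    symProd, Finset.prod_smul]

variable (lam : YoungDiagram) (l : ℕ)

theorem polytabloid_mem_schurFunctor {G V : Type*} [Group G] [AddCommGroup V] [Module ℂ V]
    (ρ : Representation ℂ G V) (t : lam.cells → V) :
    polytabloid lam t ∈ (schurFunctor lam ρ).toSubmodule :=
  Submodule.subset_span ⟨t, rfl⟩

theorem schurRep_polytabloid {G V A : Type*} [Group G] [AddCommGroup V] [Module ℂ V] [Fintype A]
    (ρ : Representation ℂ G V) (v : A → V) (g : G) (w : A → A → ℂ)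
    (h : ∀ a, ρ g (v a) = ∑ s, w s a • v s) (a : lam.cells → A) :
    schurRep lam ρ g ⟨polytabloid lam fun c => v (a c), polytabloid_mem_schurFunctor _ _ _⟩ =
      ∑ S : lam.cells → A, (∏ c, w (S c) (a c)) •
        (⟨polytabloid lam fun c => v (S c), polytabloid_mem_schurFunctor _ _ _⟩ :
          (schurFunctor lam ρ).toSubmodule) := by
  classical
  apply Subtype.ext
  rw [coe_schurRep_apply, rowMap_polytabloid, ← polytabloidMultilinear_apply]
  simp only [h]
  rw [MultilinearMap.map_sum, Submodule.coe_sum]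
  refine Finset.sum_congr rfl fun S _ => ?_
  rw [MultilinearMap.map_smul_univ, polytabloidMultilinear_apply]
  rfl

/-- An equivariant map from a tensor power of the natural representation, from the images of
the basis vectors. -/
def tensorRepLift {ι W : Type*} [Fintype ι] [DecidableEq ι] [AddCommGroup W] [Module ℂ W]
    (σ : Representation ℂ (Matrix.SpecialLinearGroup (Fin 2) ℂ) W) (F : (ι → Fin 2) → W)
    (hF : ∀ (g : Matrix.SpecialLinearGroup (Fin 2) ℂ) (a : ι → Fin 2), σ g (F a) =
      ∑ a', kroneckerPow ι (g : Matrix (Fin 2) (Fin 2) ℂ) a' a • F a') :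
    (tensorRep ι).IntertwiningMap σ where
  toLinearMap := (EuclideanSpace.basisFun (ι → Fin 2) ℂ).toBasis.constr ℂ F
  isIntertwining' g := by
    refine (EuclideanSpace.basisFun (ι → Fin 2) ℂ).toBasis.ext fun a => ?_
    rw [LinearMap.comp_apply, LinearMap.comp_apply, Module.Basis.constr_basis, hF,
      Module.Basis.constr_apply_fintype]
    refine Finset.sum_congr rfl fun a' _ => ?_
    congr 1
    change (Matrix.toEuclideanLin _ _) a' = _
    simp [Matrix.toEuclideanLin]

theorem tensorRepLift_basisFun {ι W : Type*} [Fintype ι] [DecidableEq ι] [AddCommGroup W]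
    [Module ℂ W] (σ : Representation ℂ (Matrix.SpecialLinearGroup (Fin 2) ℂ) W)
    (F : (ι → Fin 2) → W)
    (hF : ∀ (g : Matrix.SpecialLinearGroup (Fin 2) ℂ) (a : ι → Fin 2), σ g (F a) =
      ∑ a', kroneckerPow ι (g : Matrix (Fin 2) (Fin 2) ℂ) a' a • F a') (a : ι → Fin 2) :
    tensorRepLift σ F hF (EuclideanSpace.basisFun (ι → Fin 2) ℂ a) = F a :=
  (EuclideanSpace.basisFun (ι → Fin 2) ℂ).toBasis.constr_basis ℂ F a

theorem kroneckerPow_curry {α β : Type*} [Fintype α] [Fintype β]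
    (g : Matrix (Fin 2) (Fin 2) ℂ) (S : α → β → Fin 2) (a : α × β → Fin 2) :
    kroneckerPow (α × β) g ((Equiv.curry _ _ _).symm S) a =
      ∏ c, ∏ j, g (S c j) (Function.curry a c j) := by
  rw [kroneckerPow, Matrix.of_apply, Fintype.prod_prod_type]
  rfl

/-- The polytabloid whose entries are products of basis vectors. -/
def symPolytabloid (a : lam.cells × Fin l → Fin 2) :
    (schurFunctor lam (symRep natRep l)).toSubmodule :=
  ⟨polytabloid lam fun c => symProd l (Function.curry a c), polytabloid_mem_schurFunctor _ _ _⟩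

theorem schurSymRep_symPolytabloid (g : Matrix.SpecialLinearGroup (Fin 2) ℂ)
    (a : lam.cells × Fin l → Fin 2) :
    schurSymRep lam l g (symPolytabloid lam l a) =
      ∑ a', kroneckerPow (lam.cells × Fin l) (g : Matrix (Fin 2) (Fin 2) ℂ) a' a •
        symPolytabloid lam l a' := by
  refine (schurRep_polytabloid lam (symRep natRep l) (symProd l) g _ (symRep_symProd l g)
    (Function.curry a)).trans ?_
  refine Fintype.sum_equiv (Equiv.curry _ _ _).symm _ _ fun S => ?_
  exact congrArg (fun x : ℂ => x • symPolytabloid lam l ((Equiv.curry _ _ _).symm S))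
    (kroneckerPow_curry g S a).symm

/-- A surjection from a tensor power of the natural representation to `∇^λ Sym^l E`. -/
def tensorToSchur :
    (tensorRep (lam.cells × Fin l)).IntertwiningMap (schurSymRep lam l) :=
  tensorRepLift (W := (schurFunctor lam (symRep natRep l)).toSubmodule) (schurSymRep lam l)
    (symPolytabloid lam l) (schurSymRep_symPolytabloid lam l)

theorem tensorToSchur_surjective : Function.Surjective (tensorToSchur lam l) := by
  have h : (schurFunctor lam (symRep natRep l)).toSubmodule ≤
      (LinearMap.range (tensorToSchur lam l).toLinearMap).map (Submodule.subtype _) := by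
    refine Submodule.span_le.mpr ?_
    rintro _ ⟨t, rfl⟩
    refine Submodule.span_le.mpr ?_ (polytabloid_mem_span_basis lam (symBasis l) t)
    rintro _ ⟨s, rfl⟩
    choose a ha using exists_symProd_eq l
    refine ⟨symPolytabloid lam l fun p => a (s p.1) p.2,
      ⟨EuclideanSpace.basisFun (lam.cells × Fin l → Fin 2) ℂ fun p => a (s p.1) p.2, ?_⟩, ?_⟩
    · exact tensorRepLift_basisFun _ _ _ _
    · simp only [symPolytabloid, Submodule.subtype_apply]
      congr 1
      ext1 c
      exact Subtype.ext ((ha (s c)).trans (coe_symBasis l (s c)).symm)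
  intro w
  obtain ⟨w', ⟨v, hv⟩, hw⟩ := h w.2
  exact ⟨v, hv.trans (Subtype.ext hw)⟩

end SymmetricPower

end Plethysm

end


noncomputable section

namespace Plethysm

section CharacterPolynomial

open Polynomial

/-- The principal specialization of a Schur polynomial in `n` variables, as a sum over
semistandard fillings; an entry `v` has weight `X ^ (n - 1 - v)`. -/
def schurPoly (lam : YoungDiagram) (n : ℕ) : ℂ[X] :=
  ∑ s ∈ semistandardFillings lam n, X ^ ∑ c, (n - 1 - (s c : ℕ))

theorem trace_eq_of_equiv {G V W : Type*} [Group G] [AddCommGroup V] [Module ℂ V]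
    [AddCommGroup W] [Module ℂ W] {ρ : Representation ℂ G V} {σ : Representation ℂ G W}
    (e : ρ.Equiv σ) (g : G) : LinearMap.trace ℂ V (ρ g) = LinearMap.trace ℂ W (σ g) :=
  congrFun (Representation.char_iso e) g

/-- The character of `∇^λ Sym^l E` on the diagonal torus. -/
def torusTrace (lam : YoungDiagram) (l : ℕ) (q : ℂˣ) : ℂ :=
  LinearMap.trace ℂ (schurFunctor lam (symRep natRep l)).toSubmodule
    (schurSymRep lam l (upperSL q 0))

theorem torusTrace_eq_schurPoly (lam : YoungDiagram) (l : ℕ) (q : ℂˣ) :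
    (q : ℂ) ^ (l * lam.card) * torusTrace lam l q = (schurPoly lam (l + 1)).eval ((q : ℂ) ^ 2) := by
  rw [torusTrace, trace_schurRep (symRep natRep l) (symBasis l) _ _ (symRep_symBasis l q), schurPoly,
    eval_finsetSum, Finset.mul_sum]
  refine Finset.sum_congr rfl fun s _ => ?_
  have h1 : (q : ℂ) ^ (l * lam.card) = ∏ _c : lam.cells, (q : ℂ) ^ l := by
    rw [Finset.prod_const, Finset.card_univ, Fintype.card_coe, ← pow_mul]
  rw [h1, ← Finset.prod_mul_distrib, eval_pow, eval_X, ← Finset.prod_pow_eq_pow_sum]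
  refine Finset.prod_congr rfl fun c _ => ?_
  have hk : (s c : ℕ) ≤ l := Nat.lt_succ_iff.mp (s c).2
  obtain ⟨d, hd⟩ := Nat.exists_eq_add_of_le hk
  rw [Nat.add_sub_cancel, ← pow_mul]
  have h2 : l - (s c : ℕ) = d := by omega
  have hq := q.ne_zero
  rw [h2]
  nth_rewrite 1 [hd]
  rw [pow_add, inv_pow, two_mul, pow_add]
  field_simp

theorem nonempty_equiv_iff_torusTrace_eq (lam mu : YoungDiagram) (l m : ℕ) :
    Nonempty ((schurSymRep lam l).Equiv (schurSymRep mu m)) ↔ ∀ q : ℂˣ,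
      torusTrace lam l q = torusTrace mu m q := by
  constructor
  · rintro ⟨e⟩ q
    exact trace_eq_of_equiv (V := (schurFunctor lam (symRep natRep l)).toSubmodule)
      (W := (schurFunctor mu (symRep natRep m)).toSubmodule) e _
  · intro h
    exact nonempty_equiv_of_character_torus_eq
      (W := (schurFunctor lam (symRep natRep l)).toSubmodule)
      (W' := (schurFunctor mu (symRep natRep m)).toSubmodule)
      (tensorToSchur lam l) (tensorToSchur_surjective lam l)
      (tensorToSchur mu m) (tensorToSchur_surjective mu m) h

theorem nonempty_equiv_iff_schurPoly (lam mu : YoungDiagram) (l m : ℕ) :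
    Nonempty ((schurSymRep lam l).Equiv (schurSymRep mu m)) ↔
      X ^ (m * mu.card) * expand ℂ 2 (schurPoly lam (l + 1)) =
      X ^ (l * lam.card) * expand ℂ 2 (schurPoly mu (m + 1)) := by
  rw [nonempty_equiv_iff_torusTrace_eq]
  have key (q : ℂˣ) (a b : ℂ) : a = b ↔
      (q : ℂ) ^ (m * mu.card) * ((q : ℂ) ^ (l * lam.card) * a) =
      (q : ℂ) ^ (l * lam.card) * ((q : ℂ) ^ (m * mu.card) * b) := by
    have := q.ne_zero
    constructor
    · rintro rfl; ring
    · intro h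
      rw [mul_left_comm] at h
      exact mul_left_cancel₀ (pow_ne_zero _ this) (mul_left_cancel₀ (pow_ne_zero _ this) h)
  constructor
  · intro h
    refine eq_of_infinite_eval_eq _ _ (Set.Infinite.mono (s := {0}ᶜ) (fun q hq => ?_)
      (Set.finite_singleton 0).infinite_compl)
    replace hq : q ≠ 0 := hq
    have := (key (Units.mk0 q hq) _ _).mp (h (Units.mk0 q hq))
    rw [torusTrace_eq_schurPoly, torusTrace_eq_schurPoly, Units.val_mk0] at this
    simpa [expand_eval] using this
  · intro h q
    rw [key q, torusTrace_eq_schurPoly, torusTrace_eq_schurPoly]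
    simpa [expand_eval] using congr(eval (q : ℂ) $h)

end CharacterPolynomial

end Plethysm

end


noncomputable section

namespace Plethysm

section Branching

open Polynomial

theorem sum_cells {M : Type*} [AddCommMonoid M] (lam : YoungDiagram) {n : ℕ}
    (h : lam.colLen 0 ≤ n) (f : ℕ × ℕ → M) :
    ∑ c ∈ lam.cells, f c = ∑ i ∈ Finset.range n, ∑ j ∈ Finset.range (lam.rowLen i), f (i, j) := by
  rw [Finset.sum_sigma']
  refine Finset.sum_nbij' (fun c => ⟨c.1, c.2⟩) (fun p => (p.1, p.2)) ?_ ?_ (by simp) (by simp)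
    (by simp)
  · intro c hc
    rw [Finset.mem_sigma, Finset.mem_range, Finset.mem_range, ← YoungDiagram.mem_iff_lt_rowLen]
    exact ⟨(row_lt_colLen ⟨c, hc⟩).trans_le h, (lam.mem_cells c).mp hc⟩
  · intro p hp
    rw [Finset.mem_sigma, Finset.mem_range, Finset.mem_range,
      ← YoungDiagram.mem_iff_lt_rowLen] at hp
    exact (lam.mem_cells _).mpr hp.2

theorem card_eq_sum_rowLen (lam : YoungDiagram) {n : ℕ} (h : lam.colLen 0 ≤ n) :
    lam.card = ∑ i ∈ Finset.range n, lam.rowLen i := by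
  have := sum_cells lam h fun _ => 1
  simpa [YoungDiagram.card] using this

variable {n : ℕ}

/-- The Young diagram with row lengths `r` (if `r` is antitone). -/
def diagramOfRows (r : Fin n → ℕ) : YoungDiagram where
  cells := (Finset.range n ×ˢ Finset.range (∑ i, r i)).filter fun c =>
    ∀ k : Fin n, (k : ℕ) ≤ c.1 → c.2 < r k
  isLowerSet := by
    rintro ⟨i, j⟩ ⟨i', j'⟩ ⟨hi, hj⟩ h
    simp only [Finset.coe_filter, Finset.mem_product, Finset.mem_range, Set.mem_ofPred_eq] at h hi hj ⊢
    exact ⟨⟨by omega, by omega⟩, fun k hk => by have := h.2 k (by omega); omega⟩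

theorem mem_diagramOfRows {r : Fin n → ℕ} (hr : Antitone r) (i j : ℕ) :
    (i, j) ∈ diagramOfRows r ↔ ∃ h : i < n, j < r ⟨i, h⟩ := by
  rw [← YoungDiagram.mem_cells]
  simp only [diagramOfRows, Finset.mem_filter, Finset.mem_product, Finset.mem_range]
  constructor
  · rintro ⟨⟨h1, -⟩, h2⟩
    exact ⟨h1, h2 ⟨i, h1⟩ le_rfl⟩
  · rintro ⟨h1, h2⟩
    refine ⟨⟨h1, h2.trans_le ?_⟩, fun k hk => h2.trans_le (hr hk)⟩
    exact Finset.single_le_sum (f := r) (fun _ _ => Nat.zero_le _) (Finset.mem_univ _)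

theorem rowLen_diagramOfRows {r : Fin n → ℕ} (hr : Antitone r) (i : Fin n) :
    (diagramOfRows r).rowLen i = r i := by
  refine eq_of_forall_lt_iff fun j => ?_
  rw [← YoungDiagram.mem_iff_lt_rowLen, mem_diagramOfRows hr]
  simp

theorem colLen_diagramOfRows {r : Fin n → ℕ} (hr : Antitone r) :
    (diagramOfRows r).colLen 0 ≤ n := by
  by_contra h
  rw [not_le, ← YoungDiagram.mem_iff_lt_colLen, mem_diagramOfRows hr] at h
  exact lt_irrefl _ h.1

/-- The sequences of row lengths interlacing with a partition. -/
def interlacing (lam : YoungDiagram) (n : ℕ) : Finset (Fin n → ℕ) :=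
  Fintype.piFinset fun i => Finset.Icc (lam.rowLen (i + 1)) (lam.rowLen i)

variable {lam : YoungDiagram}

theorem mem_interlacing {r : Fin n → ℕ} :
    r ∈ interlacing lam n ↔ ∀ i : Fin n, lam.rowLen (i + 1) ≤ r i ∧ r i ≤ lam.rowLen i := by
  simp [interlacing]

theorem antitone_of_mem_interlacing {r : Fin n → ℕ} (hr : r ∈ interlacing lam n) :
    Antitone r := by
  rw [mem_interlacing] at hr
  intro i j hij
  rcases hij.eq_or_lt with rfl | h
  · exact le_rfl
  · exact (hr j).2.trans ((lam.rowLen_anti _ _ (Nat.succ_le_of_lt h)).trans (hr i).1)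

theorem diagramOfRows_le {r : Fin n → ℕ} (hr : r ∈ interlacing lam n) {c : ℕ × ℕ}
    (hc : c ∈ diagramOfRows r) : c ∈ lam := by
  obtain ⟨h1, h2⟩ := (mem_diagramOfRows (antitone_of_mem_interlacing hr) c.1 c.2).mp hc
  exact YoungDiagram.mem_iff_lt_rowLen.mpr (h2.trans_le (mem_interlacing.mp hr _).2)

theorem mem_semistandardFillings {s : lam.cells → Fin n} :
    s ∈ semistandardFillings lam n ↔ IsSemistandard s := by
  simp [semistandardFillings]

theorem row_le_of_isSemistandard {s : lam.cells → Fin n} (hs : IsSemistandard s)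
    (c : lam.cells) : c.1.1 ≤ s c := by
  obtain ⟨⟨i, j⟩, hc⟩ := c
  induction i with
  | zero => exact Nat.zero_le _
  | succ i ih =>
    have hmem : (i, j) ∈ lam.cells := by
      rw [YoungDiagram.mem_cells] at hc ⊢
      exact lam.up_left_mem (Nat.le_succ i) le_rfl hc
    have h1 := ih hmem
    have h2 := hs.col_strict ⟨(i, j), hmem⟩ ⟨(i + 1, j), hc⟩ rfl (Nat.lt_succ_self i)
    rw [Fin.lt_def] at h2
    simp only at h1 ⊢
    omega

/-- The numbers of entries less than `n` in each row. -/
def smallRowLens (s : lam.cells → Fin (n + 1)) (i : Fin n) : ℕ :=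
  (Finset.univ.filter fun x : lam.cells => x.1.1 = i ∧ (s x : ℕ) < n).card

theorem lt_smallRowLens_iff {s : lam.cells → Fin (n + 1)} (hs : IsSemistandard s)
    (c : lam.cells) (h : c.1.1 < n) :
    c.1.2 < smallRowLens s ⟨c.1.1, h⟩ ↔ (s c : ℕ) < n := by
  have key (x : lam.cells) : (s x : ℕ) < n ↔ s x ≤ ⟨n - 1, by omega⟩ := by
    rw [Fin.le_def]
    simp only
    omega
  rw [key, le_iff_lt_card_of_row_weak hs.row_weak, smallRowLens]
  simp only [key]

theorem smallRowLens_mem {s : lam.cells → Fin (n + 1)} (hs : IsSemistandard s) :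
    smallRowLens s ∈ interlacing lam n := by
  rw [mem_interlacing]
  refine fun i => ⟨?_, ?_⟩
  · refine le_of_forall_lt fun j hj => ?_
    have hmem : (i.1 + 1, j) ∈ lam := YoungDiagram.mem_iff_lt_rowLen.mpr hj
    have hmem' : (i.1, j) ∈ lam := lam.up_left_mem (Nat.le_succ _) le_rfl hmem
    have := hs.col_strict ⟨_, (lam.mem_cells _).mpr hmem'⟩ ⟨_, (lam.mem_cells _).mpr hmem⟩ rfl
      (Nat.lt_succ_self _)
    refine (lt_smallRowLens_iff hs ⟨(i.1, j), (lam.mem_cells _).mpr hmem'⟩ i.2).mpr ?_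
    exact lt_of_lt_of_le this (Nat.lt_succ_iff.mp (Fin.is_lt _))
  · rw [← Finset.card_range (lam.rowLen i), smallRowLens]
    refine Finset.card_le_card_of_injOn (fun c => c.1.2) (fun c hc => ?_) fun x hx y hy hxy => ?_
    · simp only [Finset.coe_filter, Finset.mem_univ, true_and, Set.mem_ofPred_eq] at hc
      rw [Finset.mem_coe, Finset.mem_range, ← hc.1, ← YoungDiagram.mem_iff_lt_rowLen]
      exact (lam.mem_cells _).mp c.2
    · simp only [Finset.coe_filter, Finset.mem_univ, true_and, Set.mem_ofPred_eq] at hx hy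
      exact Subtype.ext (Prod.ext (hx.1.trans hy.1.symm) hxy)

theorem lt_iff_mem_diagramOfRows {s : lam.cells → Fin (n + 1)} (hs : IsSemistandard s)
    (c : lam.cells) : (s c : ℕ) < n ↔ c.1 ∈ diagramOfRows (smallRowLens s) := by
  have hanti := antitone_of_mem_interlacing (smallRowLens_mem hs)
  rw [mem_diagramOfRows hanti c.1.1 c.1.2]
  constructor
  · intro h
    have := (row_le_of_isSemistandard hs c).trans_lt h
    exact ⟨this, (lt_smallRowLens_iff hs c this).mpr h⟩
  · rintro ⟨h1, h2⟩
    exact (lt_smallRowLens_iff hs c h1).mp h2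

/-- Extend a filling by the largest entry. -/
def extendFilling (lam : YoungDiagram) {mu : YoungDiagram} (t : mu.cells → Fin n) :
    lam.cells → Fin (n + 1) := fun c =>
  if h : c.1 ∈ mu.cells then (t ⟨c.1, h⟩).castSucc else Fin.last n

theorem extendFilling_lt_iff {mu : YoungDiagram} (t : mu.cells → Fin n) (c : lam.cells) :
    (extendFilling lam t c : ℕ) < n ↔ c.1 ∈ mu.cells := by
  rw [extendFilling]
  split_ifs with h <;> simp [h]

theorem extendFilling_isSemistandard (hlam : lam.colLen 0 ≤ n + 1) {r : Fin n → ℕ}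
    (hr : r ∈ interlacing lam n) {t : (diagramOfRows r).cells → Fin n} (ht : IsSemistandard t) :
    IsSemistandard (extendFilling lam t) := by
  constructor
  · intro c c' h1 h2
    by_cases hc' : c'.1 ∈ (diagramOfRows r).cells
    · have hc : c.1 ∈ (diagramOfRows r).cells :=
        (diagramOfRows r).up_left_mem h1.le h2 hc'
      simp only [extendFilling, hc, hc', dif_pos, Fin.castSucc_le_castSucc_iff]
      exact ht.row_weak ⟨_, hc⟩ ⟨_, hc'⟩ h1 h2
    · simp only [extendFilling, hc', dif_neg, not_false_eq_true, Fin.le_last]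
  · intro c c' h1 h2
    have hc : c.1 ∈ (diagramOfRows r).cells := by
      have hn : c.1.1 < n := by
        have := (row_lt_colLen c').trans_le hlam
        omega
      refine (mem_diagramOfRows (antitone_of_mem_interlacing hr) c.1.1 c.1.2).mpr ⟨hn, ?_⟩
      refine lt_of_lt_of_le ?_ (mem_interlacing.mp hr ⟨_, hn⟩).1
      rw [← YoungDiagram.mem_iff_lt_rowLen, h1]
      exact lam.up_left_mem (Nat.succ_le_of_lt h2) le_rfl ((lam.mem_cells _).mp c'.2)
    by_cases hc' : c'.1 ∈ (diagramOfRows r).cells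
    · simp only [extendFilling, hc, hc', dif_pos, Fin.castSucc_lt_castSucc_iff]
      exact ht.col_strict ⟨_, hc⟩ ⟨_, hc'⟩ h1 h2
    · simp only [extendFilling, hc, hc', dif_neg, dif_pos, not_false_eq_true, Fin.castSucc_lt_last]

theorem smallRowLens_extendFilling {r : Fin n → ℕ} (hr : r ∈ interlacing lam n)
    (t : (diagramOfRows r).cells → Fin n) : smallRowLens (extendFilling lam t) = r := by
  have hanti := antitone_of_mem_interlacing hr
  ext i
  rw [smallRowLens, ← Finset.card_range (r i)]
  refine Finset.card_nbij (fun c => c.1.2) (fun c hc => ?_) (fun x hx y hy hxy => ?_)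
    fun j hj => ?_
  · simp only [Finset.coe_filter, Finset.mem_univ, true_and, Set.mem_ofPred_eq,
      extendFilling_lt_iff] at hc
    obtain ⟨_, h⟩ := (mem_diagramOfRows hanti c.1.1 c.1.2).mp hc.2
    rw [Finset.mem_coe, Finset.mem_range]
    convert h
    exact hc.1.symm
  · simp only [Finset.coe_filter, Finset.mem_univ, true_and, Set.mem_ofPred_eq] at hx hy
    exact Subtype.ext (Prod.ext (hx.1.trans hy.1.symm) hxy)
  · have hmem : (i.1, j) ∈ diagramOfRows r :=
      (mem_diagramOfRows hanti _ _).mpr ⟨i.2, by simpa using hj⟩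
    refine ⟨⟨_, (lam.mem_cells _).mpr (diagramOfRows_le hr hmem)⟩, ?_, rfl⟩
    simp only [Finset.coe_filter, Finset.mem_univ, true_and, Set.mem_ofPred_eq,
      extendFilling_lt_iff]
    exact hmem

theorem sum_weight_eq {r : Fin n → ℕ} (hr : r ∈ interlacing lam n)
    (t : (diagramOfRows r).cells → Fin n) :
    ∑ c, (n + 1 - 1 - (extendFilling lam t c : ℕ)) =
      ∑ i, r i + ∑ c, (n - 1 - (t c : ℕ)) := by
  have hanti := antitone_of_mem_interlacing hr
  have h1 : ∑ i, r i = ∑ _c : (diagramOfRows r).cells, 1 := by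
    rw [Finset.sum_const, Finset.card_univ, Fintype.card_coe, smul_eq_mul, mul_one]
    refine Eq.trans ?_ (card_eq_sum_rowLen _ (colLen_diagramOfRows hanti)).symm
    rw [Finset.sum_range]
    exact Finset.sum_congr rfl fun i _ => (rowLen_diagramOfRows hanti i).symm
  rw [h1, ← Finset.sum_add_distrib]
  symm
  refine Finset.sum_of_injOn (fun c => ⟨c.1, diagramOfRows_le hr c.2⟩)
    (fun x _ y _ h => Subtype.ext (congrArg (fun z : lam.cells => z.1) h)) (by simp) ?_ ?_
  · intro c _ hc
    have : c.1 ∉ (diagramOfRows r).cells := fun h => hc ⟨⟨c.1, h⟩, by simp, rfl⟩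
    simp [extendFilling, this]
  · intro c _
    have h := (t c).2
    simp only [extendFilling, c.2, dif_pos, Fin.val_castSucc, Subtype.coe_eta]
    omega

/-- The branching rule for principal specializations of Schur polynomials. -/
theorem schurPoly_succ (hlam : lam.colLen 0 ≤ n + 1) :
    schurPoly lam (n + 1) =
      ∑ r ∈ interlacing lam n, X ^ (∑ i, r i) * schurPoly (diagramOfRows r) n := by
  rw [schurPoly, ← Finset.sum_fiberwise_of_maps_to (g := smallRowLens) (t := interlacing lam n)
    fun s hs => smallRowLens_mem (mem_semistandardFillings.mp hs)]
  refine Finset.sum_congr rfl fun r hr => ?_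
  rw [schurPoly, Finset.mul_sum]
  have hex (s) (hs : s ∈ (semistandardFillings lam (n + 1)).filter (smallRowLens · = r))
      (c : (diagramOfRows r).cells) : (s ⟨c.1, diagramOfRows_le hr c.2⟩ : ℕ) < n := by
    rw [Finset.mem_filter, mem_semistandardFillings] at hs
    rw [lt_iff_mem_diagramOfRows hs.1, hs.2]
    exact c.2
  have hinv (s) (hs : s ∈ (semistandardFillings lam (n + 1)).filter (smallRowLens · = r)) :
      extendFilling lam (fun c : (diagramOfRows r).cells => ⟨_, hex s hs c⟩) = s := by
    ext c
    by_cases hc : c.1 ∈ (diagramOfRows r).cells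
    · simp [extendFilling, hc]
    · simp only [extendFilling, hc, dif_neg, not_false_eq_true, Fin.val_last]
      rw [Finset.mem_filter, mem_semistandardFillings] at hs
      have := (lt_iff_mem_diagramOfRows hs.1 c).not.mpr (by rwa [hs.2])
      have h2 := (s c).2
      omega
  refine Finset.sum_bij' (fun s hs c => ⟨_, hex s hs c⟩) (fun t _ => extendFilling lam t)
    ?_ ?_ hinv ?_ ?_
  · intro s hs
    have hs1 := mem_semistandardFillings.mp (Finset.mem_filter.mp hs).1
    rw [mem_semistandardFillings]
    exact ⟨fun c c' h1 h2 => hs1.row_weak _ _ h1 h2, fun c c' h1 h2 => hs1.col_strict _ _ h1 h2⟩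
  · intro t ht
    rw [Finset.mem_filter, mem_semistandardFillings]
    exact ⟨extendFilling_isSemistandard hlam hr (mem_semistandardFillings.mp ht),
      smallRowLens_extendFilling hr t⟩
  · intro t ht
    ext c
    simp [extendFilling]
  · intro s hs
    rw [← pow_add, ← sum_weight_eq hr, hinv s hs]

end Branching

end Plethysm

end


noncomputable section

namespace Plethysm

section Alternant

open Polynomial

/-- The strictly decreasing sequence attached to a partition with at most `n` parts. -/
def shiftedPart (lam : YoungDiagram) (n : ℕ) (i : ℕ) : ℕ := lam.rowLen i + (n - 1 - i)

/-- The Vandermonde determinant in the powers of `X` given by the shifted parts. -/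
def alternant (lam : YoungDiagram) (n : ℕ) : ℂ[X] :=
  (Matrix.vandermonde fun i : Fin n => (X : ℂ[X]) ^ shiftedPart lam n i).det

/-- The ratio between consecutive alternants in the branching rule. -/
def alternantStep (n : ℕ) : ℂ[X] :=
  X ^ (∑ i : Fin n, (n - 1 - (i : ℕ))) * ∏ j : Fin n, (1 - X ^ ((j : ℕ) + 1))

theorem sum_Icc_pow_mul (a b d k : ℕ) (h : a ≤ b) :
    (∑ r ∈ Finset.Icc a b, (X : ℂ[X]) ^ ((r + d) * k)) * (1 - X ^ k) =
      X ^ ((a + d) * k) - X ^ ((b + d + 1) * k) := by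
  induction b, h using Nat.le_induction with
  | base => simp; ring
  | succ b h ih =>
    rw [Finset.sum_Icc_succ_top (by omega), add_mul, ih]
    ring

theorem alternant_succ (lam : YoungDiagram) (n : ℕ) :
    alternant lam (n + 1) = alternantStep n *
      ∑ r ∈ interlacing lam n, X ^ (∑ i, r i) * alternant (diagramOfRows r) n := by
  have h1 : alternant lam (n + 1) = (Matrix.of fun i j : Fin n =>
      (X : ℂ[X]) ^ (shiftedPart lam (n + 1) (i + 1) * (j + 1)) -
        X ^ (shiftedPart lam (n + 1) i * (j + 1))).det := by
    let B : Matrix (Fin (n + 1)) (Fin (n + 1)) ℂ[X] := Matrix.of fun i j =>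
      Fin.cases ((X : ℂ[X]) ^ (shiftedPart lam (n + 1) 0 * j)) (fun i : Fin n =>
        (X : ℂ[X]) ^ (shiftedPart lam (n + 1) (i + 1) * j) -
          X ^ (shiftedPart lam (n + 1) i * j)) i
    rw [alternant, Matrix.det_eq_of_forall_row_eq_smul_add_pred (B := B) (fun _ => 1),
      Matrix.det_succ_column_zero, Finset.sum_eq_single 0]
    · simp only [B, Fin.val_zero, pow_zero, one_mul, Matrix.of_apply, mul_zero]
      rw [show (Fin.cases (motive := fun _ => ℂ[X]) 1 _ (0 : Fin (n + 1)) : ℂ[X]) = 1 from rfl,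
        one_mul]
      rfl
    · intro i _ hi
      obtain ⟨i, rfl⟩ := Fin.exists_succ_eq.mpr hi
      simp [B]
    · simp
    · intro j
      simp [B, Matrix.vandermonde_apply, pow_mul]
    · intro i j
      simp [B, Matrix.vandermonde_apply, pow_mul]
  have h2 (i j : Fin n) : (X : ℂ[X]) ^ (shiftedPart lam (n + 1) (i + 1) * (j + 1)) -
        X ^ (shiftedPart lam (n + 1) i * (j + 1)) =
      (1 - X ^ ((j : ℕ) + 1)) * ∑ r ∈ Finset.Icc (lam.rowLen (i + 1)) (lam.rowLen i),
        X ^ ((r + (n - 1 - i)) * (j + 1)) := by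
    rw [mul_comm (1 - _), sum_Icc_pow_mul _ _ _ _ (lam.rowLen_anti _ _ (Nat.le_succ _))]
    have := i.2
    congr 3
    · rw [shiftedPart, show n + 1 - 1 - (i.1 + 1) = n - 1 - i by omega]
    · rw [shiftedPart, show n + 1 - 1 - i.1 = n - 1 - i + 1 by omega, add_assoc]
  have h3 (r : Fin n → ℕ) (hr : r ∈ interlacing lam n) :
      X ^ (∑ i : Fin n, (n - 1 - (i : ℕ))) * (X ^ (∑ i, r i) * alternant (diagramOfRows r) n) =
      (Matrix.of fun i j : Fin n => (X : ℂ[X]) ^ ((r i + (n - 1 - i)) * (j + 1))).det := by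
    rw [← mul_assoc, ← pow_add, add_comm, ← Finset.sum_add_distrib, ← Finset.prod_pow_eq_pow_sum,
      alternant, ← Matrix.det_mul_column]
    congr 1
    ext1 i j
    rw [Matrix.of_apply, Matrix.of_apply, Matrix.vandermonde_apply, shiftedPart,
      rowLen_diagramOfRows (antitone_of_mem_interlacing hr), ← pow_mul, ← pow_add]
    ring_nf
  simp only [h1, h2]
  rw [show (Matrix.of fun i j : Fin n => (1 - (X : ℂ[X]) ^ ((j : ℕ) + 1)) *
      ∑ r ∈ Finset.Icc (lam.rowLen (i + 1)) (lam.rowLen i), X ^ ((r + (n - 1 - i)) * (j + 1))) =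
    Matrix.of fun i j : Fin n => (1 - (X : ℂ[X]) ^ ((j : ℕ) + 1)) *
      (Matrix.of fun i j : Fin n => ∑ r ∈ Finset.Icc (lam.rowLen (i + 1)) (lam.rowLen i),
        (X : ℂ[X]) ^ ((r + (n - 1 - i)) * (j + 1))) i j from rfl, Matrix.det_mul_row]
  have h4 : (Matrix.of fun i j : Fin n => ∑ r ∈ Finset.Icc (lam.rowLen (i + 1)) (lam.rowLen i),
        (X : ℂ[X]) ^ ((r + (n - 1 - i)) * (j + 1))).det =
      ∑ r ∈ interlacing lam n,
        (Matrix.of fun i j : Fin n => (X : ℂ[X]) ^ ((r i + (n - 1 - i)) * (j + 1))).det := by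
    have := (Matrix.detRowAlternating (n := Fin n) (R := ℂ[X])).toMultilinearMap.map_sum_finset
      (fun (i : Fin n) (r : ℕ) => fun j : Fin n => (X : ℂ[X]) ^ ((r + (n - 1 - i)) * (j + 1)))
      (fun i => Finset.Icc (lam.rowLen (i + 1)) (lam.rowLen i))
    refine Eq.trans ?_ this
    refine congrArg Matrix.det ?_
    ext1 i j
    simp
  rw [h4, alternantStep, mul_comm (X ^ _), mul_assoc]
  congr 1
  rw [Finset.mul_sum]
  exact Finset.sum_congr rfl fun r hr => (h3 r hr).symm

theorem eq_bot_of_colLen_eq_zero {lam : YoungDiagram} (h : lam.colLen 0 = 0) : lam = ⊥ := by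
  ext c
  simp only [YoungDiagram.cells_bot, Finset.notMem_empty, iff_false]
  intro hc
  have := row_lt_colLen ⟨c, hc⟩
  omega

theorem schurPoly_bot (n : ℕ) : schurPoly ⊥ n = 1 := by
  have : IsEmpty (⊥ : YoungDiagram).cells :=
    ⟨fun c => Finset.notMem_empty _ c.2⟩
  rw [schurPoly, Finset.sum_eq_single default]
  · simp
  · intro s _ hs
    exact absurd (Subsingleton.elim _ _) hs
  · intro h
    refine absurd ?_ h
    rw [mem_semistandardFillings]
    exact ⟨fun c => isEmptyElim c, fun c => isEmptyElim c⟩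

theorem exists_schurPoly_mul_eq (n : ℕ) : ∃ K : ℂ[X], ∀ lam : YoungDiagram,
    lam.colLen 0 ≤ n → K * schurPoly lam n = alternant lam n := by
  induction n with
  | zero =>
    refine ⟨1, fun lam h => ?_⟩
    rw [eq_bot_of_colLen_eq_zero (Nat.le_zero.mp h), schurPoly_bot]
    simp [alternant]
  | succ n ih =>
    obtain ⟨K, hK⟩ := ih
    refine ⟨alternantStep n * K, fun lam h => ?_⟩
    rw [alternant_succ, schurPoly_succ h, mul_assoc, Finset.mul_sum]
    refine congrArg _ (Finset.sum_congr rfl fun r hr => ?_)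
    rw [← hK _ (colLen_diagramOfRows (antitone_of_mem_interlacing hr))]
    exact mul_left_comm _ _ _

/-- The bialternant formula for principal specializations of Schur polynomials. -/
theorem alternant_bot_mul_schurPoly {lam : YoungDiagram} {n : ℕ} (h : lam.colLen 0 ≤ n) :
    alternant ⊥ n * schurPoly lam n = alternant lam n := by
  obtain ⟨K, hK⟩ := exists_schurPoly_mul_eq n
  have h0 := hK ⊥ (by
    by_contra h0
    exact YoungDiagram.notMem_bot _ (YoungDiagram.mem_iff_lt_colLen.mpr (not_le.mp h0)))
  rw [schurPoly_bot, mul_one] at h0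
  rw [← h0, hK lam h]

end Alternant

end Plethysm

end


noncomputable section

namespace Plethysm

section HookContent

open Polynomial

theorem prod_cells {M : Type*} [CommMonoid M] (lam : YoungDiagram) {n : ℕ}
    (h : lam.colLen 0 ≤ n) (f : ℕ × ℕ → M) :
    ∏ c ∈ lam.cells, f c = ∏ i ∈ Finset.range n, ∏ j ∈ Finset.range (lam.rowLen i), f (i, j) :=
  sum_cells (M := Additive M) lam h f

/-- The hook length of a box. -/
def hookLength (lam : YoungDiagram) (c : ℕ × ℕ) : ℕ :=
  lam.rowLen c.1 - 1 - c.2 + (lam.colLen c.2 - 1 - c.1) + 1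

theorem shiftedPart_lt {lam : YoungDiagram} {n i j : ℕ} (hij : i < j) (hj : j < n) :
    shiftedPart lam n j < shiftedPart lam n i := by
  have := lam.rowLen_anti i j hij.le
  unfold shiftedPart
  omega

theorem hookLength_strictAnti {lam : YoungDiagram} {i j k : ℕ} (hjk : j < k)
    (hk : k < lam.rowLen i) : hookLength lam (i, k) < hookLength lam (i, j) := by
  have h1 := lam.colLen_anti j k hjk.le
  simp only [hookLength]
  omega

theorem injOn_shiftedPart_sub (lam : YoungDiagram) (n i : ℕ) :
    Set.InjOn (fun j => shiftedPart lam n i - shiftedPart lam n j) (Finset.Ioo i n) := by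
  intro a ha b hb hab
  simp only [Finset.coe_Ioo, Set.mem_Ioo] at ha hb hab
  have h1 := shiftedPart_lt (lam := lam) ha.1 ha.2
  have h2 := shiftedPart_lt (lam := lam) hb.1 hb.2
  rcases lt_trichotomy a b with hlt | rfl | hlt
  · have := shiftedPart_lt (lam := lam) hlt hb.2
    omega
  · rfl
  · have := shiftedPart_lt (lam := lam) hlt ha.2
    omega

theorem injOn_hookLength (lam : YoungDiagram) (p i : ℕ) :
    Set.InjOn (fun j => hookLength lam (i, j)) (Finset.Ico p (lam.rowLen i)) := by
  intro a ha b hb hab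
  simp only [Finset.coe_Ico, Set.mem_Ico] at ha hb hab
  rcases lt_trichotomy a b with hlt | rfl | hlt
  · have := hookLength_strictAnti hlt hb.2
    omega
  · rfl
  · have := hookLength_strictAnti hlt ha.2
    omega

theorem image_hookLength_union {lam : YoungDiagram} {n p i : ℕ} (h : lam.colLen p ≤ n)
    (hp : ∀ j < n, p ≤ lam.rowLen j) (hi : i < n) :
    Disjoint ((Finset.Ico p (lam.rowLen i)).image fun j => hookLength lam (i, j))
      ((Finset.Ioo i n).image fun j => shiftedPart lam n i - shiftedPart lam n j) ∧
    ((Finset.Ico p (lam.rowLen i)).image fun j => hookLength lam (i, j)) ∪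
      ((Finset.Ioo i n).image fun j => shiftedPart lam n i - shiftedPart lam n j) =
      Finset.Icc 1 (shiftedPart lam n i - p) := by
  have hcol (c : ℕ) (hc : c ∈ Finset.Ico p (lam.rowLen i)) :
      i < lam.colLen c ∧ lam.colLen c ≤ n := by
    rw [Finset.mem_Ico] at hc
    exact ⟨YoungDiagram.mem_iff_lt_colLen.mp (YoungDiagram.mem_iff_lt_rowLen.mpr hc.2),
      (lam.colLen_anti p c hc.1).trans h⟩
  have hdisj : Disjoint ((Finset.Ico p (lam.rowLen i)).image fun j => hookLength lam (i, j))
      ((Finset.Ioo i n).image fun j => shiftedPart lam n i - shiftedPart lam n j) := by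
    rw [Finset.disjoint_left]
    intro x hx hx'
    obtain ⟨c, hc, rfl⟩ := Finset.mem_image.mp hx
    obtain ⟨j, hj, hjx⟩ := Finset.mem_image.mp hx'
    obtain ⟨h1, h2⟩ := hcol c hc
    rw [Finset.mem_Ico] at hc
    rw [Finset.mem_Ioo] at hj
    have h3 := lam.rowLen_anti i j hj.1.le
    have h4 : c < lam.rowLen j ↔ j < lam.colLen c :=
      YoungDiagram.mem_iff_lt_rowLen.symm.trans YoungDiagram.mem_iff_lt_colLen
    simp only [hookLength, shiftedPart] at hjx
    omega
  have hpi := hp i hi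
  refine ⟨hdisj, Finset.eq_of_subset_of_card_le ?_ ?_⟩
  · intro x hx
    rw [Finset.mem_Icc]
    rcases Finset.mem_union.mp hx with hx | hx <;> obtain ⟨c, hc, rfl⟩ := Finset.mem_image.mp hx
    · obtain ⟨h1, h2⟩ := hcol c hc
      have := Finset.mem_Ico.mp hc
      simp only [hookLength, shiftedPart]
      omega
    · rw [Finset.mem_Ioo] at hc
      have h1 := shiftedPart_lt (lam := lam) hc.1 hc.2
      have h2 := hp c hc.2
      have h3 : lam.rowLen c ≤ shiftedPart lam n c := Nat.le_add_right _ _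
      omega
  · rw [Finset.card_union_of_disjoint hdisj, Finset.card_image_of_injOn,
      Finset.card_image_of_injOn]
    · simp only [Nat.card_Icc, Nat.card_Ico, Nat.card_Ioo, shiftedPart]
      omega
    · exact injOn_shiftedPart_sub lam n i
    · exact injOn_hookLength lam p i

@[to_additive]
theorem prod_Ico_hookLength_mul_prod {M : Type*} [CommMonoid M] {lam : YoungDiagram}
    {n p i : ℕ} (h : lam.colLen p ≤ n) (hp : ∀ j < n, p ≤ lam.rowLen j) (hi : i < n)
    (f : ℕ → M) :
    (∏ j ∈ Finset.Ico p (lam.rowLen i), f (hookLength lam (i, j))) *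
      ∏ j ∈ Finset.Ioo i n, f (shiftedPart lam n i - shiftedPart lam n j) =
    ∏ k ∈ Finset.range (shiftedPart lam n i - p), f (k + 1) := by
  obtain ⟨h1, h2⟩ := image_hookLength_union h hp hi
  have h3 : ∏ k ∈ Finset.range (shiftedPart lam n i - p), f (k + 1) =
      ∏ k ∈ Finset.Icc 1 (shiftedPart lam n i - p), f k := by
    rw [← Finset.Ico_succ_right_eq_Icc, Finset.prod_Ico_eq_prod_range]
    simp only [Nat.succ_eq_succ, Nat.succ_eq_add_one, Nat.add_sub_cancel]
    exact Finset.prod_congr rfl fun k _ => by rw [add_comm]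
  rw [h3, ← h2, Finset.prod_union h1, Finset.prod_image (injOn_shiftedPart_sub lam n i),
    Finset.prod_image (injOn_hookLength lam p i)]

theorem prod_hookLength_mul_prod {M : Type*} [CommMonoid M] {lam : YoungDiagram} {n i : ℕ}
    (h : lam.colLen 0 ≤ n) (hi : i < n) (f : ℕ → M) :
    (∏ j ∈ Finset.range (lam.rowLen i), f (hookLength lam (i, j))) *
      ∏ j ∈ Finset.Ioo i n, f (shiftedPart lam n i - shiftedPart lam n j) =
    (∏ k ∈ Finset.range (n - 1 - i), f (k + 1)) *
      ∏ j ∈ Finset.range (lam.rowLen i), f (n + j - i) := by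
  rw [Finset.range_eq_Ico, prod_Ico_hookLength_mul_prod h (fun _ _ => Nat.zero_le _) hi,
    Nat.sub_zero, shiftedPart, add_comm (lam.rowLen i), Finset.prod_range_add,
    ← Finset.range_eq_Ico]
  congr 1
  exact Finset.prod_congr rfl fun k _ => congrArg f (by omega)

theorem alternant_eq_prod (lam : YoungDiagram) (n : ℕ) :
    alternant lam n = X ^ (∑ i ∈ Finset.range n, ∑ j ∈ Finset.Ioo i n, shiftedPart lam n j) *
      ∏ i ∈ Finset.range n, ∏ j ∈ Finset.Ioo i n,
        (1 - X ^ (shiftedPart lam n i - shiftedPart lam n j)) := by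
  have h (i : Fin n) : ∏ j ∈ Finset.Ioi i,
      ((X : ℂ[X]) ^ shiftedPart lam n j - X ^ shiftedPart lam n i) =
      ∏ j ∈ Finset.Ioo (i : ℕ) n, (X ^ shiftedPart lam n j - X ^ shiftedPart lam n i) := by
    rw [← Fin.map_valEmbedding_Ioi, Finset.prod_map]
    rfl
  rw [alternant, Matrix.det_vandermonde]
  simp only [h]
  rw [Finset.prod_range, ← Finset.prod_pow_eq_pow_sum, Finset.prod_range,
    ← Finset.prod_mul_distrib]
  refine Finset.prod_congr rfl fun i _ => ?_
  rw [← Finset.prod_pow_eq_pow_sum, ← Finset.prod_mul_distrib]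
  refine Finset.prod_congr rfl fun j hj => ?_
  rw [Finset.mem_Ioo] at hj
  rw [mul_sub, mul_one, ← pow_add, Nat.add_sub_cancel' (shiftedPart_lt hj.1 hj.2).le]

theorem one_sub_X_pow_ne_zero {k : ℕ} (hk : 0 < k) : (1 - X ^ k : ℂ[X]) ≠ 0 := by
  intro h
  have := congrArg (eval 0) h
  simp [hk.ne'] at this

theorem sum_shiftedPart (lam : YoungDiagram) (n : ℕ) :
    ∑ i ∈ Finset.range n, ∑ j ∈ Finset.Ioo i n, shiftedPart lam n j =
      ∑ i ∈ Finset.range n, ∑ _j ∈ Finset.range (lam.rowLen i), i +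
      ∑ i ∈ Finset.range n, ∑ j ∈ Finset.Ioo i n, (n - 1 - j) := by
  simp only [shiftedPart, Finset.sum_add_distrib]
  congr 1
  simp only [Finset.sum_const, Finset.card_range, smul_eq_mul]
  rw [Finset.sum_comm' (t' := Finset.range n) (s' := fun j => Finset.range j)]
  · exact Finset.sum_congr rfl fun j _ => by simp [mul_comm]
  · intro i j
    simp only [Finset.mem_range, Finset.mem_Ioo]
    omega

theorem rowLen_bot (i : ℕ) : (⊥ : YoungDiagram).rowLen i = 0 := by
  by_contra h
  exact YoungDiagram.notMem_bot _
    (YoungDiagram.mem_iff_lt_rowLen.mpr (Nat.pos_of_ne_zero h))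

theorem alternant_mul_prod_hookLength {lam : YoungDiagram} {n : ℕ} (h : lam.colLen 0 ≤ n) :
    alternant lam n * ∏ c ∈ lam.cells, (1 - X ^ hookLength lam c) =
      alternant ⊥ n * (X ^ (∑ c ∈ lam.cells, c.1) *
        ∏ c ∈ lam.cells, (1 - X ^ (n + c.2 - c.1))) := by
  have key (mu : YoungDiagram) (hmu : mu.colLen 0 ≤ n) :
      alternant mu n * ∏ c ∈ mu.cells, (1 - X ^ hookLength mu c) =
      X ^ (∑ i ∈ Finset.range n, ∑ j ∈ Finset.Ioo i n, (n - 1 - j)) *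
        (∏ i ∈ Finset.range n, ∏ k ∈ Finset.range (n - 1 - i), (1 - X ^ (k + 1))) *
      (X ^ (∑ c ∈ mu.cells, c.1) * ∏ c ∈ mu.cells, (1 - X ^ (n + c.2 - c.1))) := by
    have h1 : (∏ c ∈ mu.cells, (1 - X ^ hookLength mu c)) *
        (∏ i ∈ Finset.range n, ∏ j ∈ Finset.Ioo i n,
          (1 - X ^ (shiftedPart mu n i - shiftedPart mu n j))) =
        (∏ i ∈ Finset.range n, ∏ k ∈ Finset.range (n - 1 - i), (1 - X ^ (k + 1))) *
          ∏ c ∈ mu.cells, (1 - (X : ℂ[X]) ^ (n + c.2 - c.1)) := by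
      rw [prod_cells mu hmu, prod_cells mu hmu, ← Finset.prod_mul_distrib,
        ← Finset.prod_mul_distrib]
      exact Finset.prod_congr rfl fun i hi =>
        prod_hookLength_mul_prod hmu (Finset.mem_range.mp hi) fun k => 1 - (X : ℂ[X]) ^ k
    rw [alternant_eq_prod, sum_shiftedPart, pow_add, sum_cells mu hmu, mul_assoc,
      mul_comm (∏ i ∈ Finset.range n, ∏ j ∈ Finset.Ioo i n, _), h1]
    ring
  have hbot := key ⊥ (by
    by_contra h0
    exact YoungDiagram.notMem_bot _ (YoungDiagram.mem_iff_lt_colLen.mpr (not_le.mp h0)))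
  simp only [YoungDiagram.cells_bot, Finset.prod_empty, Finset.sum_empty, pow_zero,
    mul_one] at hbot
  rw [hbot, key lam h]

theorem alternant_ne_zero (lam : YoungDiagram) (n : ℕ) : alternant lam n ≠ 0 := by
  rw [alternant_eq_prod]
  refine mul_ne_zero (pow_ne_zero _ X_ne_zero) (Finset.prod_ne_zero_iff.mpr fun i _ =>
    Finset.prod_ne_zero_iff.mpr fun j hj => one_sub_X_pow_ne_zero ?_)
  rw [Finset.mem_Ioo] at hj
  exact Nat.sub_pos_of_lt (shiftedPart_lt hj.1 hj.2)

/-- Stanley's hook content formula. -/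
theorem schurPoly_mul_prod_hookLength {lam : YoungDiagram} {n : ℕ} (h : lam.colLen 0 ≤ n) :
    schurPoly lam n * ∏ c ∈ lam.cells, (1 - X ^ hookLength lam c) =
      X ^ (∑ c ∈ lam.cells, c.1) * ∏ c ∈ lam.cells, (1 - X ^ (n + c.2 - c.1)) := by
  refine mul_left_cancel₀ (alternant_ne_zero ⊥ n) ?_
  rw [← mul_assoc, alternant_bot_mul_schurPoly h, alternant_mul_prod_hookLength h]

/-- The multiset of hook lengths. -/
def hookLengths (lam : YoungDiagram) : Multiset ℕ :=
  lam.cells.val.map (hookLength lam)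

/-- The multiset of contents, shifted by `n`. -/
def shiftedContents (lam : YoungDiagram) (n : ℕ) : Multiset ℕ :=
  lam.cells.val.map fun c => n + c.2 - c.1

theorem eq_of_prod_one_sub_X_pow_eq (A B : Multiset ℕ) (hA : ∀ a ∈ A, 0 < a)
    (hB : ∀ b ∈ B, 0 < b) (a b : ℕ)
    (h : (X : ℂ[X]) ^ a * (A.map fun k => 1 - X ^ k).prod =
      X ^ b * (B.map fun k => 1 - X ^ k).prod) : A = B := by
  induction hN : A.card + B.card using Nat.strong_induction_on generalizing A B with
  | _ N ih =>
  subst hN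
  by_cases hAB : A + B = 0
  · obtain ⟨h1, h2⟩ := add_eq_zero.mp hAB
    rw [h1, h2]
  have hne : (A + B).toFinset.Nonempty := by
    rwa [Multiset.toFinset_nonempty]
  obtain ⟨m, hm, hmax⟩ := (A + B).toFinset.exists_max_image id hne
  rw [Multiset.mem_toFinset, Multiset.mem_add] at hm
  have hmpos : 0 < m := hm.elim (hA m) (hB m)
  have hζ := Complex.isPrimitiveRoot_exp m hmpos.ne'
  set ζ := Complex.exp (2 * Real.pi * Complex.I / m)
  have hζ0 : ζ ≠ 0 := hζ.ne_zero hmpos.ne'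
  have hroot (C : Multiset ℕ) (hC : ∀ c ∈ C, 0 < c) (hCm : ∀ c ∈ C, c ≤ m) (c : ℕ) :
      eval ζ ((X : ℂ[X]) ^ c * (C.map fun k => 1 - X ^ k).prod) = 0 ↔ m ∈ C := by
    rw [eval_mul, eval_pow, eval_X, mul_eq_zero, or_iff_right (pow_ne_zero _ hζ0),
      eval_multiset_prod, Multiset.prod_eq_zero_iff, Multiset.map_map, Multiset.mem_map]
    constructor
    · rintro ⟨k, hk, hk0⟩
      simp only [Function.comp_apply, eval_sub, eval_one, eval_pow, eval_X, sub_eq_zero] at hk0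
      have := Nat.le_of_dvd (hC k hk) ((hζ.pow_eq_one_iff_dvd k).mp hk0.symm)
      rwa [le_antisymm this (hCm k hk)]
    · intro hk
      exact ⟨m, hk, by simp [hζ.pow_eq_one]⟩
  have hAm : ∀ c ∈ A, c ≤ m := fun c hc =>
    hmax c (Multiset.mem_toFinset.mpr (Multiset.mem_add.mpr (Or.inl hc)))
  have hBm : ∀ c ∈ B, c ≤ m := fun c hc =>
    hmax c (Multiset.mem_toFinset.mpr (Multiset.mem_add.mpr (Or.inr hc)))
  have hiff : m ∈ A ↔ m ∈ B := by
    rw [← hroot A hA hAm a, ← hroot B hB hBm b, h]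
  have hmA : m ∈ A := hm.elim id hiff.mpr
  obtain ⟨A', rfl⟩ := Multiset.exists_cons_of_mem hmA
  obtain ⟨B', rfl⟩ := Multiset.exists_cons_of_mem (hiff.mp hmA)
  congr 1
  refine ih _ ?_ A' B' (fun c hc => hA c (Multiset.mem_cons_of_mem hc))
    (fun c hc => hB c (Multiset.mem_cons_of_mem hc)) ?_ rfl
  · simp only [Multiset.card_cons]
    omega
  · simp only [Multiset.map_cons, Multiset.prod_cons] at h
    rw [mul_left_comm, mul_left_comm (X ^ b)] at h
    exact mul_left_cancel₀ (one_sub_X_pow_ne_zero hmpos) h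

theorem pos_of_mem_hookLengths {lam : YoungDiagram} {k : ℕ} (hk : k ∈ hookLengths lam) :
    0 < k := by
  obtain ⟨c, -, rfl⟩ := Multiset.mem_map.mp hk
  exact Nat.succ_pos _

theorem pos_of_mem_shiftedContents {lam : YoungDiagram} {n k : ℕ} (h : lam.colLen 0 ≤ n)
    (hk : k ∈ shiftedContents lam n) : 0 < k := by
  obtain ⟨c, hc, rfl⟩ := Multiset.mem_map.mp hk
  have := row_lt_colLen ⟨c, hc⟩
  simp only at this
  omega

theorem sum_transpose_cells {M : Type*} [AddCommMonoid M] (lam : YoungDiagram)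
    (f : ℕ × ℕ → M) : ∑ c ∈ lam.transpose.cells, f c = ∑ c ∈ lam.cells, f (c.2, c.1) := by
  refine Finset.sum_nbij' Prod.swap Prod.swap ?_ ?_ (by simp) (by simp) (by simp)
  · intro c hc
    simpa using hc
  · intro c hc
    simpa using hc

theorem sum_arm (lam : YoungDiagram) :
    ∑ c ∈ lam.cells, (lam.rowLen c.1 - 1 - c.2) = ∑ c ∈ lam.cells, c.2 := by
  rw [sum_cells lam le_rfl, sum_cells lam le_rfl]
  exact Finset.sum_congr rfl fun i _ => Finset.sum_range_reflect (fun j => j) (lam.rowLen i)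

theorem sum_leg (lam : YoungDiagram) :
    ∑ c ∈ lam.cells, (lam.colLen c.2 - 1 - c.1) = ∑ c ∈ lam.cells, c.1 := by
  have := sum_arm lam.transpose
  rw [sum_transpose_cells, sum_transpose_cells] at this
  simpa using this

theorem sum_hookLengths (lam : YoungDiagram) :
    (hookLengths lam).sum = ∑ c ∈ lam.cells, c.2 + ∑ c ∈ lam.cells, c.1 + lam.card := by
  change ∑ c ∈ lam.cells, hookLength lam c = _
  simp only [hookLength, Finset.sum_add_distrib, sum_arm, sum_leg]
  simp [YoungDiagram.card]

theorem sum_shiftedContents {lam : YoungDiagram} {n : ℕ} (h : lam.colLen 0 ≤ n) :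
    (shiftedContents lam n).sum + ∑ c ∈ lam.cells, c.1 =
      n * lam.card + ∑ c ∈ lam.cells, c.2 := by
  change ∑ c ∈ lam.cells, (n + c.2 - c.1) + _ = _
  rw [← Finset.sum_add_distrib, mul_comm, YoungDiagram.card, ← smul_eq_mul,
    ← Finset.sum_const, ← Finset.sum_add_distrib]
  refine Finset.sum_congr rfl fun c hc => ?_
  have := row_lt_colLen ⟨c, hc⟩
  simp only at this
  omega

/-- The degrees match whenever the multisets of shifted contents and hook lengths do. -/
theorem mul_card_add_eq {lam mu : YoungDiagram} {l m : ℕ} (hl : lam.colLen 0 ≤ l + 1)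
    (hm : mu.colLen 0 ≤ m + 1)
    (h : shiftedContents lam (l + 1) + hookLengths mu =
      shiftedContents mu (m + 1) + hookLengths lam) :
    l * lam.card + 2 * ∑ c ∈ mu.cells, c.1 = m * mu.card + 2 * ∑ c ∈ lam.cells, c.1 := by
  have h1 := congrArg Multiset.sum h
  rw [Multiset.sum_add, Multiset.sum_add, sum_hookLengths, sum_hookLengths] at h1
  have h2 := sum_shiftedContents hl
  have h3 := sum_shiftedContents hm
  rw [add_mul, one_mul] at h2 h3
  omega

theorem nonempty_equiv_iff_shiftedContents {lam mu : YoungDiagram} {l m : ℕ}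
    (hl : lam.colLen 0 ≤ l + 1) (hm : mu.colLen 0 ≤ m + 1) :
    Nonempty ((schurSymRep lam l).Equiv (schurSymRep mu m)) ↔
      shiftedContents lam (l + 1) + hookLengths mu =
        shiftedContents mu (m + 1) + hookLengths lam := by
  let F (A : Multiset ℕ) : ℂ[X] := (A.map fun k => 1 - X ^ (2 * k)).prod
  have hF (A B : Multiset ℕ) : F (A + B) = F A * F B := by
    simp only [F, Multiset.map_add, Multiset.prod_add]
  have hF0 (A : Multiset ℕ) (hA : ∀ a ∈ A, 0 < a) : F A ≠ 0 := by
    refine Multiset.prod_ne_zero fun h0 => ?_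
    obtain ⟨k, hk, hk0⟩ := Multiset.mem_map.mp h0
    exact one_sub_X_pow_ne_zero (Nat.mul_pos two_pos (hA k hk)) hk0
  have hH (nu : YoungDiagram) (n : ℕ) (hn : nu.colLen 0 ≤ n) :
      expand ℂ 2 (schurPoly nu n) * F (hookLengths nu) =
        X ^ (2 * ∑ c ∈ nu.cells, c.1) * F (shiftedContents nu n) := by
    have := congrArg (expand ℂ 2) (schurPoly_mul_prod_hookLength hn)
    simp only [map_mul, map_prod, map_sub, map_one, map_pow, expand_X, ← pow_mul] at this
    simp only [F, hookLengths, shiftedContents, Multiset.map_map]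
    exact this
  rw [nonempty_equiv_iff_schurPoly]
  have hlhs : X ^ (m * mu.card) * expand ℂ 2 (schurPoly lam (l + 1)) *
      (F (hookLengths lam) * F (hookLengths mu)) =
      X ^ (m * mu.card + 2 * ∑ c ∈ lam.cells, c.1) *
        F (shiftedContents lam (l + 1) + hookLengths mu) := by
    rw [pow_add, hF]
    linear_combination X ^ (m * mu.card) * F (hookLengths mu) * hH lam (l + 1) hl
  have hrhs : X ^ (l * lam.card) * expand ℂ 2 (schurPoly mu (m + 1)) *
      (F (hookLengths lam) * F (hookLengths mu)) =
      X ^ (l * lam.card + 2 * ∑ c ∈ mu.cells, c.1) *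
        F (shiftedContents mu (m + 1) + hookLengths lam) := by
    rw [pow_add, hF]
    linear_combination X ^ (l * lam.card) * F (hookLengths lam) * hH mu (m + 1) hm
  have hne := mul_ne_zero (hF0 _ fun _ => pos_of_mem_hookLengths (lam := lam))
    (hF0 _ fun _ => pos_of_mem_hookLengths (lam := mu))
  rw [← mul_left_inj' hne, hlhs, hrhs]
  constructor
  · intro h
    refine Multiset.map_injective (f := fun k => 2 * k) (fun a b hab => by simpa using hab)
      (eq_of_prod_one_sub_X_pow_eq _ _ ?_ ?_ (m * mu.card + 2 * ∑ c ∈ lam.cells, c.1)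
        (l * lam.card + 2 * ∑ c ∈ mu.cells, c.1) ?_)
    pick_goal 3
    · simp only [Multiset.map_map]
      exact h
    all_goals
      intro a ha
      obtain ⟨k, hk, rfl⟩ := Multiset.mem_map.mp ha
      refine Nat.mul_pos two_pos ?_
      rcases Multiset.mem_add.mp hk with hk | hk
      · exact pos_of_mem_shiftedContents (by assumption) hk
      · exact pos_of_mem_hookLengths hk
  · intro h
    rw [mul_card_add_eq hl hm h, h]

end HookContent

end Plethysm

end


noncomputable section

namespace Plethysm

section Contents

variable {lam mu : YoungDiagram}

theorem lt_rowLen_iff_lt_colLen {i j : ℕ} : j < lam.rowLen i ↔ i < lam.colLen j :=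
  YoungDiagram.mem_iff_lt_rowLen.symm.trans YoungDiagram.mem_iff_lt_colLen

/-- The number of boxes of a given content. -/
def contentCount (lam : YoungDiagram) (x : ℤ) : ℕ :=
  (lam.cells.filter fun c => (c.2 : ℤ) - c.1 = x).card

theorem mem_iff_content_mem_Ioo {i j t : ℕ} (ht : t = min i j) :
    (i, j) ∈ lam ↔ (t : ℤ) - lam.colLen t < j - i ∧ (j : ℤ) - i < lam.rowLen t - t := by
  have hd : t < lam.rowLen t ↔ t < lam.colLen t := lt_rowLen_iff_lt_colLen
  rcases le_total i j with h | h
  · obtain rfl : t = i := by omega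
    rw [YoungDiagram.mem_iff_lt_rowLen]
    omega
  · obtain rfl : t = j := by omega
    rw [YoungDiagram.mem_iff_lt_colLen]
    omega

theorem lt_contentCount_iff {t : ℕ} {x : ℤ} :
    t < contentCount lam x ↔ (t : ℤ) - lam.colLen t < x ∧ x < lam.rowLen t - t := by
  let P (t : ℕ) : Prop := (t : ℤ) - lam.colLen t < x ∧ x < lam.rowLen t - t
  have hanti (s t : ℕ) (hst : s ≤ t) (ht : P t) : P s := by
    have h1 := lam.colLen_anti s t hst
    have h2 := lam.rowLen_anti s t hst
    simp only [P] at ht ⊢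
    omega
  have hcard : contentCount lam x =
      ((Finset.range (lam.rowLen 0)).filter P).card := by
    refine Finset.card_nbij (fun c => min c.1 c.2) ?_ ?_ ?_
    · intro c hc
      simp only [Finset.coe_filter, Set.mem_ofPred_eq, YoungDiagram.mem_cells] at hc
      rw [Finset.coe_filter, Set.mem_ofPred_eq, Finset.mem_range]
      have h1 := (mem_iff_content_mem_Ioo (lam := lam) (i := c.1) (j := c.2) rfl).mp hc.1
      rw [hc.2] at h1
      have h2 : min c.1 c.2 < lam.rowLen _ ↔ min c.1 c.2 < lam.colLen _ :=
        lt_rowLen_iff_lt_colLen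
      have h3 := lam.rowLen_anti 0 (min c.1 c.2) (Nat.zero_le _)
      refine ⟨?_, h1⟩
      change min c.1 c.2 < _
      omega
    · rintro ⟨i, j⟩ hc ⟨i', j'⟩ hc' h
      simp only [Finset.coe_filter, Set.mem_ofPred_eq] at hc hc' h
      ext <;> simp only <;> omega
    · intro t ht
      rw [Finset.coe_filter, Set.mem_ofPred_eq] at ht
      refine ⟨(t + (-x).toNat, t + x.toNat), ?_, by simp only; omega⟩
      simp only [Finset.coe_filter, Set.mem_ofPred_eq, YoungDiagram.mem_cells]
      have hx : ((t + x.toNat : ℕ) : ℤ) - (t + (-x).toNat : ℕ) = x := by omega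
      refine ⟨(mem_iff_content_mem_Ioo (t := t) (by omega)).mpr ?_, hx⟩
      rw [hx]
      exact ht.2
  have hd : t < lam.rowLen t ↔ t < lam.colLen t := lt_rowLen_iff_lt_colLen
  have h0 := lam.rowLen_anti 0 t (Nat.zero_le _)
  rw [hcard]
  constructor
  · intro h
    by_contra hP
    refine h.not_ge ?_
    rw [← Finset.card_range t]
    refine Finset.card_le_card fun s hs => ?_
    rw [Finset.mem_filter] at hs
    rw [Finset.mem_range]
    by_contra hts
    exact hP (hanti t s (not_lt.mp hts) hs.2)
  · intro h
    rw [← Nat.succ_le_iff, ← Finset.card_range t.succ]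
    refine Finset.card_le_card fun s hs => ?_
    rw [Finset.mem_range] at hs
    rw [Finset.mem_filter, Finset.mem_range]
    exact ⟨by omega, hanti s t (by omega) h⟩

theorem eq_of_contentCount_eq (h : ∀ x, contentCount lam x = contentCount mu x) :
    lam = mu := by
  ext ⟨i, j⟩
  rw [YoungDiagram.mem_cells, YoungDiagram.mem_cells, mem_iff_content_mem_Ioo rfl,
    mem_iff_content_mem_Ioo rfl, ← lt_contentCount_iff, ← lt_contentCount_iff, h]

theorem contentCount_transpose (x : ℤ) :
    contentCount lam.transpose x = contentCount lam (-x) := by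
  refine eq_of_forall_lt_iff fun t => ?_
  rw [lt_contentCount_iff, lt_contentCount_iff, YoungDiagram.colLen_transpose,
    YoungDiagram.rowLen_transpose]
  omega

theorem contentCount_eq_zero {x : ℤ} (hx : (lam.colLen 0 : ℤ) ≤ -x ∨ (lam.rowLen 0 : ℤ) ≤ x) :
    contentCount lam x = 0 := by
  by_contra h
  have := lt_contentCount_iff.mp (Nat.pos_of_ne_zero h)
  omega

theorem count_shiftedContents {n k : ℕ} (h : lam.colLen 0 ≤ n) :
    (shiftedContents lam n).count k = contentCount lam (k - n) := by
  rw [shiftedContents, Multiset.count_map, contentCount, Finset.card_def, Finset.filter_val]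
  congr 1
  refine Multiset.filter_congr fun c hc => ?_
  have := row_lt_colLen ⟨c, hc⟩
  simp only at this
  omega

theorem nonempty_equiv_iff_contentCount {l m : ℕ} (hl : lam.colLen 0 ≤ l + 1)
    (hm : mu.colLen 0 ≤ m + 1) :
    Nonempty ((schurSymRep lam l).Equiv (schurSymRep mu m)) ↔
      ∀ x : ℤ, contentCount lam (x - (l + 1)) + (hookLengths mu).count x.toNat =
        contentCount mu (x - (m + 1)) + (hookLengths lam).count x.toNat := by
  have h0 (nu : YoungDiagram) : (hookLengths nu).count 0 = 0 :=
    Multiset.count_eq_zero.mpr fun h => lt_irrefl _ (pos_of_mem_hookLengths h)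
  have key (k : ℕ) : (shiftedContents lam (l + 1) + hookLengths mu).count k =
      (shiftedContents mu (m + 1) + hookLengths lam).count k ↔
      contentCount lam ((k : ℤ) - (l + 1)) + (hookLengths mu).count k =
        contentCount mu ((k : ℤ) - (m + 1)) + (hookLengths lam).count k := by
    rw [Multiset.count_add, Multiset.count_add, count_shiftedContents hl,
      count_shiftedContents hm]
    push_cast
    rfl
  rw [nonempty_equiv_iff_shiftedContents hl hm, Multiset.ext]
  simp only [key]
  constructor
  · intro h x
    rcases le_total 0 x with hx | hx
    · obtain ⟨k, rfl⟩ := Int.eq_ofNat_of_zero_le hx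
      exact h k
    · rw [Int.toNat_of_nonpos hx, h0, h0, contentCount_eq_zero (Or.inl (by omega)),
        contentCount_eq_zero (Or.inl (by omega))]
  · intro h k
    exact h k

theorem eq_zero_of_periodic {D : ℤ → ℤ} {k B : ℤ} (hk : k ≠ 0) (hD : ∀ x, D (x + k) = D x)
    (hB : ∀ x, B ≤ |x| → D x = 0) (x : ℤ) : D x = 0 := by
  have h (N : ℕ) : D (x + N * k) = D x := by
    induction N with
    | zero => simp
    | succ N ih => rw [← ih, ← hD (x + N * k)]; push_cast; ring_nf
  rw [← h (B.natAbs + x.natAbs)]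
  refine hB _ ?_
  have h1 : |((B.natAbs + x.natAbs : ℕ) : ℤ) * k| ≥ |B| + |x| := by
    rw [abs_mul, Nat.abs_cast]
    push_cast
    exact le_mul_of_one_le_right (by positivity) (Int.one_le_abs hk)
  have h2 := abs_sub_abs_le_abs_sub (((B.natAbs + x.natAbs : ℕ) : ℤ) * k) (-x)
  rw [abs_neg, sub_neg_eq_add, add_comm _ x] at h2
  have := le_abs_self B
  linarith

theorem contentCount_eq_of_two_equivs {l m l' m' : ℕ} (h : PlethysticEquiv lam mu l m)
    (h' : PlethysticEquiv lam mu l' m') (hne : l ≠ l') (hk : (l' : ℤ) - l = m' - m) :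
    (∀ x, contentCount mu (x + (l - m)) = contentCount lam x) ∧
      hookLengths lam = hookLengths mu := by
  obtain ⟨-, -, hl, hm, h⟩ := h
  obtain ⟨-, -, hl', hm', h'⟩ := h'
  rw [nonempty_equiv_iff_contentCount hl hm] at h
  rw [nonempty_equiv_iff_contentCount hl' hm'] at h'
  let D (x : ℤ) : ℤ := contentCount lam (x - (l + 1)) - contentCount mu (x - (m + 1))
  have hD (x : ℤ) : D x = (hookLengths lam).count x.toNat - (hookLengths mu).count x.toNat := by
    have := h x
    simp only [D]
    omega
  have hper (x : ℤ) : D (x + (l - l')) = D x := by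
    rw [hD x]
    have := h' x
    simp only [D]
    rw [show x + (l - l') - ((l : ℤ) + 1) = x - (l' + 1) by ring,
      show x + (l - l') - ((m : ℤ) + 1) = x - (m' + 1) by linarith]
    omega
  have hzero := eq_zero_of_periodic (B := l + 1 + m + 1 + lam.colLen 0 + lam.rowLen 0 +
      mu.colLen 0 + mu.rowLen 0) (sub_ne_zero.mpr (by exact_mod_cast hne)) hper
    fun x hx => by
      simp only [D]
      rw [contentCount_eq_zero, contentCount_eq_zero]
      · rfl
      all_goals
        rcases abs_cases x with hx' | hx'
        · right; omega
        · left; omega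
  constructor
  · intro x
    have := hzero (x + (l + 1))
    simp only [D] at this
    rw [show x + (l + 1) - ((l : ℤ) + 1) = x by ring,
      show x + (l + 1) - ((m : ℤ) + 1) = x + (l - m) by ring] at this
    omega
  · ext k
    have h1 := hzero k
    rw [hD, Int.toNat_natCast] at h1
    omega

theorem card_mul_sub_eq {l m l' m' : ℕ} (h : PlethysticEquiv lam mu l m)
    (h' : PlethysticEquiv lam mu l' m') :
    l * lam.card + m' * mu.card = l' * lam.card + m * mu.card := by
  have h1 := mul_card_add_eq h.2.2.1 h.2.2.2.1
    ((nonempty_equiv_iff_shiftedContents h.2.2.1 h.2.2.2.1).mp h.2.2.2.2)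
  have h2 := mul_card_add_eq h'.2.2.1 h'.2.2.2.1
    ((nonempty_equiv_iff_shiftedContents h'.2.2.1 h'.2.2.2.1).mp h'.2.2.2.2)
  omega

theorem colLen_zero_pos (h : lam ≠ ⊥) : 0 < lam.colLen 0 := by
  by_contra h0
  exact h (eq_bot_of_colLen_eq_zero (by omega))

theorem card_pos_of_ne_bot (h : lam ≠ ⊥) : 0 < lam.card :=
  Finset.card_pos.mpr ⟨(0, 0), YoungDiagram.mem_iff_lt_colLen.mpr (colLen_zero_pos h)⟩

theorem lt_iff_lt_of_plethysticEquiv (hlam : lam ≠ ⊥) (hmu : mu ≠ ⊥) {l m l' m' : ℕ}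
    (h : PlethysticEquiv lam mu l m) (h' : PlethysticEquiv lam mu l' m') : l < l' ↔ m < m' := by
  have h1 := card_mul_sub_eq h h'
  have h2 := card_pos_of_ne_bot hlam
  have h3 := card_pos_of_ne_bot hmu
  constructor
  · intro hlt
    have := Nat.mul_lt_mul_of_pos_right hlt h2
    exact Nat.lt_of_mul_lt_mul_right (a := mu.card) (by omega)
  · intro hlt
    have := Nat.mul_lt_mul_of_pos_right hlt h3
    exact Nat.lt_of_mul_lt_mul_right (a := lam.card) (by omega)

theorem rowLen_add_le_of_prime (hlam : lam ≠ ⊥) {l m : ℕ} (hl : lam.colLen 0 ≤ l)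
    (h : shiftedContents lam (l + 1) + hookLengths mu =
      shiftedContents mu (m + 1) + hookLengths lam) :
    lam.rowLen 0 + l ≤ mu.rowLen 0 + m := by
  have hpos : 0 < lam.rowLen 0 := lt_rowLen_iff_lt_colLen.mpr (colLen_zero_pos hlam)
  have hmem : lam.rowLen 0 + l ∈ shiftedContents lam (l + 1) :=
    Multiset.mem_map.mpr ⟨(0, lam.rowLen 0 - 1),
      YoungDiagram.mem_iff_lt_rowLen.mpr (by omega), by simp only; omega⟩
  have hmem' : lam.rowLen 0 + l ∈ shiftedContents mu (m + 1) + hookLengths lam := by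
    rw [← h]
    exact Multiset.mem_add.mpr (Or.inl hmem)
  rcases Multiset.mem_add.mp hmem' with hc | hc
  · obtain ⟨c, hc, hcx⟩ := Multiset.mem_map.mp hc
    have h1 := YoungDiagram.mem_iff_lt_rowLen.mp hc
    have h2 := mu.rowLen_anti 0 c.1 (Nat.zero_le _)
    omega
  · obtain ⟨c, hc, hcx⟩ := Multiset.mem_map.mp hc
    have h1 := YoungDiagram.mem_iff_lt_rowLen.mp hc
    have h1' := lt_rowLen_iff_lt_colLen.mp h1
    have h2 := lam.rowLen_anti 0 c.1 (Nat.zero_le _)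
    have h3 := lam.colLen_anti 0 c.2 (Nat.zero_le _)
    simp only [hookLength] at hcx
    omega

theorem rowLen_add_eq_of_prime (hlam : lam ≠ ⊥) (hmu : mu ≠ ⊥) {l m : ℕ}
    (h : PrimePlethysticEquiv lam mu l m) : lam.rowLen 0 + l = mu.rowLen 0 + m := by
  obtain ⟨⟨-, -, hl, hm, h⟩, hl', hm'⟩ := h
  rw [nonempty_equiv_iff_shiftedContents hl hm] at h
  exact le_antisymm (rowLen_add_le_of_prime hlam hl' h)
    (rowLen_add_le_of_prime hmu hm' h.symm)

end Contents

end Plethysm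

end


noncomputable section

namespace Plethysm

section Durfee

variable {lam mu : YoungDiagram}

theorem lt_rank_iff {t : ℕ} : t < rank lam ↔ t < lam.rowLen t := by
  constructor
  · intro h
    have h1 : rank lam ≤ lam.rowLen (rank lam - 1) :=
      Nat.findGreatest_of_ne_zero (P := fun r => r ≤ lam.rowLen (r - 1)) rfl (by omega)
    have h2 := lam.rowLen_anti t (rank lam - 1) (by omega)
    omega
  · intro h
    refine Nat.succ_le_iff.mp (Nat.le_findGreatest ?_ ?_)
    · have h1 := lt_rowLen_iff_lt_colLen.mp h
      have h2 := lam.colLen_anti 0 t (Nat.zero_le _)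
      omega
    · simpa using h

theorem lt_rank_iff_lt_colLen {t : ℕ} : t < rank lam ↔ t < lam.colLen t :=
  lt_rank_iff.trans lt_rowLen_iff_lt_colLen

theorem rank_transpose (lam : YoungDiagram) : rank lam.transpose = rank lam := by
  refine eq_of_forall_lt_iff fun t => ?_
  rw [lt_rank_iff, lt_rank_iff_lt_colLen, YoungDiagram.rowLen_transpose]

theorem rank_le_rowLen {i : ℕ} (h : i < rank lam) : rank lam ≤ lam.rowLen i := by
  have h1 := lt_rank_iff.mp (show rank lam - 1 < rank lam by omega)
  have h2 := lam.rowLen_anti i (rank lam - 1) (by omega)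
  omega

theorem rank_le_colLen {j : ℕ} (h : j < rank lam) : rank lam ≤ lam.colLen j := by
  rw [← rank_transpose] at h ⊢
  rw [← YoungDiagram.rowLen_transpose]
  exact rank_le_rowLen h

theorem rowLen_le_rank {i : ℕ} (h : rank lam ≤ i) : lam.rowLen i ≤ rank lam := by
  have h1 := mt lt_rank_iff.mpr (lt_irrefl (rank lam))
  have h2 := lam.rowLen_anti (rank lam) i h
  omega

theorem colLen_le_rank {j : ℕ} (h : rank lam ≤ j) : lam.colLen j ≤ rank lam := by
  rw [← rank_transpose] at h ⊢
  rw [← YoungDiagram.rowLen_transpose]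
  exact rowLen_le_rank h

theorem rank_pos (h : lam ≠ ⊥) : 0 < rank lam :=
  lt_rank_iff_lt_colLen.mpr (colLen_zero_pos h)

theorem rank_add_southRank (h : lam ≠ ⊥) :
    rank lam + southRank lam = lam.colLen (rank lam - 1) := by
  have hd := rank_pos h
  have h1 := rank_le_colLen (show rank lam - 1 < rank lam by omega)
  apply le_antisymm
  · rcases Nat.eq_zero_or_pos (southRank lam) with h0 | h0
    · omega
    · have h2 : lam.rowLen (rank lam + southRank lam - 1) = rank lam :=
        Nat.findGreatest_of_ne_zero
          (P := fun j => lam.rowLen (rank lam + j - 1) = rank lam) rfl h0.ne'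
      have h3 : rank lam + southRank lam - 1 < lam.colLen (rank lam - 1) :=
        lt_rowLen_iff_lt_colLen.mp (by omega)
      omega
  · suffices lam.colLen (rank lam - 1) - rank lam ≤ southRank lam by omega
    rcases Nat.eq_zero_or_pos (lam.colLen (rank lam - 1) - rank lam) with h0 | h0
    · omega
    · refine Nat.le_findGreatest ?_ ?_
      · have := lam.colLen_anti 0 (rank lam - 1) (Nat.zero_le _)
        omega
      · have h2 : rank lam - 1 < lam.rowLen (lam.colLen (rank lam - 1) - 1) :=
          lt_rowLen_iff_lt_colLen.mpr (by omega)
        have h3 := rowLen_le_rank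
          (show rank lam ≤ lam.colLen (rank lam - 1) - 1 by omega)
        rw [Nat.add_sub_cancel' h1]
        omega

theorem mem_dropRows {k i j : ℕ} : (i, j) ∈ dropRows lam k ↔ (i + k, j) ∈ lam := by
  rw [dropRows, YoungDiagram.mem_ofRowLens]
  simp only [List.length_drop, YoungDiagram.length_rowLens, List.getElem_drop,
    YoungDiagram.get_rowLens]
  rw [YoungDiagram.mem_iff_lt_rowLen, add_comm i k]
  constructor
  · rintro ⟨-, h⟩
    exact h
  · intro h
    have h1 := lt_rowLen_iff_lt_colLen.mp h
    have h2 := lam.colLen_anti 0 j (Nat.zero_le _)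
    exact ⟨by omega, h⟩

theorem mem_southPartition (h : lam ≠ ⊥) {i j : ℕ} :
    (i, j) ∈ southPartition lam ↔ i + lam.colLen (rank lam - 1) < lam.colLen j := by
  rw [southPartition, mem_dropRows, rank_add_southRank h, YoungDiagram.mem_iff_lt_colLen]

theorem transpose_ne_bot (h : lam ≠ ⊥) : lam.transpose ≠ ⊥ := by
  rintro h0
  have h1 := colLen_zero_pos h
  rw [← YoungDiagram.rowLen_transpose, h0, rowLen_bot] at h1
  exact lt_irrefl _ h1

theorem eastPartition_eq_iff (lam : YoungDiagram) :
    eastPartition lam = (southPartition lam).transpose ↔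
      southPartition lam.transpose = southPartition lam := by
  rw [eastPartition]
  constructor
  · intro h
    simpa using congrArg YoungDiagram.transpose h
  · intro h
    rw [h]

/-- The east- and south-partitions are conjugate to each other exactly when the first column
lengths are obtained from the row lengths by a common shift. -/
theorem southPartition_transpose_eq_iff (h : lam ≠ ⊥) :
    southPartition lam.transpose = southPartition lam ↔
      ∃ k : ℤ, ∀ t < rank lam, (lam.colLen t : ℤ) = lam.rowLen t + k := by
  have hpos := rank_pos h
  have hrow (t : ℕ) (ht : t < rank lam) : lam.rowLen (rank lam - 1) ≤ lam.rowLen t :=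
    lam.rowLen_anti _ _ (by omega)
  have hcol (t : ℕ) (ht : t < rank lam) : lam.colLen (rank lam - 1) ≤ lam.colLen t :=
    lam.colLen_anti _ _ (by omega)
  have hiff : southPartition lam.transpose = southPartition lam ↔
      ∀ i j : ℕ, i + lam.rowLen (rank lam - 1) < lam.rowLen j ↔
        i + lam.colLen (rank lam - 1) < lam.colLen j := by
    constructor
    · intro h0 i j
      have h1 : (i, j) ∈ southPartition lam.transpose ↔ (i, j) ∈ southPartition lam := by
        rw [h0]
      rwa [mem_southPartition (transpose_ne_bot h), mem_southPartition h, rank_transpose,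
        YoungDiagram.colLen_transpose, YoungDiagram.colLen_transpose] at h1
    · intro h0
      ext ⟨i, j⟩
      rw [YoungDiagram.mem_cells, YoungDiagram.mem_cells,
        mem_southPartition (transpose_ne_bot h), mem_southPartition h, rank_transpose,
        YoungDiagram.colLen_transpose, YoungDiagram.colLen_transpose, h0]
  rw [hiff]
  constructor
  · intro h0
    refine ⟨lam.colLen (rank lam - 1) - lam.rowLen (rank lam - 1), fun t ht => ?_⟩
    have h1 := hrow t ht
    have h2 := hcol t ht
    have h3 : lam.rowLen t - lam.rowLen (rank lam - 1) =
        lam.colLen t - lam.colLen (rank lam - 1) := by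
      refine eq_of_forall_lt_iff fun i => ?_
      have := h0 i t
      omega
    omega
  · rintro ⟨k, hk⟩ i j
    have h0 := hk (rank lam - 1) (by omega)
    rcases lt_or_ge j (rank lam) with hj | hj
    · have := hk j hj
      omega
    · have h1 := rowLen_le_rank hj
      have h2 := colLen_le_rank hj
      have h3 := rank_le_rowLen (show rank lam - 1 < rank lam by omega)
      have h4 := rank_le_colLen (show rank lam - 1 < rank lam by omega)
      omega

theorem contentCount_transpose_eq {k : ℤ}
    (hk : ∀ t < rank lam, (lam.colLen t : ℤ) = lam.rowLen t + k) (x : ℤ) :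
    contentCount lam.transpose (x + k) = contentCount lam x := by
  rw [contentCount_transpose]
  refine eq_of_forall_lt_iff fun t => ?_
  rw [lt_contentCount_iff, lt_contentCount_iff]
  rcases lt_or_ge t (rank lam) with ht | ht
  · have := hk t ht
    omega
  · have h1 := rowLen_le_rank ht
    have h2 := colLen_le_rank ht
    omega

theorem hookLength_transpose (i j : ℕ) :
    hookLength lam.transpose (j, i) = hookLength lam (i, j) := by
  simp only [hookLength, YoungDiagram.rowLen_transpose, YoungDiagram.colLen_transpose]
  omega

theorem hookLengths_transpose (lam : YoungDiagram) :
    hookLengths lam.transpose = hookLengths lam := by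
  ext x
  rw [hookLengths, hookLengths, Multiset.count_map, Multiset.count_map, ← Finset.filter_val,
    ← Finset.filter_val, ← Finset.card_def, ← Finset.card_def, Finset.card_filter,
    Finset.card_filter, sum_transpose_cells]
  exact Finset.sum_congr rfl fun c _ => by rw [hookLength_transpose]

/-- The Frobenius coordinates of a partition along its rows. -/
def frobeniusArm (lam : YoungDiagram) (i : ℕ) : ℕ := lam.rowLen i - 1 - i

theorem frobeniusArm_strictAnti {i j : ℕ} (hij : i < j) (hj : j < rank lam) :
    frobeniusArm lam j < frobeniusArm lam i := by
  have h1 := lt_rank_iff.mp hj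
  have h2 := lam.rowLen_anti i j hij.le
  unfold frobeniusArm
  omega

theorem sum_hookLength_arm (lam : YoungDiagram) (f : ℕ → ℤ) :
    ∑ i ∈ Finset.range (rank lam), ∑ j ∈ Finset.Ico (rank lam) (lam.rowLen i),
      f (hookLength lam (i, j)) +
    ∑ i ∈ Finset.range (rank lam), ∑ j ∈ Finset.Ioo i (rank lam),
      f (frobeniusArm lam i - frobeniusArm lam j) =
    ∑ i ∈ Finset.range (rank lam), ∑ k ∈ Finset.range (frobeniusArm lam i), f (k + 1) := by
  rw [← Finset.sum_add_distrib]
  refine Finset.sum_congr rfl fun i hi => ?_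
  rw [Finset.mem_range] at hi
  have hs (j : ℕ) (hj : j < rank lam) :
      shiftedPart lam (rank lam) j = frobeniusArm lam j + rank lam := by
    have := lt_rank_iff.mp hj
    unfold shiftedPart frobeniusArm
    omega
  have key := sum_Ico_hookLength_add_sum (colLen_le_rank le_rfl)
    (fun j hj => rank_le_rowLen hj) hi f
  rw [hs i hi, Nat.add_sub_cancel] at key
  rw [← key]
  congr 1
  refine Finset.sum_congr rfl fun j hj => ?_
  rw [hs j (Finset.mem_Ioo.mp hj).2, Nat.add_sub_add_right]

theorem sum_cells_durfee (lam : YoungDiagram) (f : ℕ × ℕ → ℤ) :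
    ∑ c ∈ lam.cells, f c =
      ∑ i ∈ Finset.range (rank lam), ∑ j ∈ Finset.range (rank lam), f (i, j) +
      ∑ i ∈ Finset.range (rank lam), ∑ j ∈ Finset.Ico (rank lam) (lam.rowLen i), f (i, j) +
      ∑ j ∈ Finset.range (rank lam), ∑ i ∈ Finset.Ico (rank lam) (lam.colLen j), f (i, j) := by
  rw [← Finset.sum_filter_add_sum_filter_not lam.cells fun c => c.1 < rank lam]
  congr 1
  · rw [← Finset.sum_add_distrib]
    have h (i : ℕ) (hi : i ∈ Finset.range (rank lam)) :
        ∑ j ∈ Finset.range (rank lam), f (i, j) +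
          ∑ j ∈ Finset.Ico (rank lam) (lam.rowLen i), f (i, j) =
        ∑ j ∈ Finset.range (lam.rowLen i), f (i, j) :=
      Finset.sum_range_add_sum_Ico _ (rank_le_rowLen (Finset.mem_range.mp hi))
    rw [Finset.sum_congr rfl h, Finset.sum_sigma']
    refine Finset.sum_nbij' (fun c => ⟨c.1, c.2⟩) (fun p => (p.1, p.2)) ?_ ?_ (by simp)
      (by simp) (by simp)
    · intro c hc
      rw [Finset.mem_filter] at hc
      have h1 := YoungDiagram.mem_iff_lt_rowLen.mp hc.1
      simp only [Finset.mem_sigma, Finset.mem_range]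
      exact ⟨hc.2, h1⟩
    · rintro ⟨i, j⟩ hp
      simp only [Finset.mem_sigma, Finset.mem_range] at hp
      rw [Finset.mem_filter]
      exact ⟨YoungDiagram.mem_iff_lt_rowLen.mpr hp.2, hp.1⟩
  · rw [Finset.sum_sigma']
    refine Finset.sum_nbij' (fun c => ⟨c.2, c.1⟩) (fun p => (p.2, p.1)) ?_ ?_ (by simp)
      (by simp) (by simp)
    · intro c hc
      rw [Finset.mem_filter] at hc
      have h1 := YoungDiagram.mem_iff_lt_rowLen.mp hc.1
      have h2 := lt_rowLen_iff_lt_colLen.mp h1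
      have h3 := rowLen_le_rank (not_lt.mp hc.2)
      simp only [Finset.mem_sigma, Finset.mem_range, Finset.mem_Ico]
      omega
    · rintro ⟨j, i⟩ hp
      simp only [Finset.mem_sigma, Finset.mem_range, Finset.mem_Ico] at hp
      rw [Finset.mem_filter]
      exact ⟨YoungDiagram.mem_iff_lt_colLen.mpr hp.2.2, by simp only; omega⟩

theorem sum_hookLength_frobenius (lam : YoungDiagram) (f : ℕ → ℤ) :
    ∑ c ∈ lam.cells, f (hookLength lam c) +
      (∑ i ∈ Finset.range (rank lam), ∑ j ∈ Finset.Ioo i (rank lam),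
          f (frobeniusArm lam i - frobeniusArm lam j) +
        ∑ i ∈ Finset.range (rank lam), ∑ j ∈ Finset.Ioo i (rank lam),
          f (frobeniusArm lam.transpose i - frobeniusArm lam.transpose j)) =
    ∑ i ∈ Finset.range (rank lam), ∑ j ∈ Finset.range (rank lam),
        f (frobeniusArm lam i + frobeniusArm lam.transpose j + 1) +
      (∑ i ∈ Finset.range (rank lam), ∑ k ∈ Finset.range (frobeniusArm lam i), f (k + 1) +
        ∑ i ∈ Finset.range (rank lam), ∑ k ∈ Finset.range (frobeniusArm lam.transpose i),
          f (k + 1)) := by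
  have h1 := sum_hookLength_arm lam f
  have h2 := sum_hookLength_arm lam.transpose f
  rw [rank_transpose] at h2
  simp only [hookLength_transpose, YoungDiagram.rowLen_transpose] at h2
  rw [sum_cells_durfee, ← h1, ← h2]
  have h3 : ∑ i ∈ Finset.range (rank lam), ∑ j ∈ Finset.range (rank lam),
      f (hookLength lam (i, j)) =
      ∑ i ∈ Finset.range (rank lam), ∑ j ∈ Finset.range (rank lam),
        f (frobeniusArm lam i + frobeniusArm lam.transpose j + 1) := by
    refine Finset.sum_congr rfl fun i hi => Finset.sum_congr rfl fun j hj => congrArg f ?_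
    rw [Finset.mem_range] at hi hj
    have h4 := rank_le_rowLen hi
    have h5 := rank_le_colLen hj
    simp only [hookLength, frobeniusArm, YoungDiagram.rowLen_transpose]
    omega
  rw [h3]
  ring

theorem eq_of_sum_range_eq {d k : ℕ} (hk : 0 < k) {u w : ℕ → ℕ}
    (hu : ∀ i j, i < j → j < d → u j < u i) (hw : ∀ i j, i < j → j < d → w j < w i)
    (h : ∀ f : ℕ → ℤ,
      ∑ i ∈ Finset.range d, ∑ a ∈ Finset.range (u i), f (a + 1) +
        ∑ i ∈ Finset.range d, ∑ a ∈ Finset.range (w i + k), f (a + 1) =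
      ∑ i ∈ Finset.range d, ∑ a ∈ Finset.range (u i + k), f (a + 1) +
        ∑ i ∈ Finset.range d, ∑ a ∈ Finset.range (w i), f (a + 1))
    {t : ℕ} (ht : t < d) : u t = w t := by
  have hS (S : ℕ → ℤ) : ∑ i ∈ Finset.range d, (S (u i + k) - S (u i)) =
      ∑ i ∈ Finset.range d, (S (w i + k) - S (w i)) := by
    have h1 := h fun a => S a - S (a - 1)
    have h2 (n : ℕ) : ∑ a ∈ Finset.range n, (S (a + 1) - S (a + 1 - 1)) = S n - S 0 :=
      Finset.sum_range_sub S n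
    simp only [h2, Finset.sum_sub_distrib] at h1
    simp only [Finset.sum_sub_distrib]
    linarith
  have hprim (g : ℕ → ℤ) : ∃ S : ℕ → ℤ, ∀ a, S (a + k) - S a = g a := by
    refine ⟨fun a => ∑ q ∈ Finset.range (a / k), g (a % k + q * k), fun a => ?_⟩
    simp only [Nat.add_div_right _ hk, Nat.add_mod_right, Finset.sum_range_succ]
    rw [add_sub_cancel_left, mul_comm, Nat.mod_add_div]
  have hg (g : ℕ → ℤ) : ∑ i ∈ Finset.range d, g (u i) = ∑ i ∈ Finset.range d, g (w i) := by
    obtain ⟨S, h1⟩ := hprim g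
    simpa only [h1] using hS S
  have hmem (u w : ℕ → ℕ)
      (hg : ∀ g : ℕ → ℤ, ∑ i ∈ Finset.range d, g (u i) = ∑ i ∈ Finset.range d, g (w i))
      (i : Fin d) : ∃ j : Fin d, w j = u i := by
    by_contra! hne
    have h1 := hg fun a => if a = u i then 1 else 0
    rw [Finset.sum_eq_zero (s := Finset.range d) (f := fun j => if w j = u i then (1 : ℤ) else 0)
      fun j hj => if_neg (hne ⟨j, Finset.mem_range.mp hj⟩),
      Finset.sum_eq_zero_iff_of_nonneg fun j _ => by split_ifs <;> simp] at h1
    simpa using h1 i (Finset.mem_range.mpr i.2)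
  have hmono (u : ℕ → ℕ) (hu : ∀ i j, i < j → j < d → u j < u i) :
      StrictMono fun i : Fin d => OrderDual.toDual (u i) :=
    fun i j hij => hu i j hij j.2
  have hfun := ((hmono u hu).range_inj (hmono w hw)).mp (by
    ext a
    constructor
    · rintro ⟨i, rfl⟩
      exact hmem u w hg i
    · rintro ⟨i, rfl⟩
      exact hmem w u (fun g => (hg g).symm) i)
  exact congrFun hfun ⟨t, ht⟩

theorem colLen_eq_add_of_shift {k : ℕ} (hk : 0 < k)
    (hC : ∀ x, contentCount mu (x + k) = contentCount lam x)
    (hH : hookLengths lam = hookLengths mu) {t : ℕ} (ht : t < rank lam) :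
    (lam.colLen t : ℤ) = lam.rowLen t + k := by
  have hiff (t : ℕ) (x : ℤ) : ((t : ℤ) - mu.colLen t < x + k ∧ x + k < mu.rowLen t - t) ↔
      ((t : ℤ) - lam.colLen t < x ∧ x < lam.rowLen t - t) := by
    rw [← lt_contentCount_iff, ← lt_contentCount_iff, hC]
  have hcoord (t : ℕ) (ht : t < rank lam) :
      mu.rowLen t = lam.rowLen t + k ∧ lam.colLen t = mu.colLen t + k := by
    have h1 := lt_rank_iff.mp ht
    have h2 := lt_rank_iff_lt_colLen.mp ht
    have h3 := hiff t (lam.rowLen t - t - 1)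
    have h4 := hiff t (lam.rowLen t - t)
    have h5 := hiff t (t - lam.colLen t + 1)
    have h6 := hiff t (t - lam.colLen t)
    omega
  have hrank : rank mu = rank lam := by
    refine eq_of_forall_lt_iff fun t => ⟨fun h => ?_, fun h => ?_⟩
    · have h1 := lt_rank_iff.mp h
      have h2 := lt_rank_iff_lt_colLen.mp h
      have h3 := hiff t (-k)
      have h4 : t < lam.rowLen t ↔ t < lam.colLen t := lt_rowLen_iff_lt_colLen
      rw [lt_rank_iff]
      omega
    · have h1 := lt_rank_iff.mp h
      have h2 := hcoord t h
      rw [lt_rank_iff]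
      omega
  have harm (t : ℕ) (ht : t < rank lam) :
      frobeniusArm mu t = frobeniusArm lam t + k ∧
        frobeniusArm lam.transpose t = frobeniusArm mu.transpose t + k := by
    have h1 := hcoord t ht
    have h2 := lt_rank_iff.mp ht
    have h3 := lt_rank_iff_lt_colLen.mp (hrank.symm ▸ ht)
    simp only [frobeniusArm, YoungDiagram.rowLen_transpose]
    omega
  have hrange {M : Type} [AddCommMonoid M] {F G : ℕ → M} (h : ∀ i < rank lam, F i = G i) :
      ∑ i ∈ Finset.range (rank lam), F i = ∑ i ∈ Finset.range (rank lam), G i :=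
    Finset.sum_congr rfl fun i hi => h i (Finset.mem_range.mp hi)
  have key : frobeniusArm lam t = frobeniusArm mu.transpose t := by
    refine eq_of_sum_range_eq hk (fun i j => frobeniusArm_strictAnti)
      (fun i j hij hj => frobeniusArm_strictAnti hij (by rwa [rank_transpose, hrank]))
      (fun f => ?_) ht
    have h1 := sum_hookLength_frobenius lam f
    have h2 := sum_hookLength_frobenius mu f
    have h3 : ∑ c ∈ lam.cells, f (hookLength lam c) = ∑ c ∈ mu.cells, f (hookLength mu c) := by
      have := congrArg (fun A => (A.map f).sum) hH
      simp only [hookLengths, Multiset.map_map] at this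
      exact this
    rw [hrank] at h2
    have h4 : ∑ i ∈ Finset.range (rank lam), ∑ j ∈ Finset.Ioo i (rank lam),
          f (frobeniusArm mu i - frobeniusArm mu j) =
        ∑ i ∈ Finset.range (rank lam), ∑ j ∈ Finset.Ioo i (rank lam),
          f (frobeniusArm lam i - frobeniusArm lam j) :=
      hrange fun i hi => Finset.sum_congr rfl fun j hj => by
        rw [(harm i hi).1, (harm j (Finset.mem_Ioo.mp hj).2).1, Nat.add_sub_add_right]
    have h5 : ∑ i ∈ Finset.range (rank lam), ∑ j ∈ Finset.Ioo i (rank lam),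
          f (frobeniusArm lam.transpose i - frobeniusArm lam.transpose j) =
        ∑ i ∈ Finset.range (rank lam), ∑ j ∈ Finset.Ioo i (rank lam),
          f (frobeniusArm mu.transpose i - frobeniusArm mu.transpose j) :=
      hrange fun i hi => Finset.sum_congr rfl fun j hj => by
        rw [(harm i hi).2, (harm j (Finset.mem_Ioo.mp hj).2).2, Nat.add_sub_add_right]
    have h6 : ∑ i ∈ Finset.range (rank lam), ∑ j ∈ Finset.range (rank lam),
          f (frobeniusArm mu i + frobeniusArm mu.transpose j + 1) =
        ∑ i ∈ Finset.range (rank lam), ∑ j ∈ Finset.range (rank lam),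
          f (frobeniusArm lam i + frobeniusArm lam.transpose j + 1) :=
      hrange fun i hi => hrange fun j hj => by
        rw [(harm i hi).1, (harm j hj).2]
        congr 1
        ring
    have h7 : ∑ i ∈ Finset.range (rank lam), ∑ a ∈ Finset.range (frobeniusArm mu i), f (a + 1) =
        ∑ i ∈ Finset.range (rank lam), ∑ a ∈ Finset.range (frobeniusArm lam i + k), f (a + 1) :=
      hrange fun i hi => by rw [(harm i hi).1]
    have h8 : ∑ i ∈ Finset.range (rank lam), ∑ a ∈ Finset.range (frobeniusArm lam.transpose i),
          f (a + 1) =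
        ∑ i ∈ Finset.range (rank lam), ∑ a ∈ Finset.range (frobeniusArm mu.transpose i + k),
          f (a + 1) :=
      hrange fun i hi => by rw [(harm i hi).2]
    linarith
  have h1 := (hcoord t ht).2
  have h2 := lt_rank_iff.mp ht
  have h3 := lt_rank_iff_lt_colLen.mp (hrank.symm ▸ ht)
  simp only [frobeniusArm, YoungDiagram.rowLen_transpose] at key
  omega

/-- Two partitions with the same hook lengths whose content distributions differ by a positive
shift are conjugate. -/
theorem eq_transpose_of_shift {k : ℕ} (hk : 0 < k) (hlam : lam ≠ ⊥)
    (hC : ∀ x, contentCount mu (x + k) = contentCount lam x)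
    (hH : hookLengths lam = hookLengths mu) :
    southPartition lam.transpose = southPartition lam ∧ mu = lam.transpose := by
  have h (t : ℕ) (ht : t < rank lam) := colLen_eq_add_of_shift hk hC hH ht
  refine ⟨(southPartition_transpose_eq_iff hlam).mpr ⟨k, h⟩, eq_of_contentCount_eq fun x => ?_⟩
  have h1 := hC (x - k)
  have h2 := contentCount_transpose_eq h (x - k)
  rw [sub_add_cancel] at h1 h2
  rw [h1, h2]

theorem eq_or_eq_transpose_of_shift (hlam : lam ≠ ⊥) (hmu : mu ≠ ⊥) {k : ℤ}
    (hC : ∀ x, contentCount mu (x + k) = contentCount lam x)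
    (hH : hookLengths lam = hookLengths mu) :
    lam = mu ∨ (eastPartition lam = (southPartition lam).transpose ∧ lam = mu.transpose) := by
  rw [eastPartition_eq_iff]
  rcases lt_trichotomy k 0 with hk | rfl | hk
  · right
    obtain ⟨h1, h2⟩ := eq_transpose_of_shift (lam := mu) (mu := lam) (k := k.natAbs) (by omega)
      hmu (fun x => by rw [← hC]; congr 1; omega) hH.symm
    rw [h2, YoungDiagram.transpose_transpose]
    exact ⟨h1.symm, rfl⟩
  · left
    exact eq_of_contentCount_eq fun x => by rw [← hC, add_zero]
  · right
    obtain ⟨h1, h2⟩ := eq_transpose_of_shift (mu := mu) (k := k.natAbs) (by omega)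
      hlam (fun x => by rw [← hC]; congr 1; omega) hH
    exact ⟨h1, by rw [h2, YoungDiagram.transpose_transpose]⟩

end Durfee

end Plethysm

end


noncomputable section

namespace Plethysm

section Equivalences

variable {lam mu : YoungDiagram}

theorem primePlethysticEquiv_refl {n : ℕ} (hn : 0 < n) (h : lam.colLen 0 ≤ n) :
    PrimePlethysticEquiv lam lam n n :=
  ⟨⟨hn, hn, h.trans n.le_succ, h.trans n.le_succ,
    (nonempty_equiv_iff_shiftedContents (h.trans n.le_succ) (h.trans n.le_succ)).mpr rfl⟩, h, h⟩

theorem exists_two_prime_refl (lam : YoungDiagram) :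
    ∃ n n' : ℕ, n ≠ n' ∧ PrimePlethysticEquiv lam lam n n ∧ PrimePlethysticEquiv lam lam n' n' :=
  ⟨lam.colLen 0 + 1, lam.colLen 0 + 2, by omega,
    primePlethysticEquiv_refl (by omega) (by omega),
    primePlethysticEquiv_refl (by omega) (by omega)⟩

theorem exists_three_prime_of_eq_or_eq_transpose (hlam : lam ≠ ⊥)
    (h : lam = mu ∨
      (eastPartition lam = (southPartition lam).transpose ∧ lam = mu.transpose)) :
    ∃ l m : ℕ, PrimePlethysticEquiv lam mu l m ∧
      PrimePlethysticEquiv lam mu (l + 1) (m + 1) ∧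
      PrimePlethysticEquiv lam mu (l + 2) (m + 2) := by
  rcases h with rfl | ⟨h1, h2⟩
  · exact ⟨lam.colLen 0 + 1, lam.colLen 0 + 1, primePlethysticEquiv_refl (by omega) (by omega),
      primePlethysticEquiv_refl (by omega) (by omega),
      primePlethysticEquiv_refl (by omega) (by omega)⟩
  · rw [eastPartition_eq_iff, southPartition_transpose_eq_iff hlam] at h1
    obtain ⟨k, hk⟩ := h1
    obtain rfl : mu = lam.transpose := by rw [h2, YoungDiagram.transpose_transpose]
    have key (l m : ℕ) (hl : 0 < l) (hm : 0 < m) (hll : lam.colLen 0 ≤ l)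
        (hmm : lam.transpose.colLen 0 ≤ m) (hlm : (l : ℤ) = m + k) :
        PrimePlethysticEquiv lam lam.transpose l m := by
      refine ⟨⟨hl, hm, by omega, by omega, ?_⟩, hll, hmm⟩
      rw [nonempty_equiv_iff_contentCount (by omega) (by omega)]
      intro x
      rw [hookLengths_transpose, ← contentCount_transpose_eq hk]
      congr 2
      linarith
    exact ⟨lam.colLen 0 + lam.transpose.colLen 0 + k.natAbs + k.toNat + 1,
      lam.colLen 0 + lam.transpose.colLen 0 + k.natAbs + (-k).toNat + 1,
      key _ _ (by omega) (by omega) (by omega) (by omega) (by omega),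
      key _ _ (by omega) (by omega) (by omega) (by omega) (by omega),
      key _ _ (by omega) (by omega) (by omega) (by omega) (by omega)⟩

theorem eq_or_eq_transpose_of_two_prime (hlam : lam ≠ ⊥) (hmu : mu ≠ ⊥) {l m l' m' : ℕ}
    (hne : (l, m) ≠ (l', m')) (h : PrimePlethysticEquiv lam mu l m)
    (h' : PrimePlethysticEquiv lam mu l' m') :
    lam = mu ∨ (eastPartition lam = (southPartition lam).transpose ∧ lam = mu.transpose) := by
  have h1 := rowLen_add_eq_of_prime hlam hmu h
  have h2 := rowLen_add_eq_of_prime hlam hmu h'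
  have hl : l ≠ l' := by
    rintro rfl
    exact hne (by rw [show m = m' by omega])
  obtain ⟨hC, hH⟩ := contentCount_eq_of_two_equivs h.1 h'.1 hl (by omega)
  exact eq_or_eq_transpose_of_shift hlam hmu hC hH

theorem PlethysticEquiv.prime_of_lt (hlam : lam ≠ ⊥) (hmu : mu ≠ ⊥) {l m l' m' : ℕ}
    (h : PlethysticEquiv lam mu l m) (h' : PlethysticEquiv lam mu l' m') (hlt : l < l') :
    PrimePlethysticEquiv lam mu l' m' := by
  have h1 := (lt_iff_lt_of_plethysticEquiv hlam hmu h h').mp hlt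
  have h2 := h.2.2.1
  have h3 := h.2.2.2.1
  exact ⟨h', by omega, by omega⟩

theorem PlethysticEquiv.left_ne (hlam : lam ≠ ⊥) (hmu : mu ≠ ⊥) {l m l' m' : ℕ}
    (h : PlethysticEquiv lam mu l m) (h' : PlethysticEquiv lam mu l' m')
    (hne : (l, m) ≠ (l', m')) : l ≠ l' := by
  rintro rfl
  have h1 := lt_iff_lt_of_plethysticEquiv hlam hmu h h'
  have h2 := lt_iff_lt_of_plethysticEquiv hlam hmu h' h
  exact hne (by rw [show m = m' by omega])

theorem eq_or_eq_transpose_of_three (hlam : lam ≠ ⊥) (hmu : mu ≠ ⊥) {l m l' m' l'' m'' : ℕ}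
    (hne : (l, m) ≠ (l', m')) (hne' : (l, m) ≠ (l'', m'')) (hne'' : (l', m') ≠ (l'', m''))
    (h : PlethysticEquiv lam mu l m) (h' : PlethysticEquiv lam mu l' m')
    (h'' : PlethysticEquiv lam mu l'' m'') :
    lam = mu ∨ (eastPartition lam = (southPartition lam).transpose ∧ lam = mu.transpose) := by
  have n1 := h.left_ne hlam hmu h' hne
  have n2 := h.left_ne hlam hmu h'' hne'
  have n3 := h'.left_ne hlam hmu h'' hne''
  rcases lt_or_gt_of_ne n1 with a | a
  · rcases lt_or_gt_of_ne n2 with b | b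
    · exact eq_or_eq_transpose_of_two_prime hlam hmu hne'' (h.prime_of_lt hlam hmu h' a)
        (h.prime_of_lt hlam hmu h'' b)
    · exact eq_or_eq_transpose_of_two_prime hlam hmu hne (h''.prime_of_lt hlam hmu h b)
        (h.prime_of_lt hlam hmu h' a)
  · rcases lt_or_gt_of_ne n3 with b | b
    · exact eq_or_eq_transpose_of_two_prime hlam hmu hne' (h'.prime_of_lt hlam hmu h a)
        (h'.prime_of_lt hlam hmu h'' b)
    · exact eq_or_eq_transpose_of_two_prime hlam hmu hne
        (h'.prime_of_lt hlam hmu h a) (h''.prime_of_lt hlam hmu h' b)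

end Equivalences

end Plethysm

end

open Plethysm in
theorem theorem1p4 (lam mu : YoungDiagram) (hlam : lam ≠ ⊥) (hmu : mu ≠ ⊥) :
    ((∃ l m l' m' : ℕ, (l, m) ≠ (l', m') ∧
        PrimePlethysticEquiv lam mu l m ∧ PrimePlethysticEquiv lam mu l' m') ↔
      (lam = mu ∨
        (eastPartition lam = (southPartition lam).transpose ∧ lam = mu.transpose))) ∧
    ((∃ l m l' m' l'' m'' : ℕ,
        (l, m) ≠ (l', m') ∧ (l, m) ≠ (l'', m'') ∧ (l', m') ≠ (l'', m'') ∧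
        PlethysticEquiv lam mu l m ∧ PlethysticEquiv lam mu l' m' ∧
        PlethysticEquiv lam mu l'' m'') ↔
      (lam = mu ∨
        (eastPartition lam = (southPartition lam).transpose ∧ lam = mu.transpose))) ∧
    ((∃ n n' : ℕ, n ≠ n' ∧ PlethysticEquiv lam mu n n ∧ PlethysticEquiv lam mu n' n') ↔
      lam = mu) := by
  refine ⟨⟨?_, fun h => ?_⟩, ⟨?_, fun h => ?_⟩, ⟨?_, ?_⟩⟩
  · rintro ⟨l, m, l', m', hne, h, h'⟩
    exact eq_or_eq_transpose_of_two_prime hlam hmu hne h h'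
  · obtain ⟨l, m, h1, h2, -⟩ := exists_three_prime_of_eq_or_eq_transpose hlam h
    exact ⟨l, m, l + 1, m + 1, by simp, h1, h2⟩
  · rintro ⟨l, m, l', m', l'', m'', hne, hne', hne'', h, h', h''⟩
    exact eq_or_eq_transpose_of_three hlam hmu hne hne' hne'' h h' h''
  · obtain ⟨l, m, h1, h2, h3⟩ := exists_three_prime_of_eq_or_eq_transpose hlam h
    exact ⟨l, m, l + 1, m + 1, l + 2, m + 2, by simp, by simp, by simp, h1.1, h2.1, h3.1⟩
  · rintro ⟨n, n', hne, h, h'⟩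
    have hC := (contentCount_eq_of_two_equivs h h' hne rfl).1
    simp only [sub_self, add_zero] at hC
    exact eq_of_contentCount_eq fun x => (hC x).symm
  · rintro rfl
    obtain ⟨n, n', hne, h, h'⟩ := exists_two_prime_refl lam
    exact ⟨n, n', hne, h.1, h'.1⟩
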